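/- Let $f\in\mathbb{Z}\setminus\{0,-1\}$ (a generic framing) and $g\ge 2$. Consider the framed mirror curve of $\mathbb{C}^3$, $$\Sigma_f^{\mathbb{C}^3}=\{X+Y^f+Y^{f+1}=0\}\subset(\mathbb{C}^*)^2,\qquad Y=t,\quad X=-t^f(1+t),$$ and, for $r\in\mathbb{C}\setminus\{0,1\}$ with $(f+2)^2r\neq f^2$, the framed mirror curve of the resolved conifold, $$\Sigma_{f}=\{1+XY^{-f}+Y+rXY^{-f-1}=0\}\subset(\mathbb{C}^*)^2,\qquad Y=t,\quad X=-\frac{t^{f+1}(1+t)}{r+t}.$$ For each of these genus zero curves let $a_\lambda$ be the ramification points on the curve of the map $X$ (they are simple), let $s_\lambda\neq\mathrm{id}$ be the deck transformation of $X$ near $a_\lambda$ (so $X\circ s_\lambda=X$ and $s_\lambda(a_\lambda)=a_\lambda$), and let $\omega=\log Y\,\frac{dX}{X}$. Let $W^g_n$ be the Eynard–Orantin correlation functions: $W^0_2(t_1,t_2)=\frac{dt_1dt_2}{(t_1-t_2)^2}$ and, for $2g-1+n>0$ and $S=\{p_1,\dots,p_n\}$, $$W^g_{n+1}(p_0,S)=\sum_\lambda\operatorname*{Res}_{q=a_\lambda}K_\lambda(p_0,q)\Big(W^{g-1}_{n+2}(q,s_\lambda(q),S)+\sum_{g_1+g_2=g,\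 I\sqcup J=S}W^{g_1}_{|I|+1}(q,I)\,W^{g_2}_{|J|+1}(s_\lambda(q),J)\Big),$$ $$K_\lambda(p_0,q)=\frac12\,\frac{\int_q^{s_\lambda(q)}W^0_2(p_0,\cdot)}{\omega(q)-\omega(s_\lambda(q))},$$ where terms containing $W^0_1$ are omitted, as is the term with $W^{g-1}_{n+2}$ when $g=0$. Let $\Phi$ be any primitive of $\omega$ (near each ramification point, for any base point and any branch of $\log Y$), and put $$F_g=\frac{(-1)^g}{2-2g}\sum_\lambda\operatorname*{Res}_{q=a_\lambda}\Phi(q)W^g_1(q).$$ Denote this number by $F_g^{\mathbb{C}^3}$ for $\Sigma_f^{\mathbb{C}^3}$ and by $F_g$ for $\Sigma_f$. Then $$\lim_{r\to0}F_g=2\,F_g^{\mathbb{C}^3}.$$ Moreover, for every $r\in\mathbb{C}\setminus\{0,1\}$ with $(f+2)^2r\neq f^2$, the curve $\Sigma_f$ has exactly two ramification points $a_0\ne a_1$ of $X$, the involution $t\mapsto r/t$ exchanges them, and they contribute equally to $F_g$: $$\frac{(-1)^g}{2-2g}\operatorname*{Res}_{q=a_0}\Phi(q)W_1^g(q)=\frac{(-1)^g}{2-2g}\operatorname*{Res}_{q=a_1}\Phi(q)W_1^g(q)=\tfrac12F_g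 .$$ -/

import Mathlib

open Filter Topology

/-- The residue at `a` of the one-form `F(q) dq`: the common value of `(2πi)⁻¹ ∮ F(q) dq` over all
sufficiently small circles around `a` (for `F` holomorphic on a punctured neighbourhood of `a`). -/
noncomputable def residue (F : ℂ → ℂ) (a : ℂ) : ℂ :=
  limUnder (𝓝[>] (0 : ℝ)) fun ε => (2 * Real.pi * Complex.I)⁻¹ * ∮ q in C(a, ε), F q

/-- A genus zero curve in `(ℂ*)²` together with a global coordinate `t`: the curve is
`{(X t, Y t) | t ∈ dom}`, and its compactification is the Riemann sphere with coordinate `t`. -/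
structure RationalCurve where
  /-- the values of the coordinate `t` on the (punctured) curve -/
  dom : Set ℂ
  /-- the first `ℂ*`-coordinate function, as a function of `t` -/
  X : ℂ → ℂ
  /-- the second `ℂ*`-coordinate function, as a function of `t` -/
  Y : ℂ → ℂ

namespace RationalCurve

variable (C : RationalCurve)

/-- `t ↦ (X t, Y t)` is a bijective holomorphic parametrization of the plane curve `S` by the
complement of a finite set in `ℂ`. -/
def Parametrizes (S : Set (ℂ × ℂ)) : Prop :=
  C.domᶜ.Finite ∧ DifferentiableOn ℂ C.X C.dom ∧ DifferentiableOn ℂ C.Y C.dom ∧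
    Set.BijOn (fun t => (C.X t, C.Y t)) C.dom S

/-- The ramification points on the curve of the map `X`. -/
def ram : Set ℂ := {a | a ∈ C.dom ∧ deriv C.X a = 0}

/-- `s` is (a representative of the germ of) the deck transformation of `X` near the simple
ramification point `a`: the nontrivial local holomorphic map fixing `a` with `X ∘ s = X`. -/
def IsDeck (a : ℂ) (s : ℂ → ℂ) : Prop :=
  AnalyticAt ℂ s a ∧ s a = a ∧ (∀ᶠ t in 𝓝 a, C.X (s t) = C.X t) ∧ ¬ s =ᶠ[𝓝 a] id

/-- The deck transformation `s_a`. Its germ at a simple ramification point `a` is unique. -/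
noncomputable def deck (a : ℂ) : ℂ → ℂ := Classical.epsilon (C.IsDeck a)

/-- A branch of `log Y`, holomorphic near `a`. -/
noncomputable def logY (a t : ℂ) : ℂ := Complex.log (C.Y t / C.Y a) + Complex.log (C.Y a)

/-- The coefficient of `dt` in the one-form `ω = log Y dX / X`, near `a`. -/
noncomputable def omega (a t : ℂ) : ℂ := C.logY a t * logDeriv C.X t

/-- The Eynard kernel `K_a(z, q) = ½ (∫_q^{s q} W₂⁰(z, ·)) / (ω(q) - ω(s q))`, without the
factor `dz / dq`. As `W₂⁰(z, q') = dz dq' / (z - q')²`, the integral in the numerator is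
`(1 / (z - s q) - 1 / (z - q)) dz`; the one-form `ω(s q)` is the pullback of `ω` by `s`. -/
noncomputable def kernel (a z q : ℂ) : ℂ :=
  1 / 2 * (1 / (z - C.deck a q) - 1 / (z - q)) /
    (C.omega a q - C.omega a (C.deck a q) * deriv (C.deck a) q)

/-- The correlation functions of the Eynard–Orantin topological recursion on the Riemann sphere:
`W^g_{n+1}(z, S) = C.corr g n z S · dz dS₁ ⋯ dSₙ`. The bidifferential `W⁰₂` is the Cauchy kernel
`dz dS₁ / (z - S₁)²`; the terms of the recursion that involve the absent `W⁰₁` are left out, and so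
is the one with `W^{g-1}` if `g = 0`. The factor `s'(q)` comes from the slot evaluated
at `s(q)`. -/
noncomputable def corr : (g n : ℕ) → ℂ → (Fin n → ℂ) → ℂ
  | 0, 0, _, _ => 0
  | 0, 1, z, S => 1 / (z - S 0) ^ 2
  | g, n, z, S => ∑ᶠ a ∈ C.ram, residue (fun q =>
      C.kernel a z q * deriv (C.deck a) q *
        ((if _ : 0 < g then corr (g - 1) (n + 1) q (Fin.cons (C.deck a q) S) else 0) +
          ∑ m : Fin (g + 1), ∑ I : Finset (Fin n),
            if _ : ¬ (m.val = 0 ∧ I = ∅) ∧ ¬ (g - m.val = 0 ∧ Iᶜ = ∅) then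
              corr m.val I.card q (fun i => S (I.orderEmbOfFin rfl i)) *
                corr (g - m.val) Iᶜ.card (C.deck a q) (fun i => S (Iᶜ.orderEmbOfFin rfl i))
            else 0)) a
  termination_by g n => 2 * g + n
  decreasing_by
    · omega
    · rename_i h
      have h1 := m.isLt
      have h2 := Finset.card_add_card_compl I
      rw [Fintype.card_fin] at h2
      rw [← Finset.card_eq_zero, ← Finset.card_eq_zero] at h
      omega
    · rename_i h
      have h1 := m.isLt
      have h2 := Finset.card_add_card_compl I
      rw [Fintype.card_fin] at h2
      rw [← Finset.card_eq_zero, ← Finset.card_eq_zero] at h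
      omega

theorem corr_zero_zero (z : ℂ) (S : Fin 0 → ℂ) : C.corr 0 0 z S = 0 := by
  rw [corr]

theorem corr_zero_one (z : ℂ) (S : Fin 1 → ℂ) : C.corr 0 1 z S = 1 / (z - S 0) ^ 2 := by
  rw [corr]

/-- The topological recursion in the stable range. -/
theorem corr_recursion (g n : ℕ) (h : 2 ≤ 2 * g + n) (z : ℂ) (S : Fin n → ℂ) :
    C.corr g n z S = ∑ᶠ a ∈ C.ram, residue (fun q =>
      C.kernel a z q * deriv (C.deck a) q *
        ((if 0 < g then C.corr (g - 1) (n + 1) q (Fin.cons (C.deck a q) S) else 0) +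
          ∑ m : Fin (g + 1), ∑ I : Finset (Fin n),
            if ¬ (m.val = 0 ∧ I = ∅) ∧ ¬ (g - m.val = 0 ∧ Iᶜ = ∅) then
              C.corr m.val I.card q (fun i => S (I.orderEmbOfFin rfl i)) *
                C.corr (g - m.val) Iᶜ.card (C.deck a q) (fun i => S (Iᶜ.orderEmbOfFin rfl i))
            else 0)) a := by
  rw [corr]
  · rfl
  · intro h1 h2; omega
  · intro h1 h2; omega

/-- `Φ` is a choice of primitive of `ω = log Y dX / X` near each ramification point: near `a`,
`Φ a` is a primitive of `L dX / X` for some holomorphic branch `L` of `log Y`. (The integral of `ω`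
from a base point depends near `a` on the base point, the path and the branch of `log Y`; all
these choices are allowed here.) -/
def IsPrimitive (Φ : ℂ → ℂ → ℂ) : Prop :=
  ∀ a ∈ C.ram, ∃ L : ℂ → ℂ, AnalyticAt ℂ L a ∧ (∀ᶠ t in 𝓝 a, Complex.exp (L t) = C.Y t) ∧
    ∀ᶠ t in 𝓝 a, HasDerivAt (Φ a) (L t * logDeriv C.X t) t

/-- The contribution `(-1)^g / (2 - 2g) · Res_{q = a} Φ(q) W^g_1(q)` of the ramification point `a`
to the free energy `F_g`. -/
noncomputable def contribution (Φ : ℂ → ℂ → ℂ) (g : ℕ) (a : ℂ) : ℂ :=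
  (-1) ^ g / (2 - 2 * g) * residue (fun q => Φ a q * C.corr g 0 q Fin.elim0) a

/-- The free energy `F_g = (-1)^g / (2 - 2g) · ∑_a Res_{q = a} Φ(q) W^g_1(q)`, for `g ≥ 2`. -/
noncomputable def freeEnergy (Φ : ℂ → ℂ → ℂ) (g : ℕ) : ℂ :=
  ∑ᶠ a ∈ C.ram, C.contribution Φ g a

end RationalCurve

/-- The framed mirror curve of `ℂ³`: `X + Y^f + Y^(f+1) = 0` in `(ℂ*)²`. -/
def c3Locus (f : ℤ) : Set (ℂ × ℂ) :=
  {p | p.1 ≠ 0 ∧ p.2 ≠ 0 ∧ p.1 + p.2 ^ f + p.2 ^ (f + 1) = 0}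

/-- The framed mirror curve of `ℂ³`, with coordinate `t = Y`. -/
noncomputable def c3Curve (f : ℤ) : RationalCurve where
  dom := {t | t ≠ 0 ∧ 1 + t ≠ 0}
  X := fun t => -(t ^ f * (1 + t))
  Y := fun t => t

/-- The framed mirror curve of the resolved conifold:
`1 + X Y^(-f) + Y + r X Y^(-f-1) = 0` in `(ℂ*)²`. -/
def conifoldLocus (f : ℤ) (r : ℂ) : Set (ℂ × ℂ) :=
  {p | p.1 ≠ 0 ∧ p.2 ≠ 0 ∧
    1 + p.1 * p.2 ^ (-f) + p.2 + r * p.1 * p.2 ^ (-f - 1) = 0}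

/-- The framed mirror curve of the resolved conifold, with coordinate `t = Y`. -/
noncomputable def conifoldCurve (f : ℤ) (r : ℂ) : RationalCurve where
  dom := {t | t ≠ 0 ∧ 1 + t ≠ 0 ∧ r + t ≠ 0}
  X := fun t => -(t ^ (f + 1) * (1 + t) / (r + t))
  Y := fun t => t

theorem c3Curve_parametrizes (f : ℤ) : (c3Curve f).Parametrizes (c3Locus f) := by
  refine ⟨?_, ?_, differentiableOn_id, ?_, ?_, ?_⟩
  · refine (Set.toFinite ({0, -1} : Set ℂ)).subset fun t ht => ?_
    simp only [c3Curve, Set.mem_compl_iff, Set.mem_ofPred_eq, not_and_or, not_not] at ht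
    rcases ht with h | h
    · exact Or.inl h
    · exact Or.inr (by rw [Set.mem_singleton_iff]; linear_combination h)
  · intro t ht
    have h0 : t ≠ 0 := ht.1
    exact (((differentiableAt_zpow.2 (Or.inl h0)).mul
      (by fun_prop : DifferentiableAt ℂ (fun t : ℂ => 1 + t) t)).neg).differentiableWithinAt
  · rintro t ⟨h0, h1⟩
    refine ⟨neg_ne_zero.2 (mul_ne_zero (zpow_ne_zero _ h0) h1), h0, ?_⟩
    simp only [c3Curve]
    rw [zpow_add_one₀ h0]
    ring
  · intro t _ u _ h
    exact (Prod.ext_iff.1 h).2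
  · rintro ⟨x, y⟩ ⟨hx, hy, h⟩
    simp only at hx hy h
    rw [zpow_add_one₀ hy] at h
    have e : x = -(y ^ f * (1 + y)) := by linear_combination h
    refine ⟨y, ⟨hy, fun h1 => hx ?_⟩, ?_⟩
    · rw [e, h1]; simp
    · simp only [c3Curve]; rw [e]

theorem conifoldCurve_parametrizes (f : ℤ) (r : ℂ) (hr : r ≠ 1) :
    (conifoldCurve f r).Parametrizes (conifoldLocus f r) := by
  have key : ∀ x y : ℂ, y ≠ 0 → (1 + x * y ^ (-f) + y + r * x * y ^ (-f - 1)) * y ^ (f + 1) =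
      y ^ (f + 1) * (1 + y) + x * (r + y) := by
    intro x y hy
    have e1 : y ^ (-f) * y ^ (f + 1) = y := by rw [← zpow_add₀ hy]; simp
    have e2 : y ^ (-f - 1) * y ^ (f + 1) = 1 := by rw [← zpow_add₀ hy]; simp
    linear_combination x * e1 + r * x * e2
  refine ⟨?_, ?_, differentiableOn_id, ?_, ?_, ?_⟩
  · refine (Set.toFinite ({0, -1, -r} : Set ℂ)).subset fun t ht => ?_
    simp only [conifoldCurve, Set.mem_compl_iff, Set.mem_ofPred_eq, not_and_or, not_not] at ht
    rcases ht with h | h | h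
    · exact Or.inl h
    · exact Or.inr (Or.inl (by linear_combination h))
    · exact Or.inr (Or.inr (by rw [Set.mem_singleton_iff]; linear_combination h))
  · rintro t ⟨h0, h1, h2⟩
    exact ((((differentiableAt_zpow.2 (Or.inl h0)).mul
      (by fun_prop : DifferentiableAt ℂ (fun t : ℂ => 1 + t) t)).div
      (by fun_prop : DifferentiableAt ℂ (fun t : ℂ => r + t) t) h2).neg).differentiableWithinAt
  · rintro t ⟨h0, h1, h2⟩
    refine ⟨neg_ne_zero.2 (div_ne_zero (mul_ne_zero (zpow_ne_zero _ h0) h1) h2), h0, ?_⟩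
    refine (mul_eq_zero_iff_right (zpow_ne_zero (f + 1) h0)).1 ?_
    refine (key _ t h0).trans ?_
    simp only [conifoldCurve]
    field_simp
    ring
  · intro t _ u _ h
    exact (Prod.ext_iff.1 h).2
  · rintro ⟨x, y⟩ ⟨hx, hy, h⟩
    simp only at hx hy h
    have e := key x y hy
    rw [h, zero_mul] at e
    have hz := zpow_ne_zero (f + 1) hy
    have h2 : r + y ≠ 0 := by
      intro h2
      rw [h2, mul_zero, add_zero] at e
      rcases mul_eq_zero.1 e.symm with h3 | h3
      · exact hz h3
      · exact hr (by linear_combination h2 - h3)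
    have h1 : 1 + y ≠ 0 := by
      intro h1
      rw [h1, mul_zero, zero_add] at e
      exact (mul_ne_zero hx h2) e.symm
    refine ⟨y, ⟨hy, h1, h2⟩, ?_⟩
    simp only [conifoldCurve]
    congr 1
    rw [← neg_div, div_eq_iff h2]
    linear_combination e

/-! The ramification condition is linear in r, so the conifold family can be parametrized by a
ramification point `a`, with r = `ramParam f a` holomorphic near every admissible `a`. This function
has a simple zero at a₀ = -f/(f+1), where the curve is the one of ℂ³ (`c3Curve_eq`). Hence r → 0 may
be replaced by a → a₀ (`map_ramParam_base`). The second ramification point r/a tends to 0 and leaves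
the curve.

Symmetry. The involution σ(t) = r/t sends (X, Y) to (r^f/X, r/Y), so σ*ω = ω - log r · dX/X. Since
dX/X is invariant under the deck transformation, the denominator of the kernel does not change. The
Cauchy kernel W⁰₂ is σ-invariant too, so by induction every W^g_n is (`recursionResidue_inversion`,
`StableForm.eventually_flipInvariant`). The two contributions to F_g therefore agree as soon as F_g
does not depend on the constant in log Y.

Independence of that constant. In the coordinate ζ with X = X(a) exp(ζ²), changing log Y by κ
changes Φ by κζ² plus a constant. The pole part of W^g_1 at a is a residue in q of the difference of
the Cauchy kernels at s(q) and q. Constants and ζ² take equal values at s(q) and q, so both pair to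
zero with it (`exists_residue_kernel_eq`).

Analyticity. By induction on 2g + n (`IsCoordinate.stableForm`), W^g_{n+1} is a finite sum of
products of pole parts at a, plus their images under σ, with coefficients analytic in a. The images
carry a factor r, so the same formula is valid at r = 0, where only a ramifies. Consequently the
contribution of a is a function E(a) analytic at a₀ (`IsCoordinate.exists_contribution_eq`). For r ≠
0 one gets F_g = 2E(a), while the free energy of ℂ³ is E(a₀): the lost point keeps contributing E(a)
all the way to the limit. -/

/-! ### Residues of meromorphic functions -/

/-- `F` is integrable over all sufficiently small circles around `a`, with integral `2πi v`. -/
def HasResidue (F : ℂ → ℂ) (a v : ℂ) : Prop :=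
  ∀ᶠ ε in 𝓝[>] (0 : ℝ), CircleIntegrable F a ε ∧ (∮ q in C(a, ε), F q) = 2 * Real.pi * Complex.I * v

theorem eventually_sphere_of_punctured {P : ℂ → Prop} {a : ℂ} (h : ∀ᶠ q in 𝓝[≠] a, P q) :
    ∀ᶠ ε in 𝓝[>] (0 : ℝ), 0 < ε ∧ ∀ q ∈ Metric.sphere a ε, P q := by
  rw [eventually_nhdsWithin_iff, Metric.eventually_nhds_iff] at h
  obtain ⟨δ, hδ, h⟩ := h
  filter_upwards [Ioo_mem_nhdsGT hδ] with ε hε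
  refine ⟨hε.1, fun q hq => h ?_ ?_⟩
  · rw [Metric.mem_sphere.1 hq]; exact hε.2
  · rintro rfl
    simp only [Metric.mem_sphere, dist_self] at hq
    exact hε.1.ne hq

namespace HasResidue

variable {F G : ℂ → ℂ} {a u v : ℂ}

theorem residue_eq (h : HasResidue F a v) : residue F a = v := by
  refine Tendsto.limUnder_eq (tendsto_const_nhds.congr' ?_)
  filter_upwards [h] with ε hε
  rw [hε.2, ← mul_assoc, inv_mul_cancel₀ Complex.two_pi_I_ne_zero, one_mul]

theorem unique (h : HasResidue F a v) (h' : HasResidue F a u) : v = u :=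
  h.residue_eq.symm.trans h'.residue_eq

theorem congr (h : HasResidue F a v) (hFG : F =ᶠ[𝓝[≠] a] G) : HasResidue G a v := by
  filter_upwards [h, eventually_sphere_of_punctured hFG] with ε hε hs
  refine ⟨(circleIntegrable_congr fun q hq => ?_).1 hε.1, ?_⟩
  · rw [abs_of_pos hs.1] at hq; exact hs.2 q hq
  · rw [← hε.2]
    exact circleIntegral.integral_congr hs.1.le fun q hq => (hs.2 q hq).symm

theorem add (h : HasResidue F a v) (h' : HasResidue G a u) :
    HasResidue (fun q => F q + G q) a (v + u) := by
  filter_upwards [h, h'] with ε h1 h2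
  refine ⟨h1.1.add h2.1, ?_⟩
  rw [circleIntegral.integral_add h1.1 h2.1, h1.2, h2.2]
  ring

theorem const_mul (c : ℂ) (h : HasResidue F a v) : HasResidue (fun q => c * F q) a (c * v) := by
  filter_upwards [h] with ε h1
  refine ⟨by simpa [smul_eq_mul] using h1.1.const_fun_smul (a := c), ?_⟩
  rw [circleIntegral.integral_const_mul, h1.2]
  ring

theorem zero : HasResidue (fun _ => 0) a 0 := by
  refine Eventually.of_forall fun ε => ⟨circleIntegrable_const 0 a ε, ?_⟩
  simp [circleIntegral]

theorem sum {ι : Type*} (s : Finset ι) {F : ι → ℂ → ℂ} {v : ι → ℂ}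
    (h : ∀ i ∈ s, HasResidue (F i) a (v i)) :
    HasResidue (fun q => ∑ i ∈ s, F i q) a (∑ i ∈ s, v i) := by
  classical
  induction s using Finset.induction_on with
  | empty => simpa using zero
  | insert i s hi ih =>
    simp only [Finset.sum_insert hi]
    exact (h i (Finset.mem_insert_self i s)).add
      (ih fun j hj => h j (Finset.mem_insert_of_mem hj))

theorem of_analyticAt (h : AnalyticAt ℂ F a) : HasResidue F a 0 := by
  obtain ⟨δ, hδ, hb⟩ := Metric.eventually_nhds_iff_ball.1 h.eventually_analyticAt
  filter_upwards [Ioo_mem_nhdsGT hδ] with ε hε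
  have hsub : Metric.closedBall a ε ⊆ Metric.ball a δ := Metric.closedBall_subset_ball hε.2
  have hd : DifferentiableOn ℂ F (Metric.closedBall a ε) := fun q hq =>
    (hb q (hsub hq)).differentiableAt.differentiableWithinAt
  refine ⟨(hd.continuousOn.mono Metric.sphere_subset_closedBall).circleIntegrable hε.1.le, ?_⟩
  rw [mul_zero]
  exact Complex.circleIntegral_eq_zero_of_differentiable_on_off_countable hε.1.le
    Set.countable_empty hd.continuousOn
    fun q hq => (hb q (hsub (Metric.ball_subset_closedBall hq.1))).differentiableAt

theorem inv_sub : HasResidue (fun q => (q - a)⁻¹) a 1 := by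
  filter_upwards [self_mem_nhdsWithin] with ε hε
  have hε : 0 < ε := hε
  refine ⟨circleIntegrable_sub_inv_iff.2 (Or.inr ?_), ?_⟩
  · simp [abs_of_pos hε, hε.ne]
  · rw [circleIntegral.integral_sub_center_inv a hε.ne', mul_one]

/-- An exact form integrates to zero over a closed circle. This is the source of every integration
by parts below. -/
theorem deriv_of_meromorphicAt (h : MeromorphicAt G a) : HasResidue (deriv G) a 0 := by
  filter_upwards [eventually_sphere_of_punctured h.eventually_analyticAt] with ε hε
  refine ⟨ContinuousOn.circleIntegrable hε.1.le fun q hq =>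
    (hε.2 q hq).deriv.continuousAt.continuousWithinAt, ?_⟩
  rw [mul_zero]
  exact circleIntegral.integral_eq_zero_of_hasDerivWithinAt hε.1.le fun q hq =>
    (hε.2 q hq).differentiableAt.hasDerivAt.hasDerivWithinAt

theorem inv_sub_mul (h : AnalyticAt ℂ F a) : HasResidue (fun q => (q - a)⁻¹ * F q) a (F a) := by
  have hd : AnalyticAt ℂ (dslope F a) a := by
    obtain ⟨p, hp⟩ := h
    exact hp.has_fpower_series_dslope_fslope.analyticAt
  have := (inv_sub (a := a)).const_mul (F a) |>.add (of_analyticAt hd)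
  rw [mul_one, add_zero] at this
  refine this.congr ?_
  filter_upwards [self_mem_nhdsWithin] with q hq
  have hq : q ≠ a := hq
  have hqa := sub_ne_zero.2 hq
  rw [dslope_of_ne _ hq, slope_def_field]
  field_simp
  ring

end HasResidue

theorem hasDerivAt_inv_sub_pow_mul {H : ℂ → ℂ} {a q H' : ℂ} (N : ℕ) (hq : q ≠ a)
    (hH : HasDerivAt H H' q) :
    HasDerivAt (fun q => ((q - a) ^ (N + 1))⁻¹ * H q)
      (-((N + 1) * (((q - a) ^ (N + 2))⁻¹ * H q)) + ((q - a) ^ (N + 1))⁻¹ * H') q := by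
  have hqa := sub_ne_zero.2 hq
  have h1 : HasDerivAt (fun q => (q - a) ^ (N + 1)) ((N + 1 : ℕ) * (q - a) ^ N * 1) q :=
    ((hasDerivAt_id' q).sub_const a).fun_pow (N + 1)
  refine ((h1.fun_inv (pow_ne_zero _ hqa)).mul hH).congr_deriv ?_
  push_cast
  field_simp
  ring

theorem meromorphicAt_inv_sub_pow_mul {H : ℂ → ℂ} {a : ℂ} (N : ℕ) (hH : AnalyticAt ℂ H a) :
    MeromorphicAt (fun q => ((q - a) ^ N)⁻¹ * H q) a := by
  have h1 : AnalyticAt ℂ (fun q => (q - a) ^ N) a := by fun_prop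
  exact h1.meromorphicAt.inv.mul hH.meromorphicAt

/-- Integration by parts lowers the order of the pole. -/
theorem HasResidue.inv_sub_pow_mul_succ {H : ℂ → ℂ} {a v : ℂ} (N : ℕ) (hH : AnalyticAt ℂ H a)
    (h : HasResidue (fun q => ((q - a) ^ (N + 1))⁻¹ * deriv H q) a v) :
    HasResidue (fun q => ((q - a) ^ (N + 2))⁻¹ * H q) a ((N + 1 : ℂ)⁻¹ * v) := by
  have h0 := HasResidue.deriv_of_meromorphicAt (meromorphicAt_inv_sub_pow_mul (N + 1) hH)
  have h1 := (h.add (h0.const_mul (-1))).const_mul (N + 1 : ℂ)⁻¹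
  rw [mul_zero, add_zero] at h1
  refine h1.congr ?_
  filter_upwards [self_mem_nhdsWithin, nhdsWithin_le_nhds hH.eventually_analyticAt] with q hq ha
  rw [(hasDerivAt_inv_sub_pow_mul N hq ha.differentiableAt.hasDerivAt).deriv]
  have : (N + 1 : ℂ) ≠ 0 := by exact_mod_cast N.succ_ne_zero
  field_simp
  ring

theorem exists_hasResidue_inv_sub_pow_mul {a : ℂ} (N : ℕ) :
    ∀ H : ℂ → ℂ, AnalyticAt ℂ H a → ∃ v, HasResidue (fun q => ((q - a) ^ N)⁻¹ * H q) a v := by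
  induction N with
  | zero => exact fun H hH => ⟨0, by simpa using HasResidue.of_analyticAt hH⟩
  | succ N ih =>
    intro H hH
    cases N with
    | zero => exact ⟨H a, by simpa using HasResidue.inv_sub_mul hH⟩
    | succ N =>
      obtain ⟨v, hv⟩ := ih _ hH.deriv
      exact ⟨_, hv.inv_sub_pow_mul_succ N hH⟩

theorem MeromorphicAt.exists_eq_inv_sub_pow_mul {F : ℂ → ℂ} {a : ℂ} (hF : MeromorphicAt F a) :
    ∃ (N : ℕ) (H : ℂ → ℂ), AnalyticAt ℂ H a ∧ F =ᶠ[𝓝[≠] a] fun q => ((q - a) ^ N)⁻¹ * H q := by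
  obtain ⟨N, hN⟩ := hF
  refine ⟨N, _, hN, ?_⟩
  filter_upwards [self_mem_nhdsWithin] with q hq
  rw [smul_eq_mul, inv_mul_cancel_left₀ (pow_ne_zero _ (sub_ne_zero.2 hq))]

theorem MeromorphicAt.hasResidue {F : ℂ → ℂ} {a : ℂ} (hF : MeromorphicAt F a) :
    HasResidue F a (residue F a) := by
  obtain ⟨N, H, hH, e⟩ := hF.exists_eq_inv_sub_pow_mul
  obtain ⟨v, hv⟩ := exists_hasResidue_inv_sub_pow_mul N H hH
  have := hv.congr e.symm
  rwa [this.residue_eq]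

/-- No meromorphy is needed: the circle integrals themselves agree for small radii, so the limits
agree even if they are default values. -/
theorem residue_congr {F G : ℂ → ℂ} {a : ℂ} (h : F =ᶠ[𝓝[≠] a] G) : residue F a = residue G a := by
  unfold residue limUnder
  congr 1
  refine Filter.map_congr ?_
  filter_upwards [eventually_sphere_of_punctured h] with ε hε
  rw [circleIntegral.integral_congr hε.1.le fun q hq => hε.2 q hq]

/-! ### Change of variable and linearity for residues. -/

theorem tendsto_punctured_of_deriv_ne_zero {χ : ℂ → ℂ} {x : ℂ} (hχ : AnalyticAt ℂ χ x)
    (hd : deriv χ x ≠ 0) : Tendsto χ (𝓝[≠] x) (𝓝[≠] (χ x)) :=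
  hχ.differentiableAt.hasDerivAt.tendsto_nhdsNE hd

/-- Induction on the order of the pole. A pole of order at least two is lowered by integrating by
parts on both sides; a simple pole is handled by writing χ ζ - χ x = (ζ - x) times the nonvanishing
`dslope χ x`. -/
theorem HasResidue.comp_inv_sub_pow_mul {χ : ℂ → ℂ} {x : ℂ} (hχ : AnalyticAt ℂ χ x)
    (hd : deriv χ x ≠ 0) (N : ℕ) : ∀ (H : ℂ → ℂ) (v : ℂ), AnalyticAt ℂ H (χ x) →
      HasResidue (fun q => ((q - χ x) ^ N)⁻¹ * H q) (χ x) v →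
      HasResidue (fun ζ => ((χ ζ - χ x) ^ N)⁻¹ * H (χ ζ) * deriv χ ζ) x v := by
  have hχ' : ∀ᶠ ζ in 𝓝[≠] x, AnalyticAt ℂ χ ζ := nhdsWithin_le_nhds hχ.eventually_analyticAt
  have hne : ∀ᶠ ζ in 𝓝[≠] x, χ ζ ≠ χ x :=
    (tendsto_punctured_of_deriv_ne_zero hχ hd).eventually self_mem_nhdsWithin
  induction N with
  | zero =>
    intro H v hH h
    simp only [pow_zero, inv_one, one_mul] at h ⊢
    rw [h.unique (HasResidue.of_analyticAt hH)]
    exact HasResidue.of_analyticAt ((hH.comp hχ).mul hχ.deriv)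
  | succ N ih =>
    intro H v hH h
    cases N with
    | zero =>
      simp only [zero_add, pow_one] at h ⊢
      rw [h.unique (HasResidue.inv_sub_mul hH)]
      have hs : AnalyticAt ℂ (dslope χ x) x := by
        obtain ⟨p, hp⟩ := hχ
        exact hp.has_fpower_series_dslope_fslope.analyticAt
      have hs0 : dslope χ x x ≠ 0 := by rwa [dslope_same]
      have := HasResidue.inv_sub_mul (((hs.inv hs0).mul (hH.comp hχ)).mul hχ.deriv)
      have e : (((dslope χ x)⁻¹ * (H ∘ χ)) * deriv χ) x = H (χ x) := by
        simp only [Pi.mul_apply, Pi.inv_apply, Function.comp, dslope_same]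
        field_simp
      rw [e] at this
      refine this.congr ?_
      filter_upwards [self_mem_nhdsWithin, hne] with ζ hζ h1
      have h2 := sub_ne_zero.2 h1
      have hζ' := sub_ne_zero.2 hζ
      simp only [Pi.mul_apply, Pi.inv_apply, Function.comp, dslope_of_ne _ hζ, slope_def_field]
      field_simp
    | succ N =>
      obtain ⟨w, hw⟩ := exists_hasResidue_inv_sub_pow_mul (N + 1) _ hH.deriv
      rw [h.unique (hw.inv_sub_pow_mul_succ N hH)]
      have hm : MeromorphicAt (fun ζ => ((χ ζ - χ x) ^ (N + 1))⁻¹ * H (χ ζ)) x :=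
        ((hχ.sub analyticAt_const).pow _).meromorphicAt.inv.mul (hH.comp hχ).meromorphicAt
      have h0 := HasResidue.deriv_of_meromorphicAt hm
      have h1 := ((ih _ _ hH.deriv hw).add (h0.const_mul (-1))).const_mul (N + 1 : ℂ)⁻¹
      rw [mul_zero, add_zero] at h1
      refine h1.congr ?_
      filter_upwards [hχ', hne, (tendsto_punctured_of_deriv_ne_zero hχ hd).eventually
        (nhdsWithin_le_nhds hH.eventually_analyticAt)] with ζ ha hb hc
      have := (hasDerivAt_inv_sub_pow_mul N hb hc.differentiableAt.hasDerivAt).comp ζ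
        ha.differentiableAt.hasDerivAt
      have e := this.deriv
      simp only [Function.comp_def] at e
      rw [e]
      have : (N + 1 : ℂ) ≠ 0 := by exact_mod_cast N.succ_ne_zero
      field_simp
      ring

theorem HasResidue.comp {F χ : ℂ → ℂ} {x v : ℂ} (hF : MeromorphicAt F (χ x))
    (h : HasResidue F (χ x) v) (hχ : AnalyticAt ℂ χ x) (hd : deriv χ x ≠ 0) :
    HasResidue (fun ζ => F (χ ζ) * deriv χ ζ) x v := by
  obtain ⟨N, H, hH, e⟩ := hF.exists_eq_inv_sub_pow_mul
  refine (HasResidue.comp_inv_sub_pow_mul hχ hd N H v hH (h.congr e)).congr ?_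
  filter_upwards [(tendsto_punctured_of_deriv_ne_zero hχ hd).eventually e] with ζ hζ
  rw [hζ]

/-- Invariance of the residue under a change of coordinate. -/
theorem residue_comp {F χ : ℂ → ℂ} {x : ℂ} (hχ : AnalyticAt ℂ χ x) (hd : deriv χ x ≠ 0)
    (hF : MeromorphicAt (fun ζ => F (χ ζ)) x) :
    residue F (χ x) = residue (fun ζ => F (χ ζ) * deriv χ ζ) x := by
  have hF' : MeromorphicAt F (χ x) := (meromorphicAt_comp_iff_of_deriv_ne_zero hχ hd).1 hF
  exact ((hF'.hasResidue.comp hF' hχ hd).residue_eq).symm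

theorem residue_add {F G : ℂ → ℂ} {a : ℂ} (hF : MeromorphicAt F a) (hG : MeromorphicAt G a) :
    residue (fun q => F q + G q) a = residue F a + residue G a :=
  (hF.hasResidue.add hG.hasResidue).residue_eq

theorem residue_const_mul {F : ℂ → ℂ} {a : ℂ} (c : ℂ) (hF : MeromorphicAt F a) :
    residue (fun q => c * F q) a = c * residue F a :=
  (hF.hasResidue.const_mul c).residue_eq

theorem residue_sum {ι : Type*} (s : Finset ι) {F : ι → ℂ → ℂ} {a : ℂ}
    (hF : ∀ i ∈ s, MeromorphicAt (F i) a) :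
    residue (fun q => ∑ i ∈ s, F i q) a = ∑ i ∈ s, residue (F i) a :=
  (HasResidue.sum s fun i hi => (hF i hi).hasResidue).residue_eq

theorem residue_analyticAt {F : ℂ → ℂ} {a : ℂ} (hF : AnalyticAt ℂ F a) : residue F a = 0 :=
  (HasResidue.of_analyticAt hF).residue_eq

theorem residue_deriv {F : ℂ → ℂ} {a : ℂ} (hF : MeromorphicAt F a) : residue (deriv F) a = 0 :=
  (HasResidue.deriv_of_meromorphicAt hF).residue_eq

/-! ### Families -/

theorem eventually_fiber {P : ℂ × ℂ → Prop} {a₀ : ℂ} (h : ∀ᶠ p in 𝓝 (a₀, (0 : ℂ)), P p) :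
    ∀ᶠ a in 𝓝 a₀, ∀ᶠ ζ in 𝓝 (0 : ℂ), P (a, ζ) := by
  rw [nhds_prod_eq] at h
  exact h.curry

theorem AnalyticAt.fiber {H : ℂ × ℂ → ℂ} {a ζ : ℂ} (h : AnalyticAt ℂ H (a, ζ)) :
    AnalyticAt ℂ (fun w => H (a, w)) ζ :=
  h.comp (g := H) (f := fun w => (a, w)) (by fun_prop)

theorem AnalyticAt.eventually_fiber {H : ℂ × ℂ → ℂ} {a₀ : ℂ} (h : AnalyticAt ℂ H (a₀, 0)) :
    ∀ᶠ a in 𝓝 a₀, AnalyticAt ℂ (fun w => H (a, w)) 0 := by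
  filter_upwards [_root_.eventually_fiber h.eventually_analyticAt] with a ha
  exact ha.self_of_nhds.fiber

theorem AnalyticAt.partial_deriv {H : ℂ × ℂ → ℂ} {a₀ : ℂ} (h : AnalyticAt ℂ H (a₀, 0)) :
    AnalyticAt ℂ (fun p : ℂ × ℂ => deriv (fun w => H (p.1, w)) p.2) (a₀, 0) := by
  have h1 : AnalyticAt ℂ (fun p => fderiv ℂ H p ((0, 1) : ℂ × ℂ)) (a₀, 0) :=
    ((ContinuousLinearMap.apply ℂ ℂ ((0, 1) : ℂ × ℂ)).analyticAt _).comp h.fderiv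
  refine h1.congr ?_
  filter_upwards [h.eventually_analyticAt] with p hp
  have h2 : HasFDerivAt H (fderiv ℂ H p) (p.1, p.2) := hp.differentiableAt.hasFDerivAt
  have h3 : HasDerivAt (fun w : ℂ => (p.1, w)) ((0, 1) : ℂ × ℂ) p.2 :=
    (hasDerivAt_const _ _).prodMk (hasDerivAt_id _)
  exact (h2.comp_hasDerivAt p.2 h3).deriv.symm

/-- The residue of a family of Laurent series depends analytically on the parameter. -/
theorem AnalyticAt.residue_family {a₀ : ℂ} (N : ℕ) : ∀ H : ℂ × ℂ → ℂ, AnalyticAt ℂ H (a₀, 0) →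
    AnalyticAt ℂ (fun a => residue (fun ζ => (ζ ^ N)⁻¹ * H (a, ζ)) 0) a₀ := by
  induction N with
  | zero =>
    intro H hH
    refine (analyticAt_const (v := (0 : ℂ))).congr ?_
    filter_upwards [hH.eventually_fiber] with a ha
    simp [residue_analyticAt ha]
  | succ N ih =>
    intro H hH
    cases N with
    | zero =>
      have h1 : AnalyticAt ℂ (fun a : ℂ => H (a, 0)) a₀ :=
        hH.comp (g := H) (f := fun a => (a, 0)) (by fun_prop)
      refine h1.congr ?_
      filter_upwards [hH.eventually_fiber] with a ha
      have := (HasResidue.inv_sub_mul ha).residue_eq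
      simpa using this.symm
    | succ N =>
      -- Integration by parts in ζ trades `H` for its ζ-derivative, which is again jointly analytic,
      -- and lowers the exponent by one.
      have h1 := (analyticAt_const (v := (N + 1 : ℂ)⁻¹)).mul (ih _ hH.partial_deriv)
      refine h1.congr ?_
      filter_upwards [hH.eventually_fiber] with a ha
      have hm := meromorphicAt_inv_sub_pow_mul (N + 1) ha.deriv
      have := (hm.hasResidue.inv_sub_pow_mul_succ N ha).residue_eq
      simp only [sub_zero] at this
      simp only [Pi.mul_apply]
      exact this.symm

/-! ### The family of conifold curves, parametrized by a ramification point -/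

/-- The value of `r` for which `a` is a ramification point of the conifold curve. -/
noncomputable def ramParam (f : ℤ) (a : ℂ) : ℂ :=
  -(a * ((f + 1) * a + f)) / ((f + 2) * a + (f + 1))

/-- The parameters `a` for which `a` is a simple ramification point of a smooth curve. -/
structure Admissible (f : ℤ) (a : ℂ) : Prop where
  framing : (f + 1 : ℂ) ≠ 0
  ne_zero : a ≠ 0
  one_add_ne_zero : 1 + a ≠ 0
  den_ne_zero : (f + 2) * a + (f + 1) ≠ 0
  disc_ne_zero : (f + 2) * a + f ≠ 0

namespace Admissible

variable {f : ℤ} {a : ℂ}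

theorem eventually (h : Admissible f a) : ∀ᶠ b in 𝓝 a, Admissible f b := by
  have h1 : ∀ᶠ b in 𝓝 a, b ≠ 0 := isOpen_ne.mem_nhds h.ne_zero
  have h2 : ∀ᶠ b in 𝓝 a, 1 + b ≠ 0 :=
    (by fun_prop : ContinuousAt (fun b : ℂ => 1 + b) a).eventually_ne h.one_add_ne_zero
  have h3 : ∀ᶠ b : ℂ in 𝓝 a, ((f + 2) * b + (f + 1) : ℂ) ≠ 0 :=
    (by fun_prop : ContinuousAt (fun b : ℂ => (f + 2) * b + (f + 1)) a).eventually_ne h.den_ne_zero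
  have h4 : ∀ᶠ b : ℂ in 𝓝 a, ((f + 2) * b + f : ℂ) ≠ 0 :=
    (by fun_prop : ContinuousAt (fun b : ℂ => (f + 2) * b + f) a).eventually_ne h.disc_ne_zero
  filter_upwards [h1, h2, h3, h4] with b b1 b2 b3 b4
  exact ⟨h.framing, b1, b2, b3, b4⟩

theorem ramParam_add (h : Admissible f a) :
    ramParam f a + a = a * (1 + a) / ((f + 2) * a + (f + 1)) := by
  have h1 := h.den_ne_zero
  unfold ramParam
  generalize hd : (f + 2) * a + (f + 1) = d at *
  field_simp
  rw [← hd]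
  ring

theorem ramParam_add_ne_zero (h : Admissible f a) : ramParam f a + a ≠ 0 := by
  rw [h.ramParam_add]
  exact div_ne_zero (mul_ne_zero h.ne_zero h.one_add_ne_zero) h.den_ne_zero

/-- The points a and r/a are distinct. The factor (f+2)a + f used here is the one that makes the
ramification simple in `logXQuot_ne_zero`. -/
theorem sq_ne_ramParam (h : Admissible f a) : a * a ≠ ramParam f a := by
  have h1 := h.den_ne_zero
  have e : a * a - ramParam f a =
      a * (1 + a) * ((f + 2) * a + f) / ((f + 2) * a + (f + 1)) := by
    unfold ramParam
    generalize hd : (f + 2) * a + (f + 1) = d at *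
    field_simp
    rw [← hd]
    ring
  rw [← sub_ne_zero, e]
  exact div_ne_zero (mul_ne_zero (mul_ne_zero h.ne_zero h.one_add_ne_zero) h.disc_ne_zero) h1

theorem quadratic (h : Admissible f a) :
    (f + 1) * a ^ 2 + ((f + 2) * ramParam f a + f) * a + (f + 1) * ramParam f a = 0 := by
  have h1 := h.den_ne_zero
  unfold ramParam
  generalize hd : (f + 2) * a + (f + 1) = d at *
  field_simp
  rw [← hd]
  ring

theorem ramParam_ne_one (h : Admissible f a) : ramParam f a ≠ 1 := by
  have h1 := h.den_ne_zero
  have e : 1 - ramParam f a = (f + 1) * (1 + a) ^ 2 / ((f + 2) * a + (f + 1)) := by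
    unfold ramParam
    generalize hd : (f + 2) * a + (f + 1) = d at *
    field_simp
    rw [← hd]
    ring
  intro h0
  rw [h0, sub_self] at e
  exact div_ne_zero (mul_ne_zero h.framing (pow_ne_zero 2 h.one_add_ne_zero)) h1 e.symm

end Admissible

theorem conifold_hasDerivAt (f : ℤ) {r t : ℂ} (h0 : t ≠ 0) (h2 : r + t ≠ 0) :
    HasDerivAt (conifoldCurve f r).X
      (-(t ^ f * ((f + 1) * t ^ 2 + ((f + 2) * r + f) * t + (f + 1) * r) / (r + t) ^ 2)) t := by
  have h3 := ((hasDerivAt_zpow (f + 1) t (Or.inl h0)).mul ((hasDerivAt_id' t).const_add 1)).div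
    ((hasDerivAt_id' t).const_add r) h2
  refine h3.neg.congr_deriv ?_
  rw [zpow_add_one₀ h0]
  push_cast
  simp only [add_sub_cancel_right, Pi.mul_apply, zpow_add_one₀ h0]
  field_simp
  ring

theorem conifold_logDeriv (f : ℤ) {r t : ℂ} (h0 : t ≠ 0) (h1 : 1 + t ≠ 0) (h2 : r + t ≠ 0) :
    logDeriv (conifoldCurve f r).X t = ((f + 1) * t ^ 2 + ((f + 2) * r + f) * t + (f + 1) * r) /
      (t * (1 + t) * (r + t)) := by
  have hz : t ^ f ≠ 0 := zpow_ne_zero f h0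
  rw [logDeriv_apply, (conifold_hasDerivAt f h0 h2).deriv]
  simp only [conifoldCurve]
  rw [zpow_add_one₀ h0]
  field_simp

theorem conifold_analyticAt (f : ℤ) {r t : ℂ} (h0 : t ≠ 0) (h2 : r + t ≠ 0) :
    AnalyticAt ℂ (conifoldCurve f r).X t := by
  have h3 : ∀ᶠ u in 𝓝 t, u ≠ 0 := isOpen_ne.mem_nhds h0
  have h4 : ∀ᶠ u in 𝓝 t, r + u ≠ 0 :=
    (by fun_prop : ContinuousAt (fun b : ℂ => r + b) t).eventually_ne h2
  rw [Complex.analyticAt_iff_eventually_differentiableAt]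
  filter_upwards [h3, h4] with u h5 h6
  exact (conifold_hasDerivAt f h5 h6).differentiableAt

theorem conifold_X_ne_zero (f : ℤ) {r t : ℂ} (h0 : t ≠ 0) (h1 : 1 + t ≠ 0) (h2 : r + t ≠ 0) :
    (conifoldCurve f r).X t ≠ 0 :=
  neg_ne_zero.2 (div_ne_zero (mul_ne_zero (zpow_ne_zero _ h0) h1) h2)

/-- The numerator of dX/X is a quadratic whose roots have product r, so the root other than a is
r/a. The condition t ≠ 0 discards that root when r = 0, so one formula covers both curves. -/
theorem Admissible.ram_eq {f : ℤ} {a : ℂ} (h : Admissible f a) :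
    (conifoldCurve f (ramParam f a)).ram = {t | t ≠ 0 ∧ (t = a ∨ t = ramParam f a / a)} := by
  set r := ramParam f a with hr
  have ha := h.ne_zero
  have e : ∀ t, a * ((f + 1) * t ^ 2 + ((f + 2) * r + f) * t + (f + 1) * r) =
      (f + 1) * (t - a) * (a * t - r) := fun t => by linear_combination t * h.quadratic
  have hroot : ∀ t : ℂ, (f + 1) * t ^ 2 + ((f + 2) * r + f) * t + (f + 1) * r = 0 ↔
      t = a ∨ t = r / a := by
    intro t
    rw [← mul_eq_zero_iff_left ha, e, mul_eq_zero, mul_eq_zero, eq_div_iff ha, sub_eq_zero,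
      sub_eq_zero, mul_comm a t]
    simp [h.framing]
  have hr1 : r ≠ 1 := h.ramParam_ne_one
  ext t
  simp only [RationalCurve.ram, Set.mem_ofPred_eq]
  constructor
  · rintro ⟨⟨h0, h1, h2⟩, hd⟩
    refine ⟨h0, (hroot t).1 ?_⟩
    rw [(conifold_hasDerivAt f h0 h2).deriv] at hd
    simpa [zpow_ne_zero f h0, h0, h2] using hd
  · rintro ⟨h0, h1⟩
    have h1 := (hroot t).2 h1
    have h2 : 1 + t ≠ 0 := by
      intro h2
      have : t = -1 := by linear_combination h2
      subst this
      exact hr1 (by linear_combination -h1)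
    have h3 : r + t ≠ 0 := by
      intro h3
      have : r = -t := by linear_combination h3
      rw [this] at h1
      have h4 : t * (1 + t) = 0 := by linear_combination -h1
      exact (mul_ne_zero h0 h2) h4
    refine ⟨⟨h0, h2, h3⟩, ?_⟩
    rw [(conifold_hasDerivAt f h0 h3).deriv, h1]
    simp

/-! ### The coordinate with `X = X(a) exp(ζ²)` -/

/-- `(log (1 + u)) / u` -/
noncomputable def logQuot : ℂ → ℂ := dslope (fun u => Complex.log (1 + u)) 0

/-- `(log (1 + u) - u) / u ^ 2` -/
noncomputable def logQuot₂ : ℂ → ℂ := dslope logQuot 0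

theorem AnalyticAt.dslope_self {F : ℂ → ℂ} {a : ℂ} (h : AnalyticAt ℂ F a) :
    AnalyticAt ℂ (dslope F a) a := by
  obtain ⟨p, hp⟩ := h
  exact hp.has_fpower_series_dslope_fslope.analyticAt

theorem hasDerivAt_log_one_add {u : ℂ} (hu : 1 + u ∈ Complex.slitPlane) :
    HasDerivAt (fun u => Complex.log (1 + u)) (1 / (1 + u)) u :=
  ((hasDerivAt_id' u).const_add 1).clog hu

theorem analyticAt_log_one_add : AnalyticAt ℂ (fun u => Complex.log (1 + u)) 0 :=
  AnalyticAt.clog (by fun_prop) (by simp)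

theorem analyticAt_logQuot : AnalyticAt ℂ logQuot 0 := analyticAt_log_one_add.dslope_self

theorem analyticAt_logQuot₂ : AnalyticAt ℂ logQuot₂ 0 := analyticAt_logQuot.dslope_self

theorem mul_logQuot (u : ℂ) : u * logQuot u = Complex.log (1 + u) := by
  have := sub_smul_dslope (fun u => Complex.log (1 + u)) 0 u
  simpa [logQuot] using this

theorem logQuot_zero : logQuot 0 = 1 := by
  rw [logQuot, dslope_same, (hasDerivAt_log_one_add (by simp)).deriv]
  simp

theorem logQuot_eq (u : ℂ) : logQuot u = 1 + u * logQuot₂ u := by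
  have := sub_smul_dslope logQuot 0 u
  rw [logQuot_zero, sub_zero, smul_eq_mul] at this
  rw [logQuot₂, this]
  ring

theorem log_one_add_eq (u : ℂ) : Complex.log (1 + u) = u + u ^ 2 * logQuot₂ u := by
  rw [← mul_logQuot, logQuot_eq]
  ring

/-- Differentiate log(1 + u) = u + u² q(u), divide by u, and let u tend to 0. -/
theorem logQuot₂_zero : logQuot₂ 0 = -(1 / 2) := by
  have h1 : HasDerivAt (fun u => Complex.log (1 + u) - u - u ^ 2 * logQuot₂ u) 0 0 := by
    refine (hasDerivAt_const 0 (0 : ℂ)).congr_of_eventuallyEq (Eventually.of_forall fun u => ?_)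
    simp only [log_one_add_eq]
    ring
  have e : ∀ᶠ u in 𝓝 (0 : ℂ), 1 / (1 + u) - 1 - (2 * u * logQuot₂ u + u ^ 2 * deriv logQuot₂ u) = 0 := by
    have hs : ∀ᶠ u in 𝓝 (0 : ℂ), 1 + u ∈ Complex.slitPlane :=
      (by fun_prop : ContinuousAt (fun u : ℂ => 1 + u) 0).eventually_mem
        (Complex.isOpen_slitPlane.mem_nhds (by simp))
    filter_upwards [hs, analyticAt_logQuot₂.eventually_analyticAt] with u hu hm
    have h2 := ((hasDerivAt_log_one_add hu).sub (hasDerivAt_id' u)).sub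
      (((hasDerivAt_id' u).fun_pow 2).mul hm.differentiableAt.hasDerivAt)
    have h3 : HasDerivAt ((((fun u => Complex.log (1 + u)) - fun x => x)) -
        (fun x => x ^ 2) * logQuot₂) 0 u := by
      refine (hasDerivAt_const u (0 : ℂ)).congr_of_eventuallyEq (Eventually.of_forall fun v => ?_)
      simp only [Pi.sub_apply, Pi.mul_apply, log_one_add_eq]
      ring
    have := h2.unique h3
    simpa using this
  have e2 : ∀ᶠ u in 𝓝[≠] (0 : ℂ), -(1 / (1 + u)) - 2 * logQuot₂ u - u * deriv logQuot₂ u = 0 := by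
    have hs : ∀ᶠ u in 𝓝 (0 : ℂ), 1 + u ≠ 0 :=
      (by fun_prop : ContinuousAt (fun u : ℂ => 1 + u) 0).eventually_ne (by simp)
    filter_upwards [nhdsWithin_le_nhds e, nhdsWithin_le_nhds hs, self_mem_nhdsWithin] with u h3 h4 h5
    have h5 : u ≠ 0 := h5
    refine (mul_right_injective₀ h5) ?_
    simp only [mul_zero]
    rw [← h3]
    field_simp
    ring
  have hc : ContinuousAt (fun u => -(1 / (1 + u)) - 2 * logQuot₂ u - u * deriv logQuot₂ u) 0 := by
    have h6 := analyticAt_logQuot₂.continuousAt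
    have h7 := analyticAt_logQuot₂.deriv.continuousAt
    have h8 : ContinuousAt (fun u : ℂ => 1 / (1 + u)) 0 := by
      refine ContinuousAt.div (by fun_prop) (by fun_prop) (by simp)
    fun_prop
  have := tendsto_nhds_unique (hc.tendsto.mono_left nhdsWithin_le_nhds)
    ((tendsto_const_nhds (x := (0 : ℂ))).congr' (e2.mono fun u hu => hu.symm))
  simp only [add_zero, div_one, zero_mul, sub_zero] at this
  linear_combination -(1 / 2) * this

/-- `(log X(a + x) - log X(a)) / x ^ 2` for the conifold curve with ramification point `a`. -/
noncomputable def logXQuot (f : ℤ) (p : ℂ × ℂ) : ℂ :=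
  (f + 1) * (p.1⁻¹ ^ 2 * logQuot₂ (p.2 * p.1⁻¹)) +
    ((1 + p.1)⁻¹ ^ 2 * logQuot₂ (p.2 * (1 + p.1)⁻¹)) -
    ((ramParam f p.1 + p.1)⁻¹ ^ 2 * logQuot₂ (p.2 * (ramParam f p.1 + p.1)⁻¹))

theorem Admissible.analyticAt_ramParam {f : ℤ} {a : ℂ} (h : Admissible f a) :
    AnalyticAt ℂ (ramParam f) a := by
  unfold ramParam
  exact AnalyticAt.div (by fun_prop) (by fun_prop) h.den_ne_zero

theorem analyticAt_comp_mul_inv {d : ℂ × ℂ → ℂ} {p : ℂ × ℂ} {g : ℂ → ℂ} (hg : AnalyticAt ℂ g 0)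
    (hp : p.2 = 0) (hd : AnalyticAt ℂ d p) (h0 : d p ≠ 0) :
    AnalyticAt ℂ (fun q : ℂ × ℂ => g (q.2 * (d q)⁻¹)) p := by
  have h1 : AnalyticAt ℂ (fun q : ℂ × ℂ => q.2 * (d q)⁻¹) p := analyticAt_snd.mul (hd.inv h0)
  refine AnalyticAt.comp (g := g) ?_ h1
  rw [hp, zero_mul]
  exact hg

theorem Admissible.analyticAt_logXQuot {f : ℤ} {a : ℂ} (h : Admissible f a) :
    AnalyticAt ℂ (logXQuot f) (a, 0) := by
  have hr : AnalyticAt ℂ (fun p : ℂ × ℂ => ramParam f p.1) (a, 0) :=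
    AnalyticAt.comp (g := ramParam f) h.analyticAt_ramParam analyticAt_fst
  have h1 : AnalyticAt ℂ (fun p : ℂ × ℂ => p.1) (a, 0) := analyticAt_fst
  have h2 : AnalyticAt ℂ (fun p : ℂ × ℂ => 1 + p.1) (a, 0) :=
    analyticAt_const.add analyticAt_fst
  have h3 : AnalyticAt ℂ (fun p : ℂ × ℂ => ramParam f p.1 + p.1) (a, 0) := hr.add h1
  have k1 := analyticAt_comp_mul_inv analyticAt_logQuot₂ rfl h1 h.ne_zero
  have k2 := analyticAt_comp_mul_inv analyticAt_logQuot₂ rfl h2 h.one_add_ne_zero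
  have k3 := analyticAt_comp_mul_inv analyticAt_logQuot₂ rfl h3 h.ramParam_add_ne_zero
  have i1 := h1.inv h.ne_zero
  have i2 := h2.inv h.one_add_ne_zero
  have i3 := h3.inv h.ramParam_add_ne_zero
  exact ((analyticAt_const.mul ((i1.pow 2).mul k1)).add ((i2.pow 2).mul k2)).sub
    ((i3.pow 2).mul k3)

/-- This is simplicity of the ramification: the second-order coefficient of log X at a does not
vanish. -/
theorem Admissible.logXQuot_ne_zero {f : ℤ} {a : ℂ} (h : Admissible f a) :
    logXQuot f (a, 0) ≠ 0 := by
  have h1 := h.ne_zero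
  have h2 := h.one_add_ne_zero
  have h3 := h.den_ne_zero
  have e : logXQuot f (a, 0) = (1 / 2) * ((f + 1) * ((f + 2) * a + f) / (a ^ 2 * (1 + a))) := by
    simp only [logXQuot, zero_mul, logQuot₂_zero, h.ramParam_add]
    generalize hd : (f + 2) * a + (f + 1) = d at *
    field_simp
    rw [← hd]
    ring
  rw [e]
  exact mul_ne_zero (by norm_num) (div_ne_zero (mul_ne_zero h.framing h.disc_ne_zero)
    (mul_ne_zero (pow_ne_zero 2 h1) h2))

theorem Admissible.X_eq {f : ℤ} {a x : ℂ} (h : Admissible f a) (h0 : 1 + x * a⁻¹ ≠ 0)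
    (h1 : 1 + x * (1 + a)⁻¹ ≠ 0) (h2 : 1 + x * (ramParam f a + a)⁻¹ ≠ 0) :
    (conifoldCurve f (ramParam f a)).X (a + x) =
      (conifoldCurve f (ramParam f a)).X a * Complex.exp (x ^ 2 * logXQuot f (a, x)) := by
  have n0 := h.ne_zero
  have n1 := h.one_add_ne_zero
  have n2 := h.ramParam_add_ne_zero
  have n3 := h.den_ne_zero
  -- The linear coefficient of log X at a, which vanishes because a is a ramification point.
  have lin : (f + 1) * a⁻¹ + (1 + a)⁻¹ - (ramParam f a + a)⁻¹ = 0 := by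
    rw [h.ramParam_add]
    generalize hd : (f + 2) * a + (f + 1) = d at *
    field_simp
    rw [← hd]
    ring
  have e : x ^ 2 * logXQuot f (a, x) = ((f + 1 : ℤ) : ℂ) * Complex.log (1 + x * a⁻¹) +
      Complex.log (1 + x * (1 + a)⁻¹) - Complex.log (1 + x * (ramParam f a + a)⁻¹) := by
    simp only [log_one_add_eq, logXQuot]
    push_cast
    linear_combination -x * lin
  rw [e, Complex.exp_sub, Complex.exp_add, Complex.exp_int_mul, Complex.exp_log h0,
    Complex.exp_log h1, Complex.exp_log h2]
  have e0 : a + x = a * (1 + x * a⁻¹) := by field_simp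
  simp only [conifoldCurve]
  have e1 : 1 + (a + x) = (1 + a) * (1 + x * (1 + a)⁻¹) := by field_simp; ring
  have e2 : ramParam f a + (a + x) = (ramParam f a + a) * (1 + x * (ramParam f a + a)⁻¹) := by
    field_simp; ring
  rw [e1, e2, e0, mul_zpow]
  generalize 1 + x * a⁻¹ = u at *
  generalize 1 + x * (1 + a)⁻¹ = v at *
  generalize 1 + x * (ramParam f a + a)⁻¹ = w at *
  field_simp

/-- An analytic implicit function theorem for `y ^ 2 * K (a, ζ y) = 1`. -/
theorem exists_analytic_sqrt {K : ℂ × ℂ → ℂ} {a : ℂ} (hK : AnalyticAt ℂ K (a, 0))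
    (h0 : K (a, 0) ≠ 0) : ∃ y : ℂ × ℂ → ℂ, AnalyticAt ℂ y (a, 0) ∧ y (a, 0) ≠ 0 ∧
      ∀ᶠ p in 𝓝 (a, (0 : ℂ)), y p ^ 2 * K (p.1, p.2 * y p) = 1 := by
  obtain ⟨y₀, hy₀⟩ := IsAlgClosed.exists_pow_nat_eq (K (a, 0))⁻¹ (n := 2) (by norm_num)
  have hy0 : y₀ ≠ 0 := by
    rintro rfl
    exact inv_ne_zero h0 (by simpa using hy₀.symm)
  let u : (ℂ × ℂ) × ℂ := ((a, 0), y₀)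
  let F : (ℂ × ℂ) × ℂ → ℂ := fun q => q.2 ^ 2 * K (q.1.1, q.1.2 * q.2)
  have hF : AnalyticAt ℂ F u := by
    have h1 : AnalyticAt ℂ (fun q : (ℂ × ℂ) × ℂ => (q.1.1, q.1.2 * q.2)) u :=
      (analyticAt_fst.comp analyticAt_fst).prod
        ((analyticAt_snd.comp analyticAt_fst).mul analyticAt_snd)
    have h2 : AnalyticAt ℂ (fun q : (ℂ × ℂ) × ℂ => K (q.1.1, q.1.2 * q.2)) u := by
      refine AnalyticAt.comp (g := K) ?_ h1
      simpa [u] using hK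
    exact (analyticAt_snd.pow 2).mul h2
  -- In `WithTop ℕ∞` the order `⊤` stands for analyticity, so the implicit function is analytic and
  -- not merely smooth.
  have hc : ContDiffAt ℂ ⊤ F u := hF.contDiffAt
  have hd : (fderiv ℂ F u ∘L .inr ℂ (ℂ × ℂ) ℂ) 1 = 2 * y₀ * K (a, 0) := by
    have h3 : HasDerivAt (fun w : ℂ => ((a, (0 : ℂ)), w)) (((0, 0), 1) : (ℂ × ℂ) × ℂ) y₀ :=
      (hasDerivAt_const _ _).prodMk (hasDerivAt_id _)
    have h4 : HasFDerivAt F (fderiv ℂ F u) ((a, (0 : ℂ)), y₀) :=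
      hF.differentiableAt.hasFDerivAt
    have h5 := h4.comp_hasDerivAt y₀ h3
    have h6 : HasDerivAt (fun w : ℂ => w ^ 2 * K (a, 0)) (2 * y₀ * K (a, 0)) y₀ := by
      simpa using ((hasDerivAt_id' y₀).fun_pow 2).mul_const (K (a, 0))
    have h7 : F ∘ (fun w : ℂ => ((a, (0 : ℂ)), w)) = fun w : ℂ => w ^ 2 * K (a, 0) := by
      ext w; simp [F]
    rw [h7] at h5
    have h8 : (fderiv ℂ F u ∘L .inr ℂ (ℂ × ℂ) ℂ) 1 = fderiv ℂ F u (((0, 0), 1) : (ℂ × ℂ) × ℂ) := rfl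
    rw [h8, h5.unique h6]
  have hne : 2 * y₀ * K (a, 0) ≠ 0 := mul_ne_zero (mul_ne_zero two_ne_zero hy0) h0
  have hinv : (fderiv ℂ F u ∘L .inr ℂ (ℂ × ℂ) ℂ).IsInvertible := by
    refine ⟨ContinuousLinearEquiv.unitsEquivAut ℂ (Units.mk0 _ hne), ?_⟩
    ext
    rw [hd]
    simp
  have hω : (⊤ : WithTop ℕ∞) ≠ 0 := by simp
  refine ⟨hc.implicitFunction hω hinv, (hc.contDiffAt_implicitFunction hω hinv).analyticAt, ?_, ?_⟩
  · rw [hc.implicitFunction_apply_self hω hinv]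
    exact hy0
  · filter_upwards [hc.eventually_apply_implicitFunction hω hinv] with p hp
    have : F u = 1 := by simp [F, u, hy₀, h0]
    rw [this] at hp
    exact hp

/-- With x = ζ y the equation x² `logXQuot` = ζ² is the one solved by `exists_analytic_sqrt`. The
logarithm vanishes at ζ = 0, and `logQuot` performs the division by ζ. -/
theorem Admissible.exists_coordinate {f : ℤ} {a : ℂ} (h : Admissible f a) :
    ∃ y l : ℂ × ℂ → ℂ, AnalyticAt ℂ y (a, 0) ∧ y (a, 0) ≠ 0 ∧ AnalyticAt ℂ l (a, 0) ∧
      l (a, 0) ≠ 0 ∧ ∀ᶠ p in 𝓝 (a, (0 : ℂ)),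
        Complex.log ((p.1 + p.2 * y p) / p.1) = p.2 * l p ∧
        (conifoldCurve f (ramParam f p.1)).X (p.1 + p.2 * y p) =
          (conifoldCurve f (ramParam f p.1)).X p.1 * Complex.exp (p.2 ^ 2) := by
  obtain ⟨y, hy, hy0, hy1⟩ := exists_analytic_sqrt h.analyticAt_logXQuot h.logXQuot_ne_zero
  have i1 : AnalyticAt ℂ (fun p : ℂ × ℂ => p.1⁻¹) (a, 0) := analyticAt_fst.inv h.ne_zero
  have hu : AnalyticAt ℂ (fun p : ℂ × ℂ => p.2 * y p * p.1⁻¹) (a, 0) :=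
    (analyticAt_snd.mul hy).mul i1
  have hl : AnalyticAt ℂ (fun p : ℂ × ℂ => y p * p.1⁻¹ * logQuot (p.2 * y p * p.1⁻¹)) (a, 0) := by
    refine (hy.mul i1).mul (AnalyticAt.comp (g := logQuot) ?_ hu)
    simpa using analyticAt_logQuot
  refine ⟨y, _, hy, hy0, hl, ?_, ?_⟩
  · simp [logQuot_zero, hy0, h.ne_zero]
  · have hadm : ∀ᶠ p in 𝓝 (a, (0 : ℂ)), Admissible f p.1 :=
      continuousAt_fst.eventually (f := Prod.fst) h.eventually
    have hr : AnalyticAt ℂ (fun p : ℂ × ℂ => ramParam f p.1) (a, 0) :=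
      AnalyticAt.comp (g := ramParam f) h.analyticAt_ramParam analyticAt_fst
    have near : ∀ d : ℂ × ℂ → ℂ, AnalyticAt ℂ d (a, 0) → d (a, 0) ≠ 0 →
        ∀ᶠ p in 𝓝 (a, (0 : ℂ)), 1 + p.2 * y p * (d p)⁻¹ ≠ 0 := by
      intro d hd hd0
      have : AnalyticAt ℂ (fun p : ℂ × ℂ => 1 + p.2 * y p * (d p)⁻¹) (a, 0) :=
        analyticAt_const.add ((analyticAt_snd.mul hy).mul (hd.inv hd0))
      exact this.continuousAt.eventually_ne (by simp)
    filter_upwards [hadm, hy1, near _ analyticAt_fst h.ne_zero,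
      near (fun p => 1 + p.1) (analyticAt_const.add analyticAt_fst) h.one_add_ne_zero,
      near _ (hr.add analyticAt_fst) h.ramParam_add_ne_zero] with p ha hp n0 n1 n2
    have := ha.ne_zero
    constructor
    · have e : (p.1 + p.2 * y p) / p.1 = 1 + p.2 * y p * p.1⁻¹ := by field_simp
      rw [e, ← mul_logQuot]
      ring
    · rw [ha.X_eq n0 n1 n2]
      congr 2
      linear_combination p.2 ^ 2 * hp

/-! ### Deck transformations in an adapted coordinate -/

theorem AnalyticAt.exists_local_inverse {χ : ℂ → ℂ} {x : ℂ} (hχ : AnalyticAt ℂ χ x)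
    (hd : deriv χ x ≠ 0) : ∃ ψ : ℂ → ℂ, AnalyticAt ℂ ψ (χ x) ∧ ψ (χ x) = x ∧
      (∀ᶠ ζ in 𝓝 x, ψ (χ ζ) = ζ) ∧ ∀ᶠ q in 𝓝 (χ x), χ (ψ q) = q :=
  ⟨_, hχ.analyticAt_localInverse hd, HasStrictFDerivAt.localInverse_apply_image ..,
    HasStrictDerivAt.eventually_left_inverse .., HasStrictDerivAt.eventually_right_inverse ..⟩

theorem not_eventually_neg_eq : ¬ ∀ᶠ ζ in 𝓝 (0 : ℂ), -ζ = ζ := by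
  intro h
  have h1 : ∀ᶠ ζ in 𝓝[≠] (0 : ℂ), False := by
    filter_upwards [nhdsWithin_le_nhds h, self_mem_nhdsWithin] with ζ h2 h3
    exact h3 (self_eq_neg.1 h2.symm)
  exact h1.exists.choose_spec

theorem tendsto_neg_zero : Tendsto (fun ζ : ℂ => -ζ) (𝓝 0) (𝓝 0) := by
  have : Continuous (fun ζ : ℂ => -ζ) := continuous_neg
  simpa using this.tendsto 0

theorem tendsto_neg_punctured : Tendsto (fun ζ : ℂ => -ζ) (𝓝[≠] 0) (𝓝[≠] 0) := by
  refine tendsto_nhdsWithin_of_tendsto_nhds_of_eventually_within _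
    (tendsto_neg_zero.mono_left nhdsWithin_le_nhds) ?_
  filter_upwards [self_mem_nhdsWithin] with ζ hζ
  exact neg_ne_zero.2 hζ

/-- The product (ψ - ζ)(ψ + ζ) vanishes near 0, and zeros of nonzero analytic functions are
isolated, so one factor vanishes identically. -/
theorem eq_id_or_eq_neg_of_sq_eq {ψ : ℂ → ℂ} (hψ : AnalyticAt ℂ ψ 0)
    (h : ∀ᶠ ζ in 𝓝 (0 : ℂ), ψ ζ ^ 2 = ζ ^ 2) :
    (∀ᶠ ζ in 𝓝 (0 : ℂ), ψ ζ = ζ) ∨ ∀ᶠ ζ in 𝓝 (0 : ℂ), ψ ζ = -ζ := by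
  have h1 : AnalyticAt ℂ (fun ζ => ψ ζ - ζ) 0 := hψ.sub analyticAt_id
  have h2 : AnalyticAt ℂ (fun ζ => ψ ζ + ζ) 0 := hψ.add analyticAt_id
  rcases h1.eventually_eq_zero_or_eventually_ne_zero with h3 | h3
  · exact Or.inl (h3.mono fun ζ hζ => sub_eq_zero.1 hζ)
  rcases h2.eventually_eq_zero_or_eventually_ne_zero with h4 | h4
  · exact Or.inr (h4.mono fun ζ hζ => eq_neg_of_add_eq_zero_left hζ)
  exfalso
  have h5 : ∀ᶠ ζ in 𝓝[≠] (0 : ℂ), False := by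
    filter_upwards [h3, h4, nhdsWithin_le_nhds h] with ζ h6 h7 h8
    exact (mul_ne_zero h6 h7) (by linear_combination h8)
  exact h5.exists.choose_spec

/-- `χ` is a local coordinate at the ramification point `b` in which the deck transformation is
`ζ ↦ -ζ` and the denominator of the kernel is `2 ζ² (l(ζ) + l(-ζ))`. -/
structure IsAdapted (C : RationalCurve) (b : ℂ) (χ l : ℂ → ℂ) : Prop where
  analyticAt : AnalyticAt ℂ χ 0
  map_zero : χ 0 = b
  deriv_ne_zero : deriv χ 0 ≠ 0
  deck_eq : ∀ᶠ ζ in 𝓝 0, C.deck b (χ ζ) = χ (-ζ)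
  deriv_deck : ∀ᶠ ζ in 𝓝 0, deriv (C.deck b) (χ ζ) * deriv χ ζ = -deriv χ (-ζ)
  omega_sub : ∀ᶠ ζ in 𝓝 0, (C.omega b (χ ζ) - C.omega b (C.deck b (χ ζ)) *
    deriv (C.deck b) (χ ζ)) * deriv χ ζ = 2 * ζ ^ 2 * (l ζ + l (-ζ))

/-- The map is ζ ↦ -ζ conjugated by the coordinate. Existence is needed because `deck` is chosen by
`Classical.epsilon`. -/
theorem exists_isDeck {C : RationalCurve} {χ : ℂ → ℂ} {c ε : ℂ}
    (hχ : AnalyticAt ℂ χ 0) (hd : deriv χ 0 ≠ 0)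
    (hX : ∀ᶠ ζ in 𝓝 (0 : ℂ), C.X (χ ζ) = c * Complex.exp (ε * ζ ^ 2)) :
    ∃ s, C.IsDeck (χ 0) s := by
  obtain ⟨ψ, hψ, hψ0, hl, hr⟩ := hχ.exists_local_inverse hd
  have hψn : AnalyticAt ℂ (fun q => -ψ q) (χ 0) := hψ.neg
  have hn0 : -ψ (χ 0) = 0 := by rw [hψ0, neg_zero]
  have ht : Tendsto ψ (𝓝 (χ 0)) (𝓝 0) := by
    have := hψ.continuousAt.tendsto
    rwa [hψ0] at this
  refine ⟨fun q => χ (-ψ q), ?_, ?_, ?_, ?_⟩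
  · refine AnalyticAt.comp (g := χ) ?_ hψn
    rw [hn0]
    exact hχ
  · simp [hψ0]
  · filter_upwards [ht.eventually hX, (tendsto_neg_zero.comp ht).eventually hX, hr] with q h1 h2 h3
    simp only [Function.comp] at h2
    rw [h2, ← h3, h1, h3, neg_sq]
  · intro he
    have h1 : ∀ᶠ ζ in 𝓝 (0 : ℂ), χ (-ψ (χ ζ)) = χ ζ := hχ.continuousAt.tendsto.eventually he
    refine not_eventually_neg_eq ?_
    filter_upwards [h1, hl, tendsto_neg_zero.eventually hl] with ζ h2 h3 h4
    rw [h3] at h2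
    rw [← h4, h2, h3]

/-- In the coordinate, s becomes a map θ with exp(εθ²) = exp(εζ²). Near 0 this forces θ² = ζ², hence
θ = ζ or θ = -ζ, and the first is excluded by s ≠ id. -/
theorem IsDeck_eq_neg {C : RationalCurve} {χ s : ℂ → ℂ} {c ε : ℂ}
    (hχ : AnalyticAt ℂ χ 0) (hd : deriv χ 0 ≠ 0) (hc : c ≠ 0) (hε : ε ≠ 0)
    (hX : ∀ᶠ ζ in 𝓝 (0 : ℂ), C.X (χ ζ) = c * Complex.exp (ε * ζ ^ 2)) (hs : C.IsDeck (χ 0) s) :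
    ∀ᶠ ζ in 𝓝 (0 : ℂ), s (χ ζ) = χ (-ζ) := by
  obtain ⟨ψ, hψ, hψ0, hl, hr⟩ := hχ.exists_local_inverse hd
  obtain ⟨hsa, hs0, hsX, hsid⟩ := hs
  have tχ : Tendsto χ (𝓝 0) (𝓝 (χ 0)) := hχ.continuousAt.tendsto
  have ts : Tendsto s (𝓝 (χ 0)) (𝓝 (χ 0)) := by
    have := hsa.continuousAt.tendsto
    rwa [hs0] at this
  have tψ : Tendsto ψ (𝓝 (χ 0)) (𝓝 0) := by
    have := hψ.continuousAt.tendsto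
    rwa [hψ0] at this
  have hsχ : AnalyticAt ℂ (fun ζ => s (χ ζ)) 0 := hsa.comp hχ
  have hθ : AnalyticAt ℂ (fun ζ => ψ (s (χ ζ))) 0 := by
    refine AnalyticAt.comp (g := ψ) ?_ hsχ
    rw [hs0]
    exact hψ
  have tθ := tψ.comp (ts.comp tχ)
  have hback : ∀ᶠ ζ in 𝓝 (0 : ℂ), χ (ψ (s (χ ζ))) = s (χ ζ) := (ts.comp tχ).eventually hr
  have small : ∀ᶠ w in 𝓝 (0 : ℂ), Complex.exp (ε * w ^ 2) = Complex.exp (ε * w ^ 2) ∧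
      ‖ε * w ^ 2‖ < 1 := by
    have : ContinuousAt (fun w : ℂ => ‖ε * w ^ 2‖) 0 := by fun_prop
    filter_upwards [this.eventually_lt_const (by simp : ‖ε * (0 : ℂ) ^ 2‖ < 1)] with w hw
    exact ⟨rfl, hw⟩
  have hsq : ∀ᶠ ζ in 𝓝 (0 : ℂ), ψ (s (χ ζ)) ^ 2 = ζ ^ 2 := by
    filter_upwards [tθ.eventually hX, hX, hback, tχ.eventually hsX, small, tθ.eventually small]
      with ζ h1 h2 h3 h4 h5 h6
    simp only [Function.comp] at h1 h6
    rw [h3, h4, h2] at h1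
    have h7 := mul_left_cancel₀ hc h1
    obtain ⟨n, hn⟩ := Complex.exp_eq_exp_iff_exists_int.1 h7
    -- Both exponents have norm below 1, so they cannot differ by a nonzero multiple of 2πi.
    have hn0 : n = 0 := by
      by_contra hne
      have e : ε * ζ ^ 2 - ε * ψ (s (χ ζ)) ^ 2 = n * (2 * Real.pi * Complex.I) := by
        rw [hn]; ring
      have b1 : ‖ε * ζ ^ 2 - ε * ψ (s (χ ζ)) ^ 2‖ < 2 :=
        (norm_sub_le _ _).trans_lt (by linarith [h5.2, h6.2])
      rw [e] at b1
      simp only [norm_mul, Complex.norm_intCast, Complex.norm_ofNat, Complex.norm_real,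
        Complex.norm_I, mul_one, Real.norm_eq_abs, abs_of_pos Real.pi_pos] at b1
      have b2 : (1 : ℝ) ≤ |(n : ℝ)| := by exact_mod_cast Int.one_le_abs hne
      nlinarith [Real.pi_gt_three]
    rw [hn0, Int.cast_zero, zero_mul, add_zero] at hn
    exact (mul_left_cancel₀ hε hn).symm
  rcases eq_id_or_eq_neg_of_sq_eq hθ hsq with h1 | h1
  · refine absurd ?_ hsid
    filter_upwards [hr, tψ.eventually h1, tψ.eventually hback] with q h2 h3 h4
    rw [h2] at h3 h4
    rw [id, ← h4, h3, h2]
  · filter_upwards [h1, hback] with ζ h2 h3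
    rw [← h3, h2]

/-- The sign ε is 1 at a and -1 at r/a. It enters the kernel denominator once through log Y and once
through dX/X, so only ε² = 1 survives, and both points share the same `l`. The constant log Y(χ 0)
cancels because dX/X = 2εζ dζ is invariant under ζ ↦ -ζ. -/
theorem isAdapted_of_X_eq {C : RationalCurve} {χ l : ℂ → ℂ} {c ε : ℂ} (hχ : AnalyticAt ℂ χ 0)
    (hd : deriv χ 0 ≠ 0) (hc : c ≠ 0) (hε : ε ^ 2 = 1) (hCX : AnalyticAt ℂ C.X (χ 0))
    (hX : ∀ᶠ ζ in 𝓝 (0 : ℂ), C.X (χ ζ) = c * Complex.exp (ε * ζ ^ 2))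
    (hY : ∀ᶠ ζ in 𝓝 (0 : ℂ), Complex.log (C.Y (χ ζ) / C.Y (χ 0)) = ε * (ζ * l ζ)) :
    IsAdapted C (χ 0) χ l ∧
      ∀ᶠ ζ in 𝓝 (0 : ℂ), logDeriv C.X (χ ζ) * deriv χ ζ = 2 * ε * ζ := by
  have hε0 : ε ≠ 0 := by rintro rfl; norm_num at hε
  have hdeck : C.IsDeck (χ 0) (C.deck (χ 0)) := Classical.epsilon_spec (exists_isDeck hχ hd hX)
  have tχ : Tendsto χ (𝓝 0) (𝓝 (χ 0)) := hχ.continuousAt.tendsto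
  have hneg := IsDeck_eq_neg hχ hd hc hε0 hX hdeck
  have hderiv : ∀ᶠ ζ in 𝓝 (0 : ℂ), deriv (C.deck (χ 0)) (χ ζ) * deriv χ ζ = -deriv χ (-ζ) := by
    filter_upwards [hneg.eventually_nhds, tχ.eventually hdeck.1.eventually_analyticAt,
      hχ.eventually_analyticAt, tendsto_neg_zero.eventually hχ.eventually_analyticAt]
      with ζ h1 h2 h3 h4
    have e1 := h2.differentiableAt.hasDerivAt.comp ζ h3.differentiableAt.hasDerivAt
    have e2 := h4.differentiableAt.hasDerivAt.comp ζ (hasDerivAt_neg ζ)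
    have e3 := (e2.congr_of_eventuallyEq h1).unique e1
    rw [← e3]
    ring
  have hlog : ∀ᶠ ζ in 𝓝 (0 : ℂ), logDeriv C.X (χ ζ) * deriv χ ζ = 2 * ε * ζ := by
    filter_upwards [hX.eventually_nhds, tχ.eventually hCX.eventually_analyticAt,
      hχ.eventually_analyticAt, hX] with ζ h1 h2 h3 h4
    have e1 := h2.differentiableAt.hasDerivAt.comp ζ h3.differentiableAt.hasDerivAt
    have e2 : HasDerivAt (fun ζ : ℂ => c * Complex.exp (ε * ζ ^ 2))
        (c * (Complex.exp (ε * ζ ^ 2) * (ε * (2 * ζ)))) ζ := by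
      simpa using ((((hasDerivAt_id' ζ).fun_pow 2).const_mul ε).cexp).const_mul c
    have e3 := e1.unique (e2.congr_of_eventuallyEq h1)
    rw [logDeriv_apply, div_mul_eq_mul_div, e3, h4]
    have := Complex.exp_ne_zero (ε * ζ ^ 2)
    field_simp
  refine ⟨⟨hχ, rfl, hd, hneg, hderiv, ?_⟩, hlog⟩
  filter_upwards [hneg, hderiv, hlog, tendsto_neg_zero.eventually hlog, hY,
    tendsto_neg_zero.eventually hY] with ζ h1 h2 h3 h4 h5 h6
  rw [sub_mul, mul_assoc, h2, h1]
  simp only [RationalCurve.omega, RationalCurve.logY, h5, h6]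
  linear_combination (ε * (ζ * l ζ) + Complex.log (C.Y (χ 0))) * h3 +
    (ε * (-ζ * l (-ζ)) + Complex.log (C.Y (χ 0))) * h4 + 2 * ζ ^ 2 * (l ζ + l (-ζ)) * hε

/-! ### Expansions of families of Laurent series with parameters -/

section Expansion

variable {E ι : Type} (a₀ : ℂ) (D : ℂ → Set ℂ) (ξ : E → ℂ → ℂ → ℂ)

/-- `H a ζ S` has an expansion in powers of `ζ` whose coefficients are combinations of the products
`∏ ξ (S i)`, `i ∈ I`, with coefficients depending analytically on `a`. -/
def HolExpansion (I : Finset ι) (H : ℂ → ℂ → (ι → ℂ) → ℂ) : Prop :=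
  ∀ M : ℕ, ∃ (J : Type) (_ : Fintype J) (ℓ : J → ℂ × ℂ → ℂ) (k : J → ι → E),
    (∀ j, AnalyticAt ℂ (ℓ j) (a₀, 0)) ∧
    ∀ᶠ a in 𝓝 a₀, ∀ S : ι → ℂ, (∀ i, S i ∈ D a) → ∃ R : ℂ → ℂ, AnalyticAt ℂ R 0 ∧
      ∀ᶠ ζ in 𝓝[≠] 0,
        H a ζ S = ∑ j, ℓ j (a, ζ) * ∏ i ∈ I, ξ (k j i) a (S i) + ζ ^ M * R ζ

/-- `H a ζ S` has such an expansion with finitely many negative powers of `ζ`. -/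
def LaurentExpansion (I : Finset ι) (H : ℂ → ℂ → (ι → ℂ) → ℂ) : Prop :=
  ∃ N : ℕ, HolExpansion a₀ D ξ I fun a ζ S => ζ ^ N * H a ζ S

variable {a₀ D ξ} {I I' : Finset ι} {H H' : ℂ → ℂ → (ι → ℂ) → ℂ}

theorem eventually_analyticAt_fiber {J : Type} [Fintype J] {ℓ : J → ℂ × ℂ → ℂ}
    (h : ∀ j, AnalyticAt ℂ (ℓ j) (a₀, 0)) :
    ∀ᶠ a in 𝓝 a₀, ∀ j, AnalyticAt ℂ (fun ζ => ℓ j (a, ζ)) 0 :=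
  eventually_all.2 fun j => (h j).eventually_fiber

namespace HolExpansion

theorem congr (h : HolExpansion a₀ D ξ I H)
    (e : ∀ᶠ a in 𝓝 a₀, ∀ S : ι → ℂ, (∀ i, S i ∈ D a) → ∀ᶠ ζ in 𝓝[≠] 0, H' a ζ S = H a ζ S) :
    HolExpansion a₀ D ξ I H' := by
  intro M
  obtain ⟨J, _, ℓ, k, hℓ, h⟩ := h M
  refine ⟨J, inferInstance, ℓ, k, hℓ, ?_⟩
  filter_upwards [h, e] with a ha he S hS
  obtain ⟨R, hR, hz⟩ := ha S hS
  refine ⟨R, hR, ?_⟩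
  filter_upwards [hz, he S hS] with ζ h1 h2
  rw [h2, h1]

theorem monomial {ℓ : ℂ × ℂ → ℂ} (hℓ : AnalyticAt ℂ ℓ (a₀, 0)) (k : ι → E) :
    HolExpansion a₀ D ξ I fun a ζ S => ℓ (a, ζ) * ∏ i ∈ I, ξ (k i) a (S i) := by
  intro M
  refine ⟨Unit, inferInstance, fun _ => ℓ, fun _ => k, fun _ => hℓ, ?_⟩
  refine Eventually.of_forall fun a S _ => ⟨fun _ => 0, analyticAt_const, ?_⟩
  exact Eventually.of_forall fun ζ => by simp

theorem zero : HolExpansion a₀ D ξ I fun _ _ _ => 0 := by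
  intro M
  refine ⟨Empty, inferInstance, fun j => j.elim, fun j => j.elim, fun j => j.elim, ?_⟩
  refine Eventually.of_forall fun a S _ => ⟨fun _ => 0, analyticAt_const, ?_⟩
  exact Eventually.of_forall fun ζ => by simp

theorem add (h : HolExpansion a₀ D ξ I H) (h' : HolExpansion a₀ D ξ I H') :
    HolExpansion a₀ D ξ I fun a ζ S => H a ζ S + H' a ζ S := by
  intro M
  obtain ⟨J, _, ℓ, k, hℓ, h⟩ := h M
  obtain ⟨J', _, ℓ', k', hℓ', h'⟩ := h' M
  refine ⟨J ⊕ J', inferInstance, Sum.elim ℓ ℓ', Sum.elim k k', ?_, ?_⟩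
  · rintro (j | j)
    exacts [hℓ j, hℓ' j]
  filter_upwards [h, h'] with a ha ha' S hS
  obtain ⟨R, hR, hz⟩ := ha S hS
  obtain ⟨R', hR', hz'⟩ := ha' S hS
  refine ⟨fun ζ => R ζ + R' ζ, hR.add hR', ?_⟩
  filter_upwards [hz, hz'] with ζ h1 h2
  rw [h1, h2, Fintype.sum_sum_type]
  simp only [Sum.elim_inl, Sum.elim_inr]
  ring

/-- Disjointness keeps at most one basis function per external variable, so products stay of the
prescribed shape. This matches the splitting of the variables into I and its complement in the
recursion. -/
theorem mul [DecidableEq ι] (hI : Disjoint I I') (h : HolExpansion a₀ D ξ I H)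
    (h' : HolExpansion a₀ D ξ I' H') :
    HolExpansion a₀ D ξ (I ∪ I') fun a ζ S => H a ζ S * H' a ζ S := by
  intro M
  obtain ⟨J, _, ℓ, k, hℓ, h⟩ := h M
  obtain ⟨J', _, ℓ', k', hℓ', h'⟩ := h' M
  refine ⟨J × J', inferInstance, fun j p => ℓ j.1 p * ℓ' j.2 p,
    fun j i => if i ∈ I then k j.1 i else k' j.2 i, fun j => (hℓ _).mul (hℓ' _), ?_⟩
  filter_upwards [h, h', eventually_analyticAt_fiber hℓ, eventually_analyticAt_fiber hℓ']
    with a ha ha' an an' S hS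
  obtain ⟨R, hR, hz⟩ := ha S hS
  obtain ⟨R', hR', hz'⟩ := ha' S hS
  let L : ℂ → ℂ := fun ζ => ∑ j, ℓ j (a, ζ) * ∏ i ∈ I, ξ (k j i) a (S i)
  let L' : ℂ → ℂ := fun ζ => ∑ j, ℓ' j (a, ζ) * ∏ i ∈ I', ξ (k' j i) a (S i)
  have hL : AnalyticAt ℂ L 0 :=
    Finset.analyticAt_fun_sum _ fun j _ => (an j).mul analyticAt_const
  have hL' : AnalyticAt ℂ L' 0 :=
    Finset.analyticAt_fun_sum _ fun j _ => (an' j).mul analyticAt_const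
  refine ⟨fun ζ => L ζ * R' ζ + R ζ * L' ζ + ζ ^ M * R ζ * R' ζ,
    ((hL.mul hR').add (hR.mul hL')).add (((analyticAt_id.pow M).mul hR).mul hR'), ?_⟩
  filter_upwards [hz, hz'] with ζ h1 h2
  have e : ∑ j : J × J', ℓ j.1 (a, ζ) * ℓ' j.2 (a, ζ) *
      ∏ i ∈ I ∪ I', ξ (if i ∈ I then k j.1 i else k' j.2 i) a (S i) = L ζ * L' ζ := by
    rw [Finset.sum_mul_sum, ← Finset.univ_product_univ, Finset.sum_product]
    refine Finset.sum_congr rfl fun j _ => Finset.sum_congr rfl fun j' _ => ?_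
    rw [Finset.prod_union hI]
    have e1 : ∏ i ∈ I, ξ (if i ∈ I then k j i else k' j' i) a (S i) =
        ∏ i ∈ I, ξ (k j i) a (S i) :=
      Finset.prod_congr rfl fun i hi => by rw [if_pos hi]
    have e2 : ∏ i ∈ I', ξ (if i ∈ I then k j i else k' j' i) a (S i) =
        ∏ i ∈ I', ξ (k' j' i) a (S i) :=
      Finset.prod_congr rfl fun i hi => by rw [if_neg (Finset.disjoint_right.1 hI hi)]
    simp only [e1, e2]
    ring
  rw [h1, h2, e]
  ring

theorem analytic_mul {ℓ : ℂ × ℂ → ℂ} (hℓ : AnalyticAt ℂ ℓ (a₀, 0))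
    (h : HolExpansion a₀ D ξ I H) : HolExpansion a₀ D ξ I fun a ζ S => ℓ (a, ζ) * H a ζ S := by
  intro M
  obtain ⟨J, _, ℓ', k, hℓ', h⟩ := h M
  refine ⟨J, inferInstance, fun j p => ℓ p * ℓ' j p, k, fun j => hℓ.mul (hℓ' j), ?_⟩
  filter_upwards [h, hℓ.eventually_fiber] with a ha an S hS
  obtain ⟨R, hR, hz⟩ := ha S hS
  refine ⟨fun ζ => ℓ (a, ζ) * R ζ, an.mul hR, ?_⟩
  filter_upwards [hz] with ζ h1
  simp only [h1, mul_add, Finset.mul_sum, mul_assoc]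
  ring

theorem neg (h : HolExpansion a₀ D ξ I H) : HolExpansion a₀ D ξ I fun a ζ S => H a (-ζ) S := by
  intro M
  obtain ⟨J, _, ℓ, k, hℓ, h⟩ := h M
  refine ⟨J, inferInstance, fun j p => ℓ j (p.1, -p.2), k, fun j => ?_, ?_⟩
  · refine AnalyticAt.comp (g := ℓ j) ?_ (analyticAt_fst.prod analyticAt_snd.neg)
    simpa using hℓ j
  filter_upwards [h] with a ha S hS
  obtain ⟨R, hR, hz⟩ := ha S hS
  refine ⟨fun ζ => (-1) ^ M * R (-ζ), analyticAt_const.mul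
    (AnalyticAt.comp (g := R) (by simpa using hR) analyticAt_id.neg), ?_⟩
  filter_upwards [tendsto_neg_punctured.eventually hz] with ζ h1
  rw [h1, neg_pow ζ M]
  ring

end HolExpansion

namespace LaurentExpansion

theorem congr (h : LaurentExpansion a₀ D ξ I H)
    (e : ∀ᶠ a in 𝓝 a₀, ∀ S : ι → ℂ, (∀ i, S i ∈ D a) → ∀ᶠ ζ in 𝓝[≠] 0, H' a ζ S = H a ζ S) :
    LaurentExpansion a₀ D ξ I H' := by
  obtain ⟨N, h⟩ := h
  refine ⟨N, h.congr ?_⟩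
  filter_upwards [e] with a ha S hS
  filter_upwards [ha S hS] with ζ h1
  rw [h1]

theorem of_holExpansion (h : HolExpansion a₀ D ξ I H) : LaurentExpansion a₀ D ξ I H :=
  ⟨0, by simpa using h⟩

theorem zero : LaurentExpansion a₀ D ξ I fun _ _ _ => 0 := of_holExpansion .zero

theorem add (h : LaurentExpansion a₀ D ξ I H) (h' : LaurentExpansion a₀ D ξ I H') :
    LaurentExpansion a₀ D ξ I fun a ζ S => H a ζ S + H' a ζ S := by
  obtain ⟨N, h⟩ := h
  obtain ⟨N', h'⟩ := h'
  have hp : ∀ n : ℕ, AnalyticAt ℂ (fun p : ℂ × ℂ => p.2 ^ n) (a₀, 0) :=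
    fun n => analyticAt_snd.pow n
  refine ⟨N + N', ((h.analytic_mul (hp N')).add (h'.analytic_mul (hp N))).congr ?_⟩
  exact Eventually.of_forall fun a S _ => Eventually.of_forall fun ζ => by ring

theorem sum {κ : Type*} (s : Finset κ) {H : κ → ℂ → ℂ → (ι → ℂ) → ℂ}
    (h : ∀ i ∈ s, LaurentExpansion a₀ D ξ I (H i)) :
    LaurentExpansion a₀ D ξ I fun a ζ S => ∑ i ∈ s, H i a ζ S := by
  classical
  induction s using Finset.induction_on with
  | empty => simpa using zero
  | insert i s hi ih =>
    simp only [Finset.sum_insert hi]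
    exact (h i (Finset.mem_insert_self i s)).add
      (ih fun j hj => h j (Finset.mem_insert_of_mem hj))

theorem mul [DecidableEq ι] (hI : Disjoint I I') (h : LaurentExpansion a₀ D ξ I H)
    (h' : LaurentExpansion a₀ D ξ I' H') :
    LaurentExpansion a₀ D ξ (I ∪ I') fun a ζ S => H a ζ S * H' a ζ S := by
  obtain ⟨N, h⟩ := h
  obtain ⟨N', h'⟩ := h'
  refine ⟨N + N', (h.mul hI h').congr ?_⟩
  exact Eventually.of_forall fun a S _ => Eventually.of_forall fun ζ => by ring

theorem neg (h : LaurentExpansion a₀ D ξ I H) :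
    LaurentExpansion a₀ D ξ I fun a ζ S => H a (-ζ) S := by
  obtain ⟨N, h⟩ := h
  refine ⟨N, (h.neg.analytic_mul (analyticAt_const (v := (-1 : ℂ) ^ N))).congr ?_⟩
  refine Eventually.of_forall fun a S _ => Eventually.of_forall fun ζ => ?_
  have : (-1 : ℂ) ^ N * (-ζ) ^ N = ζ ^ N := by rw [← mul_pow]; simp
  linear_combination -H a (-ζ) S * this

/-- Multiplication by `ζ ^ (-N) ℓ(a, ζ)`. -/
theorem laurent_mul {ℓ u : ℂ × ℂ → ℂ} (hℓ : AnalyticAt ℂ ℓ (a₀, 0)) (N : ℕ)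
    (hu : ∀ᶠ p in 𝓝 (a₀, (0 : ℂ)), p.2 ≠ 0 → p.2 ^ N * u p = ℓ p)
    (h : LaurentExpansion a₀ D ξ I H) : LaurentExpansion a₀ D ξ I fun a ζ S => u (a, ζ) * H a ζ S := by
  obtain ⟨N', h⟩ := h
  refine ⟨N + N', (h.analytic_mul hℓ).congr ?_⟩
  filter_upwards [eventually_fiber hu] with a ha S _
  filter_upwards [nhdsWithin_le_nhds ha, self_mem_nhdsWithin] with ζ h1 h2
  rw [← h1 h2]
  ring

theorem meromorphicAt (h : LaurentExpansion a₀ D ξ I H) :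
    ∀ᶠ a in 𝓝 a₀, ∀ S : ι → ℂ, (∀ i, S i ∈ D a) → MeromorphicAt (fun ζ => H a ζ S) 0 := by
  obtain ⟨N, h⟩ := h
  -- Order 0 suffices: only analyticity of the whole right side is used.
  obtain ⟨J, _, ℓ, k, hℓ, h⟩ := h 0
  filter_upwards [h, eventually_analyticAt_fiber hℓ] with a ha an S hS
  obtain ⟨R, hR, hz⟩ := ha S hS
  have hL : AnalyticAt ℂ (fun ζ => ∑ j, ℓ j (a, ζ) * ∏ i ∈ I, ξ (k j i) a (S i)) 0 :=
    Finset.analyticAt_fun_sum _ fun j _ => (an j).mul analyticAt_const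
  refine (meromorphicAt_inv_sub_pow_mul N (hL.add hR)).congr ?_
  filter_upwards [hz, self_mem_nhdsWithin] with ζ h1 h2
  have h2 : ζ ≠ 0 := h2
  have e : H a ζ S = (ζ ^ N)⁻¹ * (ζ ^ N * H a ζ S) := by field_simp
  rw [e, h1]
  simp

end LaurentExpansion

end Expansion

/-- Taylor's formula with the coefficients written as residues. -/
theorem exists_taylor_residue {a : ℂ} (N : ℕ) : ∀ h : ℂ → ℂ, AnalyticAt ℂ h a →
    ∃ r : ℂ → ℂ, AnalyticAt ℂ r a ∧ ∀ q, h q = ∑ m ∈ Finset.range N,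
      residue (fun q => ((q - a) ^ (m + 1))⁻¹ * h q) a * (q - a) ^ m + (q - a) ^ N * r q := by
  induction N with
  | zero => exact fun h hh => ⟨h, hh, fun q => by simp⟩
  | succ N ih =>
    intro h hh
    obtain ⟨r, hr, e⟩ := ih _ hh.dslope_self
    refine ⟨r, hr, fun q => ?_⟩
    have h1 : h q = h a + (q - a) * dslope h a q := by
      have := sub_smul_dslope h a q
      rw [smul_eq_mul] at this
      rw [this]; ring
    have h0 : residue (fun q => ((q - a) ^ (0 + 1))⁻¹ * h q) a = h a := by
      simpa using (HasResidue.inv_sub_mul hh).residue_eq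
    have h2 : ∀ m : ℕ, residue (fun q => ((q - a) ^ (m + 1 + 1))⁻¹ * h q) a =
        residue (fun q => ((q - a) ^ (m + 1))⁻¹ * dslope h a q) a := by
      intro m
      have hz : HasResidue (fun q => ((q - a) ^ (m + 2))⁻¹ * h a) a 0 := by
        have := HasResidue.inv_sub_pow_mul_succ (H := fun _ => h a) (a := a) (v := 0) m
          analyticAt_const (by simpa using HasResidue.zero)
        simpa using this
      have hd := (meromorphicAt_inv_sub_pow_mul (m + 1) hh.dslope_self).hasResidue
      have := hz.add hd
      rw [zero_add] at this
      rw [← this.residue_eq]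
      refine residue_congr ?_
      filter_upwards [self_mem_nhdsWithin] with q hq
      have hq' := sub_ne_zero.2 (show q ≠ a from hq)
      have h3 := sub_smul_dslope h a q
      rw [smul_eq_mul] at h3
      have h4 : h q = h a + (q - a) * dslope h a q := by rw [h3]; ring
      rw [h4]
      field_simp
      ring
    rw [Finset.sum_range_succ', h0]
    simp only [h2]
    rw [h1, e q, mul_add, Finset.mul_sum, pow_zero, mul_one, pow_succ]
    have : ∀ m, residue (fun q => ((q - a) ^ (m + 1))⁻¹ * dslope h a q) a * (q - a) ^ (m + 1) =
      (q - a) * (residue (fun q => ((q - a) ^ (m + 1))⁻¹ * dslope h a q) a * (q - a) ^ m) :=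
      fun m => by ring
    simp only [this]
    ring

/-! ### The residue against the Cauchy kernel -/

theorem inv_sub_eq_geom {u τ : ℂ} (hu : u ≠ 0) (hτ : u - τ ≠ 0) (M : ℕ) :
    (u - τ)⁻¹ = ∑ m ∈ Finset.range M, τ ^ m * (u ^ (m + 1))⁻¹ + τ ^ M * ((u ^ M)⁻¹ * (u - τ)⁻¹) := by
  induction M with
  | zero => simp
  | succ M ih =>
    rw [Finset.sum_range_succ]
    refine ih.trans ?_
    rw [add_assoc]
    congr 1
    field_simp
    ring

/-- This is the τ-derivative of the finite geometric expansion of 1/(u - τ); the last term is the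
derivative of its remainder. -/
theorem inv_sub_sq_eq_geom {u τ : ℂ} (hu : u ≠ 0) (hτ : u - τ ≠ 0) (M : ℕ) :
    ((u - τ) ^ 2)⁻¹ = ∑ m ∈ Finset.range M, (m + 1) * τ ^ m * (u ^ (m + 2))⁻¹ +
      τ ^ M * (((M + 1) * u - M * τ) * (u ^ (M + 1))⁻¹ * ((u - τ) ^ 2)⁻¹) := by
  induction M with
  | zero =>
    simp only [Finset.range_zero, Finset.sum_empty]
    field_simp
    push_cast
    ring
  | succ M ih =>
    rw [Finset.sum_range_succ]
    refine ih.trans ?_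
    rw [add_assoc]
    congr 1
    push_cast
    field_simp
    ring

/-- The coordinate near `a` attached to `y`. -/
def coord (y : ℂ × ℂ → ℂ) (a ζ : ℂ) : ℂ := a + ζ * y (a, ζ)

section Coord

variable {y : ℂ × ℂ → ℂ} {a₀ : ℂ}

theorem coord_sub (a ζ : ℂ) : coord y a ζ - a = ζ * y (a, ζ) := add_sub_cancel_left _ _

theorem coord_zero (a : ℂ) : coord y a 0 = a := by simp [coord]

theorem analyticAt_coord (hy : AnalyticAt ℂ y (a₀, 0)) :
    AnalyticAt ℂ (fun p : ℂ × ℂ => coord y p.1 p.2) (a₀, 0) :=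
  analyticAt_fst.add (analyticAt_snd.mul hy)

theorem analyticAt_comp_neg {H : ℂ × ℂ → ℂ} (hH : AnalyticAt ℂ H (a₀, 0)) :
    AnalyticAt ℂ (fun p : ℂ × ℂ => H (p.1, -p.2)) (a₀, 0) := by
  refine AnalyticAt.comp (g := H) ?_ (analyticAt_fst.prod analyticAt_snd.neg)
  simpa using hH

theorem analyticAt_comp_neg_one {H : ℂ → ℂ} (hH : AnalyticAt ℂ H 0) :
    AnalyticAt ℂ (fun ζ => H (-ζ)) 0 :=
  AnalyticAt.comp (g := H) (by simpa using hH) analyticAt_id.neg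

theorem eventually_ne_zero_fiber (hy : AnalyticAt ℂ y (a₀, 0)) (hy0 : y (a₀, 0) ≠ 0) :
    ∀ᶠ a in 𝓝 a₀, y (a, 0) ≠ 0 := by
  filter_upwards [eventually_fiber (hy.continuousAt.eventually_ne hy0)] with a ha
  exact ha.self_of_nhds

theorem hasDerivAt_coord_zero {a : ℂ} (h : AnalyticAt ℂ (fun ζ => y (a, ζ)) 0) :
    HasDerivAt (coord y a) (y (a, 0)) 0 := by
  have := ((hasDerivAt_id' (0 : ℂ)).mul h.differentiableAt.hasDerivAt).const_add a
  exact this.congr_deriv (by simp)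

theorem analyticAt_coord_fiber {a : ℂ} (h : AnalyticAt ℂ (fun ζ => y (a, ζ)) 0) :
    AnalyticAt ℂ (coord y a) 0 :=
  analyticAt_const.add (analyticAt_id.mul h)

/-- The difference of powers in the expansion of the kernel. -/
def kernelCoeff (y : ℂ × ℂ → ℂ) (m : ℕ) (p : ℂ × ℂ) : ℂ :=
  (-p.2 * y (p.1, -p.2)) ^ (m + 1) - (p.2 * y p) ^ (m + 1)

theorem analyticAt_kernelCoeff (hy : AnalyticAt ℂ y (a₀, 0)) (m : ℕ) :
    AnalyticAt ℂ (kernelCoeff y m) (a₀, 0) :=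
  ((analyticAt_snd.neg.mul (analyticAt_comp_neg hy)).pow _).sub ((analyticAt_snd.mul hy).pow _)

/-- Expand each Cauchy kernel geometrically in (coordinate - a)/(z - a). The leading terms 1/(z - a)
cancel in the difference, so the poles in z start at order two. One extra term, N + 1 in all, makes
up for the cancelled one. -/
theorem exists_kernel_expansion {a z : ℂ} (h : AnalyticAt ℂ (fun ζ => y (a, ζ)) 0) (hz : z ≠ a)
    (N : ℕ) : ∃ Q : ℂ → ℂ, AnalyticAt ℂ Q 0 ∧ ∀ᶠ ζ in 𝓝 (0 : ℂ),
      1 / (z - coord y a (-ζ)) - 1 / (z - coord y a ζ) =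
        ∑ m ∈ Finset.range N, kernelCoeff y m (a, ζ) * ((z - a) ^ (m + 2))⁻¹ + ζ ^ N * Q ζ := by
  have hc := analyticAt_coord_fiber h
  have hz' : z - a ≠ 0 := sub_ne_zero.2 hz
  have hne : z - coord y a 0 ≠ 0 := by rwa [coord_zero]
  have ha : AnalyticAt ℂ (fun ζ => z - coord y a ζ) 0 := analyticAt_const.sub hc
  let q : ℂ → ℂ := fun ζ => ζ * y (a, ζ) ^ (N + 1) * (((z - a) ^ (N + 1))⁻¹ * (z - coord y a ζ)⁻¹)
  have hq : AnalyticAt ℂ q 0 :=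
    (analyticAt_id.mul (h.pow _)).mul (analyticAt_const.mul (ha.inv hne))
  have key : ∀ ζ, z - coord y a ζ ≠ 0 → 1 / (z - coord y a ζ) =
      (z - a)⁻¹ + ∑ m ∈ Finset.range N, (ζ * y (a, ζ)) ^ (m + 1) * ((z - a) ^ (m + 2))⁻¹ +
        ζ ^ N * q ζ := by
    intro ζ hζ
    have e : z - coord y a ζ = (z - a) - ζ * y (a, ζ) := by rw [← coord_sub]; ring
    have h1 := inv_sub_eq_geom hz' (by rwa [← e]) (N + 1)
    rw [← e, Finset.sum_range_succ'] at h1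
    rw [one_div, h1]
    simp only [q]
    ring
  refine ⟨fun ζ => (-1) ^ N * q (-ζ) - q ζ,
    (analyticAt_const.mul (analyticAt_comp_neg_one hq)).sub hq, ?_⟩
  have hev := ha.continuousAt.eventually_ne hne
  filter_upwards [hev, tendsto_neg_zero.eventually hev] with ζ h1 h2
  rw [key _ h1, key _ h2, neg_pow ζ N]
  simp only [kernelCoeff, sub_mul, Finset.sum_sub_distrib]
  ring

/-- The residues of `ζ²` against the pole parts in the coordinate `ζ`. -/
noncomputable def sqMoment (y : ℂ × ℂ → ℂ) (a : ℂ) (m : ℕ) : ℂ :=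
  residue (fun ζ => ζ ^ 2 * ((coord y a ζ - a) ^ (m + 2))⁻¹ * deriv (coord y a) ζ) 0

/-- `sqMoment y a m` is the Taylor coefficient of ζ² at order m + 1 in the variable `coord - a`. The
sum is therefore the truncated Taylor series at -ζ minus the one at ζ, and (-ζ)² - ζ² = 0 leaves
only the remainders. -/
theorem exists_sqMoment_kernelCoeff {a : ℂ} (h : AnalyticAt ℂ (fun ζ => y (a, ζ)) 0)
    (h0 : y (a, 0) ≠ 0) (N : ℕ) : ∃ Q : ℂ → ℂ, AnalyticAt ℂ Q 0 ∧ ∀ᶠ ζ in 𝓝 (0 : ℂ),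
      ∑ m ∈ Finset.range N, sqMoment y a m * kernelCoeff y m (a, ζ) = ζ ^ N * Q ζ := by
  have hc := analyticAt_coord_fiber h
  have hd : deriv (coord y a) 0 ≠ 0 := by rwa [(hasDerivAt_coord_zero h).deriv]
  obtain ⟨ψ, hψ, hψ0, hl, -⟩ := hc.exists_local_inverse hd
  rw [coord_zero] at hψ hψ0
  have hψ2 : AnalyticAt ℂ (fun q => ψ q ^ 2) a := hψ.pow 2
  obtain ⟨r, hr, e⟩ := exists_taylor_residue (N + 1) _ hψ2
  have hmom : ∀ m : ℕ, residue (fun q => ((q - a) ^ (m + 1 + 1))⁻¹ * ψ q ^ 2) a =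
      sqMoment y a m := by
    intro m
    have h1 : AnalyticAt ℂ (fun ζ => (coord y a ζ - a) ^ (m + 1 + 1)) 0 :=
      (hc.sub analyticAt_const).pow _
    have h2 : AnalyticAt ℂ (fun ζ => ψ (coord y a ζ) ^ 2) 0 := by
      refine AnalyticAt.pow (AnalyticAt.comp (g := ψ) ?_ hc) 2
      rwa [coord_zero]
    have h3 := residue_comp (F := fun q => ((q - a) ^ (m + 1 + 1))⁻¹ * ψ q ^ 2) hc hd
      (h1.meromorphicAt.inv.mul h2.meromorphicAt)
    rw [coord_zero] at h3
    rw [h3, sqMoment]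
    refine residue_congr ?_
    filter_upwards [nhdsWithin_le_nhds hl] with ζ hζ
    rw [hζ]
    ring
  have hrc : AnalyticAt ℂ (fun ζ => r (coord y a ζ)) 0 := by
    refine AnalyticAt.comp (g := r) ?_ hc
    rwa [coord_zero]
  let q : ℂ → ℂ := fun ζ => ζ * y (a, ζ) ^ (N + 1) * r (coord y a ζ)
  have hq : AnalyticAt ℂ q 0 := (analyticAt_id.mul (h.pow _)).mul hrc
  refine ⟨fun ζ => q ζ - (-1) ^ N * q (-ζ),
    hq.sub (analyticAt_const.mul (analyticAt_comp_neg_one hq)), ?_⟩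
  filter_upwards [hl, tendsto_neg_zero.eventually hl] with ζ h1 h2
  have e1 := e (coord y a ζ)
  have e2 := e (coord y a (-ζ))
  simp only [h1, h2, Finset.sum_range_succ', hmom, coord_sub, pow_zero] at e1 e2
  simp only [kernelCoeff, mul_sub, Finset.sum_sub_distrib, q]
  rw [neg_sq] at e2
  have e3 := e2.symm.trans e1
  have e4 : ((-1 : ℂ)) ^ N * (-1) ^ N = 1 := by rw [← mul_pow]; simp
  have e5 : (-ζ * y (a, -ζ)) ^ (N + 1) * r (coord y a (-ζ)) =
      ζ ^ N * ((-1) ^ N * (-ζ * y (a, -ζ) ^ (N + 1) * r (coord y a (-ζ)))) := by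
    rw [mul_pow, pow_succ (-ζ), neg_pow ζ N]
    ring
  have e6 : (ζ * y (a, ζ)) ^ (N + 1) * r (coord y a ζ) =
      ζ ^ N * (ζ * y (a, ζ) ^ (N + 1) * r (coord y a ζ)) := by ring
  rw [e5, e6] at e3
  linear_combination e3

/-- With both factors expanded to order N against a pole of order N, every product containing a
remainder is analytic. The residue is thus an exact finite sum, and no convergence in z or in the
external variables is involved. -/
theorem residue_kernel_eq {J : Type} [Fintype J] {a z : ℂ} {G R : ℂ → ℂ} {ℓ : J → ℂ → ℂ}
    {w : J → ℂ} {N : ℕ} (ay : AnalyticAt ℂ (fun ζ => y (a, ζ)) 0)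
    (aκ : ∀ m : Fin N, AnalyticAt ℂ (fun ζ => kernelCoeff y m (a, ζ)) 0)
    (aℓ : ∀ j, AnalyticAt ℂ (ℓ j) 0) (hR : AnalyticAt ℂ R 0)
    (hG : ∀ᶠ ζ in 𝓝[≠] 0, ζ ^ N * G ζ = ∑ j, ℓ j ζ * w j + ζ ^ N * R ζ) (hz : z ≠ a) :
    residue (fun ζ => (1 / (z - coord y a (-ζ)) - 1 / (z - coord y a ζ)) * G ζ) 0 =
      ∑ j : J × Fin N, residue (fun ζ => (ζ ^ N)⁻¹ * (ℓ j.1 ζ * kernelCoeff y j.2 (a, ζ))) 0 *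
        (((z - a) ^ ((j.2 : ℕ) + 2))⁻¹ * w j.1) := by
  obtain ⟨Q, hQ, hk⟩ := exists_kernel_expansion ay hz N
  have hres : ∀ (j : J × Fin N),
      HasResidue (fun ζ => (ζ ^ N)⁻¹ * (ℓ j.1 ζ * kernelCoeff y j.2 (a, ζ))) 0
        (residue (fun ζ => (ζ ^ N)⁻¹ * (ℓ j.1 ζ * kernelCoeff y j.2 (a, ζ))) 0) := by
    intro j
    have := (meromorphicAt_inv_sub_pow_mul N ((aℓ j.1).mul (aκ j.2))).hasResidue
    simpa using this
  obtain ⟨L, hLdef⟩ : ∃ L : ℂ → ℂ, L = fun ζ => ∑ j, ℓ j ζ * w j := ⟨_, rfl⟩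
  obtain ⟨K, hKdef⟩ : ∃ K : ℂ → ℂ, K = fun ζ => ∑ m : Fin N,
    kernelCoeff y m (a, ζ) * ((z - a) ^ ((m : ℕ) + 2))⁻¹ := ⟨_, rfl⟩
  have hL : AnalyticAt ℂ L 0 := by
    rw [hLdef]
    exact Finset.analyticAt_fun_sum _ fun j _ => (aℓ j).mul analyticAt_const
  have hK : AnalyticAt ℂ K 0 := by
    rw [hKdef]
    exact Finset.analyticAt_fun_sum _ fun m _ => (aκ m).mul analyticAt_const
  have hrem : AnalyticAt ℂ (fun ζ => Q ζ * L ζ + (K ζ + ζ ^ N * Q ζ) * R ζ) 0 :=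
    (hQ.mul hL).add ((hK.add ((analyticAt_id.pow N).mul hQ)).mul hR)
  have h1 := HasResidue.sum (a := 0) (Finset.univ : Finset (J × Fin N)) fun j _ =>
    (hres j).const_mul (((z - a) ^ ((j.2 : ℕ) + 2))⁻¹ * w j.1)
  have h2 := h1.add (HasResidue.of_analyticAt hrem)
  rw [add_zero] at h2
  have h3 : HasResidue
      (fun ζ => (1 / (z - coord y a (-ζ)) - 1 / (z - coord y a ζ)) * G ζ) 0 _ := h2.congr ?_
  · rw [h3.residue_eq]
    exact Finset.sum_congr rfl fun j _ => by ring
  filter_upwards [hG, nhdsWithin_le_nhds hk, self_mem_nhdsWithin] with ζ g1 g2 g3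
  have hζ : ζ ^ N ≠ 0 := pow_ne_zero _ g3
  have eG : G ζ = (ζ ^ N)⁻¹ * (L ζ + ζ ^ N * R ζ) := by
    rw [hLdef, ← g1, inv_mul_cancel_left₀ hζ]
  rw [← Fin.sum_univ_eq_sum_range (fun m => kernelCoeff y m (a, ζ) * ((z - a) ^ (m + 2))⁻¹)] at g2
  have g2' : 1 / (z - coord y a (-ζ)) - 1 / (z - coord y a ζ) = K ζ + ζ ^ N * Q ζ := by
    rw [g2, hKdef]
  have eS : ∑ j : J × Fin N, ((z - a) ^ ((j.2 : ℕ) + 2))⁻¹ * w j.1 *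
      ((ζ ^ N)⁻¹ * (ℓ j.1 ζ * kernelCoeff y j.2 (a, ζ))) = (ζ ^ N)⁻¹ * (L ζ * K ζ) := by
    rw [hLdef, hKdef, Finset.sum_mul_sum, ← Finset.univ_product_univ, Finset.sum_product,
      Finset.mul_sum]
    refine Finset.sum_congr rfl fun j _ => ?_
    rw [Finset.mul_sum]
    exact Finset.sum_congr rfl fun m _ => by ring
  rw [eS, g2', eG]
  field_simp
  ring

/-- Summed under the residue, the kernel coefficients become ζ^N times an analytic function, which
cancels the pole. -/
theorem sum_residue_mul_sqMoment_eq_zero {a : ℂ} {ℓ : ℂ → ℂ} {N : ℕ}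
    (ay : AnalyticAt ℂ (fun ζ => y (a, ζ)) 0) (ay0 : y (a, 0) ≠ 0)
    (aκ : ∀ m : Fin N, AnalyticAt ℂ (fun ζ => kernelCoeff y m (a, ζ)) 0)
    (aℓ : AnalyticAt ℂ ℓ 0) :
    ∑ m : Fin N, sqMoment y a m *
      residue (fun ζ => (ζ ^ N)⁻¹ * (ℓ ζ * kernelCoeff y m (a, ζ))) 0 = 0 := by
  obtain ⟨Q, hQ, hk⟩ := exists_sqMoment_kernelCoeff ay ay0 N
  have hres : ∀ m : Fin N,
      HasResidue (fun ζ => (ζ ^ N)⁻¹ * (ℓ ζ * kernelCoeff y m (a, ζ))) 0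
        (residue (fun ζ => (ζ ^ N)⁻¹ * (ℓ ζ * kernelCoeff y m (a, ζ))) 0) := by
    intro m
    have := (meromorphicAt_inv_sub_pow_mul N (aℓ.mul (aκ m))).hasResidue
    simpa using this
  have h1 := HasResidue.sum (a := 0) (Finset.univ : Finset (Fin N)) fun m _ =>
    (hres m).const_mul (sqMoment y a m)
  refine h1.unique ((HasResidue.of_analyticAt (aℓ.mul hQ)).congr ?_)
  filter_upwards [nhdsWithin_le_nhds hk, self_mem_nhdsWithin] with ζ g1 g2
  have hζ : ζ ^ N ≠ 0 := pow_ne_zero _ g2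
  rw [← Fin.sum_univ_eq_sum_range (fun m => sqMoment y a m * kernelCoeff y m (a, ζ))] at g1
  have : ∀ x : Fin N, sqMoment y a x * ((ζ ^ N)⁻¹ * (ℓ ζ * kernelCoeff y x (a, ζ))) =
      (ζ ^ N)⁻¹ * ℓ ζ * (sqMoment y a x * kernelCoeff y x (a, ζ)) := fun x => by ring
  simp only [this]
  rw [← Finset.mul_sum, g1]
  simp only [Pi.mul_apply]
  field_simp

variable {E ι : Type} [Fintype ι] {D : ℂ → Set ℂ} {ξ : E → ℂ → ℂ → ℂ}
  {G : ℂ → ℂ → (ι → ℂ) → ℂ}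

/-- The residue of the Cauchy kernel against a Laurent expansion is a combination of pole parts,
and it is annihilated by `ζ²`. -/
theorem exists_residue_kernel_eq (hy : AnalyticAt ℂ y (a₀, 0)) (hy0 : y (a₀, 0) ≠ 0)
    (hG : LaurentExpansion a₀ D ξ Finset.univ G) :
    ∃ (J : Type) (_ : Fintype J) (c : J → ℂ → ℂ) (m : J → ℕ) (k : J → ι → E),
      (∀ j, AnalyticAt ℂ (c j) a₀) ∧ ∀ᶠ a in 𝓝 a₀, ∀ S : ι → ℂ, (∀ i, S i ∈ D a) →
        (∀ z, z ≠ a →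
          residue (fun ζ => (1 / (z - coord y a (-ζ)) - 1 / (z - coord y a ζ)) * G a ζ S) 0 =
            ∑ j, c j a * (((z - a) ^ (m j + 2))⁻¹ * ∏ i, ξ (k j i) a (S i))) ∧
        ∑ j, c j a * (sqMoment y a (m j) * ∏ i, ξ (k j i) a (S i)) = 0 := by
  obtain ⟨N, hG⟩ := hG
  obtain ⟨J, _, ℓ, k, hℓ, hG⟩ := hG N
  refine ⟨J × Fin N, inferInstance,
    fun j a => residue (fun ζ => (ζ ^ N)⁻¹ * (ℓ j.1 (a, ζ) * kernelCoeff y j.2 (a, ζ))) 0,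
    fun j => j.2, fun j => k j.1,
    ?_, ?_⟩
  · intro j
    exact AnalyticAt.residue_family N (fun p => ℓ j.1 p * kernelCoeff y j.2 p)
      ((hℓ j.1).mul (analyticAt_kernelCoeff hy _))
  have hκ : ∀ᶠ a in 𝓝 a₀, ∀ m : Fin N, AnalyticAt ℂ (fun ζ => kernelCoeff y m (a, ζ)) 0 :=
    eventually_analyticAt_fiber (ℓ := fun m : Fin N => kernelCoeff y m)
      fun m => analyticAt_kernelCoeff hy m
  have hℓ' := eventually_analyticAt_fiber hℓ
  have hy' := hy.eventually_fiber
  have hy0' := eventually_ne_zero_fiber hy hy0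
  filter_upwards [hG, hℓ', hκ, hy', hy0'] with a ha aℓ aκ ay ay0
  intro S hS
  obtain ⟨R, hR⟩ := ha S hS
  refine ⟨fun z hza => residue_kernel_eq (ℓ := fun j ζ => ℓ j (a, ζ))
    (w := fun j => ∏ i, ξ (k j i) a (S i)) ay aκ aℓ hR.1 hR.2 hza, ?_⟩
  rw [← Finset.univ_product_univ, Finset.sum_product]
  refine Finset.sum_eq_zero fun j _ => ?_
  have h2 := sum_residue_mul_sqMoment_eq_zero ay ay0 aκ (aℓ j)
  refine Eq.trans ?_ ((congrArg (· * ∏ i, ξ (k j i) a (S i)) h2).trans (zero_mul _))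
  simp only [Finset.sum_mul]
  exact Finset.sum_congr rfl fun m _ => by ring

end Coord

/-! ### Adapted coordinates at both ramification points -/

/-- Inversion is a symmetry of the curve that inverts X up to a constant, hence reverses the sign of
dX/X. -/
theorem conifold_X_inversion (f : ℤ) {r t : ℂ} (hr : r ≠ 0) (h0 : t ≠ 0) (h1 : 1 + t ≠ 0)
    (h2 : r + t ≠ 0) :
    (conifoldCurve f r).X (r / t) * (conifoldCurve f r).X t = r ^ f := by
  simp only [conifoldCurve]
  have e1 : 1 + r / t = (r + t) / t := by field_simp; ring
  have e2 : r + r / t = r * (1 + t) / t := by field_simp; ring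
  have h3 : t ^ (f + 1) ≠ 0 := zpow_ne_zero _ h0
  rw [e1, e2, div_zpow, zpow_add_one₀ hr]
  field_simp

/-- `y` and `l` describe a coordinate `ζ` at the ramification point `a` near `a₀`, in which
`X = X(a) exp(ζ²)` and `Y = a exp(ζ l)`. -/
structure IsCoordinate (f : ℤ) (a₀ : ℂ) (y l : ℂ × ℂ → ℂ) : Prop where
  admissible : Admissible f a₀
  analyticAt_y : AnalyticAt ℂ y (a₀, 0)
  y_ne_zero : y (a₀, 0) ≠ 0
  analyticAt_l : AnalyticAt ℂ l (a₀, 0)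
  l_ne_zero : l (a₀, 0) ≠ 0
  log_eq : ∀ᶠ p in 𝓝 (a₀, (0 : ℂ)), Complex.log (coord y p.1 p.2 / p.1) = p.2 * l p
  X_eq : ∀ᶠ p in 𝓝 (a₀, (0 : ℂ)), (conifoldCurve f (ramParam f p.1)).X (coord y p.1 p.2) =
    (conifoldCurve f (ramParam f p.1)).X p.1 * Complex.exp (p.2 ^ 2)

theorem Admissible.exists_isCoordinate {f : ℤ} {a : ℂ} (h : Admissible f a) :
    ∃ y l, IsCoordinate f a y l := by
  obtain ⟨y, l, h1, h2, h3, h4, h5⟩ := h.exists_coordinate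
  exact ⟨y, l, h, h1, h2, h3, h4, h5.mono fun p hp => hp.1, h5.mono fun p hp => hp.2⟩

/-- The set of points at which the correlation functions are regular. -/
def regularSet (r a : ℂ) : Set ℂ := {z | z ≠ 0 ∧ z ≠ a ∧ z * a ≠ r}

/-- The pole parts `(z - a) ^ (-m - 2)` and their images under the involution `z ↦ r / z`. -/
noncomputable def polePart (r a : ℂ) (e : Bool × ℕ) (z : ℂ) : ℂ :=
  if e.1 then -(r / z ^ 2) * ((r / z - a) ^ (e.2 + 2))⁻¹ else ((z - a) ^ (e.2 + 2))⁻¹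

/-- The index of the image of a pole part under the involution. -/
def flipIndex (e : Bool × ℕ) : Bool × ℕ := (!e.1, e.2)

theorem flipIndex_flipIndex (e : Bool × ℕ) : flipIndex (flipIndex e) = e := by
  simp [flipIndex]

theorem polePart_inversion {r a z : ℂ} (hr : r ≠ 0) (hz : z ≠ 0) (e : Bool × ℕ) :
    -(r / z ^ 2) * polePart r a e (r / z) = polePart r a (flipIndex e) z := by
  obtain ⟨b, m⟩ := e
  cases b
  · simp [polePart, flipIndex]
  · have e1 : r / (r / z) = z := by field_simp
    simp only [polePart, flipIndex, e1]
    simp only [if_true, Bool.not_true, Bool.false_eq_true, if_false]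
    field_simp

/-- At r = 0 the image half of every expansion disappears, just as the second ramification point
does. -/
theorem polePart_true_zero (a z : ℂ) (m : ℕ) : polePart 0 a (true, m) z = 0 := by
  simp [polePart]

theorem inversion_mem_regularSet {r a z : ℂ} (hr : r ≠ 0) (hz : z ∈ regularSet r a) :
    r / z ∈ regularSet r a := by
  obtain ⟨h0, h1, h2⟩ := hz
  refine ⟨div_ne_zero hr h0, ?_, ?_⟩
  · rw [Ne, div_eq_iff h0, mul_comm]
    exact fun h => h2 h.symm
  · intro h
    rw [div_mul_eq_mul_div, div_eq_iff h0] at h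
    exact h1 (mul_left_cancel₀ hr h).symm

namespace IsCoordinate

variable {f : ℤ} {a₀ : ℂ} {y l : ℂ × ℂ → ℂ}

theorem eventually_mem_regularSet (h : IsCoordinate f a₀ y l) :
    ∀ᶠ p in 𝓝 (a₀, (0 : ℂ)), p.2 ≠ 0 → coord y p.1 p.2 ∈ regularSet (ramParam f p.1) p.1 := by
  have hc := (analyticAt_coord h.analyticAt_y).continuousAt
  have hr : ContinuousAt (fun p : ℂ × ℂ => ramParam f p.1) (a₀, 0) :=
    ContinuousAt.comp (g := ramParam f) h.admissible.analyticAt_ramParam.continuousAt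
      continuousAt_fst
  have h1 : ∀ᶠ p in 𝓝 (a₀, (0 : ℂ)), coord y p.1 p.2 ≠ 0 :=
    hc.eventually_ne (by simpa [coord] using h.admissible.ne_zero)
  have h2 : ∀ᶠ p in 𝓝 (a₀, (0 : ℂ)), coord y p.1 p.2 * p.1 - ramParam f p.1 ≠ 0 := by
    refine ((hc.mul continuousAt_fst).sub hr).eventually_ne ?_
    simpa [coord, sub_eq_zero] using h.admissible.sq_ne_ramParam
  filter_upwards [h1, h2, h.analyticAt_y.continuousAt.eventually_ne h.y_ne_zero]
    with p g1 g2 g3 g4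
  refine ⟨g1, ?_, sub_ne_zero.1 g2⟩
  rw [← sub_ne_zero, coord_sub]
  exact mul_ne_zero g4 g3

theorem eventually_isAdapted (h : IsCoordinate f a₀ y l) :
    ∀ᶠ a in 𝓝 a₀, IsAdapted (conifoldCurve f (ramParam f a)) a (coord y a) (fun ζ => l (a, ζ)) ∧
      ∀ᶠ ζ in 𝓝 (0 : ℂ), logDeriv (conifoldCurve f (ramParam f a)).X (coord y a ζ) *
        deriv (coord y a) ζ = 2 * ζ := by
  filter_upwards [h.admissible.eventually, h.analyticAt_y.eventually_fiber,
    eventually_ne_zero_fiber h.analyticAt_y h.y_ne_zero, eventually_fiber h.log_eq,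
    eventually_fiber h.X_eq] with a ha ay ay0 alog aX
  have hc := analyticAt_coord_fiber ay
  have hd : deriv (coord y a) 0 ≠ 0 := by rwa [(hasDerivAt_coord_zero ay).deriv]
  have hX : (conifoldCurve f (ramParam f a)).X a ≠ 0 :=
    conifold_X_ne_zero f ha.ne_zero ha.one_add_ne_zero ha.ramParam_add_ne_zero
  have := isAdapted_of_X_eq (C := conifoldCurve f (ramParam f a)) (l := fun ζ => l (a, ζ))
    (ε := 1) hc hd hX (by norm_num)
    (by rw [coord_zero]; exact conifold_analyticAt f ha.ne_zero ha.ramParam_add_ne_zero)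
    (by simpa using aX) (by simpa [coord_zero, conifoldCurve] using alog)
  rw [coord_zero] at this
  simpa using this

/-- The coordinate at a composed with the involution: log X and log Y both change sign up to
constants, which is the case ε = -1 with the same `l`. -/
theorem eventually_isAdapted_inversion (h : IsCoordinate f a₀ y l) :
    ∀ᶠ a in 𝓝 a₀, ramParam f a ≠ 0 → IsAdapted (conifoldCurve f (ramParam f a))
      (ramParam f a / a) (fun ζ => ramParam f a / coord y a ζ) (fun ζ => l (a, ζ)) := by
  filter_upwards [h.admissible.eventually, h.analyticAt_y.eventually_fiber,
    eventually_ne_zero_fiber h.analyticAt_y h.y_ne_zero, eventually_fiber h.log_eq,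
    eventually_fiber h.X_eq] with a ha ay ay0 alog aX hr
  have hc := analyticAt_coord_fiber ay
  have hda := hasDerivAt_coord_zero ay
  have ha0 := ha.ne_zero
  have hc0 : coord y a 0 ≠ 0 := by rwa [coord_zero]
  have hX : (conifoldCurve f (ramParam f a)).X a ≠ 0 :=
    conifold_X_ne_zero f ha.ne_zero ha.one_add_ne_zero ha.ramParam_add_ne_zero
  have hσ : AnalyticAt ℂ (fun ζ => ramParam f a / coord y a ζ) 0 := analyticAt_const.div hc hc0
  have hd : deriv (fun ζ => ramParam f a / coord y a ζ) 0 ≠ 0 := by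
    have : HasDerivAt (fun ζ => ramParam f a / coord y a ζ) _ 0 :=
      (hasDerivAt_const (0 : ℂ) (ramParam f a)).div hda hc0
    rw [this.deriv]
    refine div_ne_zero ?_ (pow_ne_zero 2 hc0)
    simpa using ⟨hr, ay0⟩
  have e0 : ramParam f a + ramParam f a / a ≠ 0 := by
    have : ramParam f a + ramParam f a / a = ramParam f a * (1 + a) / a := by field_simp; ring
    rw [this]
    exact div_ne_zero (mul_ne_zero hr ha.one_add_ne_zero) ha0
  have near : ∀ c : ℂ, c + a ≠ 0 → ∀ᶠ ζ in 𝓝 (0 : ℂ), c + coord y a ζ ≠ 0 := fun c hca =>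
    (continuousAt_const.add hc.continuousAt).eventually_ne
      (by simpa [coord_zero] using hca)
  have hslit : ∀ᶠ ζ in 𝓝 (0 : ℂ), coord y a ζ / a ∈ Complex.slitPlane := by
    refine (hc.continuousAt.div_const a).eventually_mem (Complex.isOpen_slitPlane.mem_nhds ?_)
    rw [coord_zero, div_self ha0]
    simp
  have := isAdapted_of_X_eq (C := conifoldCurve f (ramParam f a)) (l := fun ζ => l (a, ζ))
    (ε := -1) (c := ramParam f a ^ f / (conifoldCurve f (ramParam f a)).X a) hσ hd
    (div_ne_zero (zpow_ne_zero _ hr) hX) (by norm_num)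
    (by rw [coord_zero]; exact conifold_analyticAt f (div_ne_zero hr ha0) e0)
    (by
      filter_upwards [aX, near 0 (by simpa using ha0), near 1 ha.one_add_ne_zero,
        near _ ha.ramParam_add_ne_zero] with ζ g1 g2 g3 g4
      rw [zero_add] at g2
      have g5 := conifold_X_inversion f hr g2 g3 g4
      rw [g1] at g5
      rw [← g5, neg_one_mul, Complex.exp_neg]
      have := Complex.exp_ne_zero (ζ ^ 2)
      field_simp)
    (by
      filter_upwards [alog, hslit, near 0 (by simpa using ha0)] with ζ g1 g2 g3
      rw [zero_add] at g3
      simp only [coord_zero]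
      have e1 : (conifoldCurve f (ramParam f a)).Y (ramParam f a / coord y a ζ) /
          (conifoldCurve f (ramParam f a)).Y (ramParam f a / a) = (coord y a ζ / a)⁻¹ := by
        simp only [conifoldCurve]
        field_simp
      rw [e1, Complex.log_inv _ (Complex.slitPlane_arg_ne_pi g2), g1]
      ring)
  simp only [coord_zero] at this
  exact this.1

end IsCoordinate

/-! ### The recursion in an adapted coordinate -/

namespace RationalCurve

variable (C : RationalCurve)

/-- The part of the integrand of the recursion that involves correlation functions. -/
noncomputable def recursionTerm (g n : ℕ) (u v : ℂ) (S : Fin n → ℂ) : ℂ :=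
  (if 0 < g then C.corr (g - 1) (n + 1) u (Fin.cons v S) else 0) +
    ∑ m : Fin (g + 1), ∑ I : Finset (Fin n),
      if ¬ (m.val = 0 ∧ I = ∅) ∧ ¬ (g - m.val = 0 ∧ Iᶜ = ∅) then
        C.corr m.val I.card u (fun i => S (I.orderEmbOfFin rfl i)) *
          C.corr (g - m.val) Iᶜ.card v (fun i => S (Iᶜ.orderEmbOfFin rfl i))
      else 0

/-- The contribution of the ramification point `b` to the recursion. -/
noncomputable def recursionResidue (g n : ℕ) (z : ℂ) (S : Fin n → ℂ) (b : ℂ) : ℂ :=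
  residue (fun q => C.kernel b z q * deriv (C.deck b) q *
    C.recursionTerm g n q (C.deck b q) S) b

theorem corr_eq_finsum (g n : ℕ) (h : 2 ≤ 2 * g + n) (z : ℂ) (S : Fin n → ℂ) :
    C.corr g n z S = ∑ᶠ a ∈ C.ram, C.recursionResidue g n z S a :=
  C.corr_recursion g n h z S

variable {C}

/-- The factor of the kernel that does not depend on the external variable. -/
noncomputable def _root_.kernelFactor (χ l : ℂ → ℂ) (ζ : ℂ) : ℂ :=
  1 / 2 * (deriv χ ζ * -deriv χ (-ζ)) / (2 * ζ ^ 2 * (l ζ + l (-ζ)))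

/-- Substitute q = χ(ζ). The form dq and the kernel denominator each give a factor χ'(ζ), while
s'(q) = -χ'(-ζ)/χ'(ζ); together they form the numerator of `kernelFactor`. -/
theorem recursionResidue_eq {g n : ℕ} {z b : ℂ} {S : Fin n → ℂ} {χ l : ℂ → ℂ}
    (h : IsAdapted C b χ l) (hl : AnalyticAt ℂ l 0)
    (hm : MeromorphicAt (fun ζ => C.recursionTerm g n (χ ζ) (χ (-ζ)) S) 0) :
    C.recursionResidue g n z S b =
      residue (fun ζ => (1 / (z - χ (-ζ)) - 1 / (z - χ ζ)) *
        (kernelFactor χ l ζ * C.recursionTerm g n (χ ζ) (χ (-ζ)) S)) 0 := by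
  have hχ := h.analyticAt
  have hd : ∀ᶠ ζ in 𝓝 (0 : ℂ), deriv χ ζ ≠ 0 := hχ.deriv.continuousAt.eventually_ne h.deriv_ne_zero
  have key : ∀ᶠ ζ in 𝓝 (0 : ℂ), C.kernel b z (χ ζ) * deriv (C.deck b) (χ ζ) *
      C.recursionTerm g n (χ ζ) (C.deck b (χ ζ)) S =
      (1 / (z - χ (-ζ)) - 1 / (z - χ ζ)) *
        (1 / 2 * (-deriv χ (-ζ)) / (2 * ζ ^ 2 * (l ζ + l (-ζ))) *
          C.recursionTerm g n (χ ζ) (χ (-ζ)) S) := by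
    filter_upwards [hd, h.deck_eq, h.deriv_deck, h.omega_sub] with ζ h1 h2 h3 h4
    have e1 := eq_div_of_mul_eq h1 h3
    have e2 := eq_div_of_mul_eq h1 h4
    rw [h2] at e2
    simp only [kernel, h2, e2]
    rw [e1]
    rcases eq_or_ne (2 * ζ ^ 2 * (l ζ + l (-ζ))) 0 with h5 | h5
    · simp [h5]
    · generalize 2 * ζ ^ 2 * (l ζ + l (-ζ)) = Q at *
      field_simp
  have hneg : ∀ {F : ℂ → ℂ}, AnalyticAt ℂ F 0 → AnalyticAt ℂ (fun ζ => F (-ζ)) 0 :=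
    fun hF => analyticAt_comp_neg_one hF
  have hmer : MeromorphicAt (fun ζ => (1 / (z - χ (-ζ)) - 1 / (z - χ ζ)) *
        (1 / 2 * (-deriv χ (-ζ)) / (2 * ζ ^ 2 * (l ζ + l (-ζ))) *
          C.recursionTerm g n (χ ζ) (χ (-ζ)) S)) 0 := by
    have m1 : MeromorphicAt (fun ζ => 1 / (z - χ (-ζ)) - 1 / (z - χ ζ)) 0 :=
      ((MeromorphicAt.const 1 0).div (analyticAt_const.sub (hneg hχ)).meromorphicAt).sub
        ((MeromorphicAt.const 1 0).div (analyticAt_const.sub hχ).meromorphicAt)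
    have m2 : MeromorphicAt (fun ζ => 1 / 2 * (-deriv χ (-ζ)) / (2 * ζ ^ 2 * (l ζ + l (-ζ)))) 0 :=
      (analyticAt_const.mul (hneg hχ.deriv).neg).meromorphicAt.div
        ((analyticAt_const.mul (analyticAt_id.pow 2)).mul (hl.add (hneg hl))).meromorphicAt
    exact m1.mul (m2.mul hm)
  have hmer' := hmer.congr (nhdsWithin_le_nhds (key.mono fun ζ hζ => hζ.symm))
  rw [recursionResidue, ← h.map_zero, residue_comp hχ h.deriv_ne_zero]
  · refine residue_congr ?_
    filter_upwards [nhdsWithin_le_nhds key] with ζ hζ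
    rw [h.map_zero, hζ, kernelFactor]
    ring
  · rw [h.map_zero]
    exact hmer'

end RationalCurve

/-! ### Expansions of the correlation functions at the ramification point -/

/-- `u (a, ζ)` is a Laurent series in `ζ` with coefficients depending analytically on `a`. -/
def LaurentFamily (a₀ : ℂ) (u : ℂ × ℂ → ℂ) : Prop :=
  ∃ (N : ℕ) (ℓ : ℂ × ℂ → ℂ), AnalyticAt ℂ ℓ (a₀, 0) ∧
    ∀ᶠ p in 𝓝 (a₀, (0 : ℂ)), p.2 ≠ 0 → p.2 ^ N * u p = ℓ p

namespace LaurentFamily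

variable {a₀ : ℂ} {u v : ℂ × ℂ → ℂ}

theorem of_analyticAt (h : AnalyticAt ℂ u (a₀, 0)) : LaurentFamily a₀ u :=
  ⟨0, u, h, Eventually.of_forall fun p _ => by simp⟩

theorem mul (hu : LaurentFamily a₀ u) (hv : LaurentFamily a₀ v) :
    LaurentFamily a₀ fun p => u p * v p := by
  obtain ⟨N, ℓ, hℓ, h⟩ := hu
  obtain ⟨N', ℓ', hℓ', h'⟩ := hv
  refine ⟨N + N', fun p => ℓ p * ℓ' p, hℓ.mul hℓ', ?_⟩
  filter_upwards [h, h'] with p h1 h2 h3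
  rw [← h1 h3, ← h2 h3]
  ring

theorem tendsto_neg_snd : Tendsto (fun p : ℂ × ℂ => (p.1, -p.2)) (𝓝 (a₀, 0)) (𝓝 (a₀, 0)) := by
  have : Continuous (fun p : ℂ × ℂ => (p.1, -p.2)) := by fun_prop
  simpa using this.tendsto (a₀, 0)

theorem neg (hu : LaurentFamily a₀ u) : LaurentFamily a₀ fun p => u (p.1, -p.2) := by
  obtain ⟨N, ℓ, hℓ, h⟩ := hu
  refine ⟨N, fun p => (-1) ^ N * ℓ (p.1, -p.2), analyticAt_const.mul (analyticAt_comp_neg hℓ), ?_⟩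
  filter_upwards [tendsto_neg_snd.eventually h] with p h1 h2
  rw [← h1 (neg_ne_zero.2 h2)]
  have : (-1 : ℂ) ^ N * (-p.2) ^ N = p.2 ^ N := by rw [← mul_pow]; simp
  linear_combination -u (p.1, -p.2) * this

theorem mul_expansion {E ι : Type} {D : ℂ → Set ℂ} {ξ : E → ℂ → ℂ → ℂ} {I : Finset ι}
    {H : ℂ → ℂ → (ι → ℂ) → ℂ} (hu : LaurentFamily a₀ u) (h : LaurentExpansion a₀ D ξ I H) :
    LaurentExpansion a₀ D ξ I fun a ζ S => u (a, ζ) * H a ζ S := by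
  obtain ⟨N, ℓ, hℓ, hN⟩ := hu
  exact h.laurent_mul hℓ N hN

theorem monomial {E ι : Type} {D : ℂ → Set ℂ} {ξ : E → ℂ → ℂ → ℂ} (hu : LaurentFamily a₀ u)
    (I : Finset ι) (k : ι → E) :
    LaurentExpansion a₀ D ξ I fun a ζ S => u (a, ζ) * ∏ i ∈ I, ξ (k i) a (S i) :=
  hu.mul_expansion ((LaurentExpansion.of_holExpansion
    (HolExpansion.monomial (ℓ := fun _ => 1) analyticAt_const k)).congr
    (Eventually.of_forall fun a S _ => Eventually.of_forall fun ζ => by simp))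

end LaurentFamily

/-- The conifold curve with ramification point `a`. -/
noncomputable def ramCurve (f : ℤ) (a : ℂ) : RationalCurve := conifoldCurve f (ramParam f a)

/-- The correlation function `W^g_{n+1}` of the curves near `a₀` is a combination of products of
pole parts, invariant under the involution, with coefficients analytic in the parameter. Its pole
part at `a` is annihilated by `ζ²`. -/
def StableForm (f : ℤ) (a₀ : ℂ) (y : ℂ × ℂ → ℂ) (g n : ℕ) : Prop :=
  ∃ (J : Type) (_ : Fintype J) (c : J → ℂ → ℂ) (m : J → ℕ) (k : J → Fin n → Bool × ℕ),
    (∀ j, AnalyticAt ℂ (c j) a₀) ∧ ∀ᶠ a in 𝓝 a₀, ∀ S : Fin n → ℂ,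
      (∀ i, S i ∈ regularSet (ramParam f a) a) →
      (∀ z ∈ regularSet (ramParam f a) a, (ramCurve f a).corr g n z S = ∑ j, c j a *
        (polePart (ramParam f a) a (false, m j) z * ∏ i, polePart (ramParam f a) a (k j i) (S i) +
          polePart (ramParam f a) a (true, m j) z *
            ∏ i, polePart (ramParam f a) a (flipIndex (k j i)) (S i))) ∧
      ∑ j, c j a * (sqMoment y a (m j) * ∏ i, polePart (ramParam f a) a (k j i) (S i)) = 0

theorem prod_orderEmbOfFin {n : ℕ} (I : Finset (Fin n)) (F : Fin n → ℂ) :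
    ∏ i : Fin I.card, F (I.orderEmbOfFin rfl i) = ∏ i ∈ I, F i := by
  conv_rhs => rw [← Finset.map_orderEmbOfFin_univ I rfl, Finset.prod_map]
  rfl

theorem RationalCurve.corr_zero_of_eq_one (C : RationalCurve) {n : ℕ} (hn : n = 1) (z : ℂ)
    (S : Fin n → ℂ) (i : Fin n) : C.corr 0 n z S = 1 / (z - S i) ^ 2 := by
  subst hn
  rw [C.corr_zero_one, Subsingleton.elim i 0]

namespace IsCoordinate

variable {f : ℤ} {a₀ : ℂ} {y l : ℂ × ℂ → ℂ}

/-- A pole part at a contributes a pole of order m + 2 in ζ. Its image under the involution is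
regular at a, since r/a ≠ a. -/
theorem laurentFamily_polePart (h : IsCoordinate f a₀ y l) (e : Bool × ℕ) :
    LaurentFamily a₀ fun p => polePart (ramParam f p.1) p.1 e (coord y p.1 p.2) := by
  obtain ⟨b, m⟩ := e
  have hy := h.analyticAt_y
  have hc := analyticAt_coord hy
  cases b
  · refine ⟨m + 2, fun p => (y p ^ (m + 2))⁻¹, (hy.pow _).inv (pow_ne_zero _ h.y_ne_zero), ?_⟩
    filter_upwards [hy.continuousAt.eventually_ne h.y_ne_zero] with p h1 h2
    simp only [polePart, Bool.false_eq_true, if_false, coord_sub, mul_pow, mul_inv]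
    rw [mul_inv_cancel_left₀ (pow_ne_zero _ h2)]
  · refine LaurentFamily.of_analyticAt ?_
    have hr : AnalyticAt ℂ (fun p : ℂ × ℂ => ramParam f p.1) (a₀, 0) :=
      AnalyticAt.comp (g := ramParam f) h.admissible.analyticAt_ramParam analyticAt_fst
    have ha := h.admissible.ne_zero
    have h0 : coord y a₀ 0 ≠ 0 := by simpa [coord] using ha
    have h1 : ramParam f a₀ / coord y a₀ 0 - a₀ ≠ 0 := by
      rw [coord_zero, sub_ne_zero, Ne, div_eq_iff ha]
      exact fun h' => h.admissible.sq_ne_ramParam h'.symm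
    have h2 : AnalyticAt ℂ (fun p : ℂ × ℂ => ramParam f p.1 / coord y p.1 p.2 - p.1) (a₀, 0) :=
      (hr.div hc h0).sub analyticAt_fst
    simp only [polePart, if_true]
    exact (hr.div (hc.pow 2) (pow_ne_zero 2 h0)).neg.mul ((h2.pow _).inv (pow_ne_zero _ h1))

theorem eventually_mem_fiber (h : IsCoordinate f a₀ y l) : ∀ᶠ a in 𝓝 a₀, ∀ᶠ ζ in 𝓝[≠] (0 : ℂ),
    coord y a ζ ∈ regularSet (ramParam f a) a ∧ coord y a (-ζ) ∈ regularSet (ramParam f a) a := by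
  filter_upwards [eventually_fiber h.eventually_mem_regularSet] with a ha
  have h1 : ∀ᶠ ζ in 𝓝[≠] (0 : ℂ), coord y a ζ ∈ regularSet (ramParam f a) a := by
    filter_upwards [nhdsWithin_le_nhds ha, self_mem_nhdsWithin] with ζ h1 h2
    exact h1 h2
  filter_upwards [h1, tendsto_neg_punctured.eventually h1] with ζ h2 h3
  exact ⟨h2, h3⟩

/-- For q near a, W⁰₂(q, S i) expands in the pole parts of S i at a, which is how these enter the
higher correlation functions. -/
theorem expansion_cauchy (h : IsCoordinate f a₀ y l) {n : ℕ} (i : Fin n) :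
    LaurentExpansion a₀ (fun a => regularSet (ramParam f a) a)
      (fun e a z => polePart (ramParam f a) a e z) {i}
      fun a ζ S => 1 / (coord y a ζ - S i) ^ 2 := by
  refine LaurentExpansion.of_holExpansion fun M => ⟨Fin M, inferInstance,
    fun m p => (m + 1) * (p.2 * y p) ^ (m : ℕ), fun m _ => (false, m),
    fun m => analyticAt_const.mul ((analyticAt_snd.mul h.analyticAt_y).pow _), ?_⟩
  filter_upwards [h.analyticAt_y.eventually_fiber] with a ay S hS
  have hu : S i - a ≠ 0 := sub_ne_zero.2 (hS i).2.1
  have hτ : AnalyticAt ℂ (fun ζ => ζ * y (a, ζ)) 0 := analyticAt_id.mul ay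
  have hd : AnalyticAt ℂ (fun ζ => (S i - a) - ζ * y (a, ζ)) 0 := analyticAt_const.sub hτ
  have hd0 : (S i - a) - 0 * y (a, 0) ≠ 0 := by simpa using hu
  refine ⟨fun ζ => y (a, ζ) ^ M * (((M + 1) * (S i - a) - M * (ζ * y (a, ζ))) *
    ((S i - a) ^ (M + 1))⁻¹ * (((S i - a) - ζ * y (a, ζ)) ^ 2)⁻¹), ?_, ?_⟩
  · exact (ay.pow M).mul (((analyticAt_const.sub (analyticAt_const.mul hτ)).mul
      analyticAt_const).mul ((hd.pow 2).inv (pow_ne_zero 2 hd0)))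
  · filter_upwards [nhdsWithin_le_nhds (hd.continuousAt.eventually_ne hd0)] with ζ hζ
    have e : (coord y a ζ - S i) ^ 2 = ((S i - a) - ζ * y (a, ζ)) ^ 2 := by
      rw [coord]; ring
    have h3 := inv_sub_sq_eq_geom hu hζ M
    rw [← Fin.sum_univ_eq_sum_range
      (fun m => ((m : ℂ) + 1) * (ζ * y (a, ζ)) ^ m * ((S i - a) ^ (m + 2))⁻¹)] at h3
    rw [e, one_div]
    refine h3.trans ?_
    simp only [Finset.prod_singleton, polePart, Bool.false_eq_true, if_false]
    ring

theorem expansion_corr (h : IsCoordinate f a₀ y l) {g n : ℕ} {I : Finset (Fin n)}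
    (h1 : 1 ≤ 2 * g + I.card) (hst : 2 ≤ 2 * g + I.card → StableForm f a₀ y g I.card) :
    LaurentExpansion a₀ (fun a => regularSet (ramParam f a) a)
      (fun e a z => polePart (ramParam f a) a e z) I
      fun a ζ S => (ramCurve f a).corr g I.card (coord y a ζ)
        (fun i => S (I.orderEmbOfFin rfl i)) := by
  by_cases h2 : 2 ≤ 2 * g + I.card
  · obtain ⟨J, _, c, m, k, hc, hW⟩ := hst h2
    have inj := (I.orderEmbOfFin rfl).injective
    -- The indices are transported from `Fin I.card` to `I`; the default (false, 0) off `I` never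
    -- enters the product over `I`.
    let κ : J → Fin n → Bool × ℕ := fun j => Function.extend (I.orderEmbOfFin rfl) (k j)
      fun _ => (false, 0)
    have hκ : ∀ j i, κ j (I.orderEmbOfFin rfl i) = k j i := fun j i => inj.extend_apply _ _ i
    have hterm : ∀ (j : J) (b : Bool) (k' : Fin n → Bool × ℕ),
        LaurentExpansion a₀ (fun a => regularSet (ramParam f a) a)
          (fun e a z => polePart (ramParam f a) a e z) I fun a ζ S =>
            (c j a * polePart (ramParam f a) a (b, m j) (coord y a ζ)) *
              ∏ i ∈ I, polePart (ramParam f a) a (k' i) (S i) := by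
      intro j b k'
      have hcj : AnalyticAt ℂ (fun p : ℂ × ℂ => c j p.1) (a₀, 0) :=
        AnalyticAt.comp (g := c j) (hc j) analyticAt_fst
      exact ((LaurentFamily.of_analyticAt hcj).mul
        (h.laurentFamily_polePart (b, m j))).monomial I k'
    refine (LaurentExpansion.sum Finset.univ fun j _ => (hterm j false (κ j)).add
      (hterm j true fun i => flipIndex (κ j i))).congr ?_
    filter_upwards [hW, h.eventually_mem_fiber] with a ha hmem S hS
    filter_upwards [hmem] with ζ hζ
    rw [(ha (fun i => S (I.orderEmbOfFin rfl i)) fun i => hS _).1 _ hζ.1]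
    refine Finset.sum_congr rfl fun j _ => ?_
    rw [← prod_orderEmbOfFin I, ← prod_orderEmbOfFin I]
    simp only [hκ]
    ring
  · have hg : g = 0 := by omega
    subst hg
    have hI : I.card = 1 := by omega
    obtain ⟨i, rfl⟩ := Finset.card_eq_one.1 hI
    refine (h.expansion_cauchy i).congr (Eventually.of_forall fun a S _ =>
      Eventually.of_forall fun ζ => ?_)
    rw [RationalCurve.corr_zero_of_eq_one _ hI _ _ ⟨0, by omega⟩]
    have : ∀ j, ({i} : Finset (Fin n)).orderEmbOfFin rfl j = i := fun j =>
      Finset.mem_singleton.1 (Finset.orderEmbOfFin_mem _ rfl j)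
    rw [this]

theorem expansion_corr_cons (h : IsCoordinate f a₀ y l) {g n : ℕ}
    (hst : 2 ≤ 2 * g + (n + 1) → StableForm f a₀ y g (n + 1)) :
    LaurentExpansion a₀ (fun a => regularSet (ramParam f a) a)
      (fun e a z => polePart (ramParam f a) a e z) Finset.univ
      fun a ζ (S : Fin n → ℂ) => (ramCurve f a).corr g (n + 1) (coord y a ζ)
        (Fin.cons (coord y a (-ζ)) S) := by
  by_cases h2 : 2 ≤ 2 * g + (n + 1)
  · obtain ⟨J, _, c, m, k, hc, hW⟩ := hst h2
    have hterm : ∀ (j : J) (b : Bool) (k' : Fin (n + 1) → Bool × ℕ),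
        LaurentExpansion a₀ (fun a => regularSet (ramParam f a) a)
          (fun e a z => polePart (ramParam f a) a e z) Finset.univ fun a ζ (S : Fin n → ℂ) =>
            (c j a * polePart (ramParam f a) a (b, m j) (coord y a ζ)) *
              polePart (ramParam f a) a (k' 0) (coord y a (-ζ)) *
              ∏ i, polePart (ramParam f a) a (k' (Fin.succ i)) (S i) := by
      intro j b k'
      have hcj : AnalyticAt ℂ (fun p : ℂ × ℂ => c j p.1) (a₀, 0) :=
        AnalyticAt.comp (g := c j) (hc j) analyticAt_fst
      exact (((LaurentFamily.of_analyticAt hcj).mul (h.laurentFamily_polePart (b, m j))).mul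
        (h.laurentFamily_polePart (k' 0)).neg).monomial Finset.univ fun i => k' (Fin.succ i)
    refine (LaurentExpansion.sum Finset.univ fun j _ => (hterm j false (k j)).add
      (hterm j true fun i => flipIndex (k j i))).congr ?_
    filter_upwards [hW, h.eventually_mem_fiber] with a ha hmem S hS
    filter_upwards [hmem] with ζ hζ
    rw [(ha (Fin.cons (coord y a (-ζ)) S) (Fin.cases (by simpa using hζ.2) (by simpa using hS))).1
      _ hζ.1]
    refine Finset.sum_congr rfl fun j _ => ?_
    simp only [Fin.prod_univ_succ, Fin.cons_zero, Fin.cons_succ]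
    ring
  -- The remaining case is W⁰₂(q, s(q)), whose denominator is ζ² times a nonvanishing function.
  · obtain ⟨rfl, rfl⟩ : g = 0 ∧ n = 0 := by omega
    have hy := h.analyticAt_y
    have hs : AnalyticAt ℂ (fun p : ℂ × ℂ => y p + y (p.1, -p.2)) (a₀, 0) :=
      hy.add (analyticAt_comp_neg hy)
    have hs0 : y (a₀, 0) + y (a₀, -0) ≠ 0 := by
      rw [neg_zero, ← two_mul]
      exact mul_ne_zero two_ne_zero h.y_ne_zero
    have hu : LaurentFamily a₀ fun p => 1 / (coord y p.1 p.2 - coord y p.1 (-p.2)) ^ 2 := by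
      refine ⟨2, fun p => ((y p + y (p.1, -p.2)) ^ 2)⁻¹,
        (hs.pow 2).inv (pow_ne_zero 2 hs0), ?_⟩
      filter_upwards [hs.continuousAt.eventually_ne hs0] with p h3 h4
      have e : coord y p.1 p.2 - coord y p.1 (-p.2) = p.2 * (y p + y (p.1, -p.2)) := by
        simp only [coord]; ring
      rw [e]
      field_simp
    refine (hu.monomial Finset.univ fun _ => (false, 0)).congr
      (Eventually.of_forall fun a S _ => Eventually.of_forall fun ζ => ?_)
    simp [RationalCurve.corr_zero_one]

theorem expansion_recursionTerm (h : IsCoordinate f a₀ y l) {g n : ℕ}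
    (hst : ∀ g' n', 2 ≤ 2 * g' + n' → 2 * g' + n' < 2 * g + n → StableForm f a₀ y g' n') :
    LaurentExpansion a₀ (fun a => regularSet (ramParam f a) a)
      (fun e a z => polePart (ramParam f a) a e z) Finset.univ
      fun a ζ (S : Fin n → ℂ) =>
        (ramCurve f a).recursionTerm g n (coord y a ζ) (coord y a (-ζ)) S := by
  unfold RationalCurve.recursionTerm
  refine LaurentExpansion.add ?_ (LaurentExpansion.sum _ fun m _ => LaurentExpansion.sum _
    fun I _ => ?_)
  · split_ifs with hg
    · exact h.expansion_corr_cons fun h2 => hst _ _ h2 (by omega)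
    · exact .zero
  · split_ifs with hI
    · have h1 := m.isLt
      have h2 := Finset.card_add_card_compl I
      rw [Fintype.card_fin] at h2
      rw [← Finset.card_eq_zero, ← Finset.card_eq_zero] at hI
      have e1 := h.expansion_corr (g := m) (I := I) (by omega) fun h3 => hst _ _ h3 (by omega)
      have e2 := (h.expansion_corr (g := g - m) (I := Iᶜ) (by omega)
        fun h3 => hst _ _ h3 (by omega)).neg
      have := e1.mul disjoint_compl_right e2
      rwa [Finset.union_compl] at this
    · exact .zero

theorem laurentFamily_kernelFactor (h : IsCoordinate f a₀ y l) :
    LaurentFamily a₀ fun p => kernelFactor (coord y p.1) (fun ζ => l (p.1, ζ)) p.2 := by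
  have hd := (analyticAt_coord h.analyticAt_y).partial_deriv
  have hl := h.analyticAt_l
  have hs : AnalyticAt ℂ (fun p : ℂ × ℂ => l p + l (p.1, -p.2)) (a₀, 0) :=
    hl.add (analyticAt_comp_neg hl)
  have hs0 : l (a₀, 0) + l (a₀, -0) ≠ 0 := by
    rw [neg_zero, ← two_mul]
    exact mul_ne_zero two_ne_zero h.l_ne_zero
  refine ⟨2, fun p => 1 / 2 * (deriv (coord y p.1) p.2 * -deriv (coord y p.1) (-p.2)) *
    (2 * (l p + l (p.1, -p.2)))⁻¹, (analyticAt_const.mul (hd.mul (analyticAt_comp_neg hd).neg)).mul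
    ((analyticAt_const.mul hs).inv (mul_ne_zero two_ne_zero hs0)), ?_⟩
  filter_upwards [hs.continuousAt.eventually_ne hs0] with p h1 h2
  rw [kernelFactor]
  field_simp

end IsCoordinate

/-! ### Invariance under the involution -/

theorem inversion_deriv_mul {r z : ℂ} (hr : r ≠ 0) (hz : z ≠ 0) :
    -(r / z ^ 2) * -(r / (r / z) ^ 2) = 1 := by
  field_simp

/-- Under the involution the Cauchy kernel changes only by the summand 1/z, which cancels in the
difference. -/
theorem cauchy_inversion {r z u v : ℂ} (hz : z ≠ 0) (hu : u ≠ 0) (hv : v ≠ 0)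
    (hzu : z * u ≠ r) (hzv : z * v ≠ r) :
    1 / (z - r / v) - 1 / (z - r / u) =
      -(r / z ^ 2) * (1 / (r / z - v) - 1 / (r / z - u)) := by
  have e : ∀ w : ℂ, w ≠ 0 → z * w ≠ r →
      1 / (z - r / w) = 1 / z + -(r / z ^ 2) * (1 / (r / z - w)) := by
    intro w hw hzw
    have h1 : z * w - r ≠ 0 := sub_ne_zero.2 hzw
    have e1 : z - r / w = (z * w - r) / w := by field_simp
    have e2 : r / z - w = -(z * w - r) / z := by field_simp; ring
    rw [e1, e2, neg_div, one_div_neg_eq_neg_one_div, one_div_div, one_div_div]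
    generalize hd : z * w - r = d at *
    field_simp
    rw [← hd]
    ring
  rw [e v hv hzv, e u hu hzu]
  ring

namespace RationalCurve

variable {C : RationalCurve} {r : ℂ} {D : Set ℂ}

/-- The multidifferential `W^g_{n+1}` is invariant under `z ↦ r / z` at points of `D`. -/
def FlipInvariant (C : RationalCurve) (r : ℂ) (D : Set ℂ) (g n : ℕ) : Prop :=
  ∀ u ∈ D, ∀ S : Fin n → ℂ, (∀ i, S i ∈ D) →
    C.corr g n (r / u) (fun i => r / S i) * (-(r / u ^ 2) * ∏ i, -(r / S i ^ 2)) = C.corr g n u S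

theorem flipInvariant_zero_one (hr : r ≠ 0) (hD : ∀ z ∈ D, z ≠ 0) :
    C.FlipInvariant r D 0 1 := by
  intro u hu S hS
  have h1 := hD u hu
  have h2 := hD _ (hS 0)
  simp only [corr_zero_one, Finset.univ_unique, Fin.default_eq_zero, Finset.prod_singleton]
  have e : r / u - r / S 0 = -(r * (u - S 0)) / (u * S 0) := by field_simp; ring
  rw [e, div_pow, neg_sq, mul_pow, one_div_div]
  rcases eq_or_ne (u - S 0) 0 with h3 | h3
  · simp [h3]
  · generalize u - S 0 = d at *
    field_simp

/-- Each summand contains u, v and every S i exactly once, so the Jacobians distribute over the two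
factors without overlap. -/
theorem recursionTerm_inversion {g n : ℕ} (hr : r ≠ 0)
    (hD : ∀ z ∈ D, z ≠ 0)
    (hst : ∀ g' n', 2 ≤ 2 * g' + n' → 2 * g' + n' < 2 * g + n → C.FlipInvariant r D g' n')
    {u v : ℂ} (hu : u ∈ D) (hv : v ∈ D) {S : Fin n → ℂ} (hS : ∀ i, S i ∈ D) :
    C.recursionTerm g n (r / u) (r / v) (fun i => r / S i) *
      (-(r / u ^ 2) * -(r / v ^ 2) * ∏ i, -(r / S i ^ 2)) = C.recursionTerm g n u v S := by
  have hst' : ∀ g' n', 1 ≤ 2 * g' + n' → 2 * g' + n' < 2 * g + n →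
      C.FlipInvariant r D g' n' := by
    intro g' n' h1 h2
    by_cases h3 : 2 ≤ 2 * g' + n'
    · exact hst _ _ h3 h2
    · obtain ⟨rfl, rfl⟩ : g' = 0 ∧ n' = 1 := by omega
      exact flipInvariant_zero_one hr hD
  unfold recursionTerm
  rw [add_mul, Finset.sum_mul]
  congr 1
  · split_ifs with hg
    · have h1 := hst' (g - 1) (n + 1) (by omega) (by omega) u hu (Fin.cons v S)
        (Fin.cases (by simpa using hv) (by simpa using hS))
      rw [Fin.prod_univ_succ] at h1
      simp only [Fin.cons_zero, Fin.cons_succ] at h1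
      rw [← h1]
      have e : (fun i => r / (Fin.cons v S : Fin (n + 1) → ℂ) i) =
          Fin.cons (r / v) fun i => r / S i := by
        ext i
        refine Fin.cases ?_ (fun i => ?_) i <;> simp
      rw [e]
      ring
    · simp
  · refine Finset.sum_congr rfl fun m _ => ?_
    rw [Finset.sum_mul]
    refine Finset.sum_congr rfl fun I _ => ?_
    split_ifs with hI
    · have h1 := m.isLt
      have h2 := Finset.card_add_card_compl I
      rw [Fintype.card_fin] at h2
      rw [← Finset.card_eq_zero, ← Finset.card_eq_zero] at hI
      have e1 := hst' m I.card (by omega) (by omega) u hu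
        (fun i => S (I.orderEmbOfFin rfl i)) fun i => hS _
      have e2 := hst' (g - m) Iᶜ.card (by omega) (by omega) v hv
        (fun i => S (Iᶜ.orderEmbOfFin rfl i)) fun i => hS _
      rw [prod_orderEmbOfFin I fun i => -(r / S i ^ 2)] at e1
      rw [prod_orderEmbOfFin Iᶜ fun i => -(r / S i ^ 2)] at e2
      rw [← e1, ← e2, ← Finset.prod_mul_prod_compl I fun i => -(r / S i ^ 2)]
      ring
    · simp

end RationalCurve

theorem kernelFactor_inversion {r : ℂ} {χ l : ℂ → ℂ} {ζ : ℂ} (h : DifferentiableAt ℂ χ ζ)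
    (h' : DifferentiableAt ℂ χ (-ζ)) (h0 : χ ζ ≠ 0) (h0' : χ (-ζ) ≠ 0) :
    kernelFactor (fun ζ => r / χ ζ) l ζ =
      -(r / χ ζ ^ 2) * -(r / χ (-ζ) ^ 2) * kernelFactor χ l ζ := by
  have e : ∀ ξ : ℂ, DifferentiableAt ℂ χ ξ → χ ξ ≠ 0 →
      deriv (fun ζ => r / χ ζ) ξ = -(r / χ ξ ^ 2) * deriv χ ξ := by
    intro ξ h1 h2
    have : HasDerivAt (fun ζ => r / χ ζ) _ ξ :=
      (hasDerivAt_const ξ r).div h1.hasDerivAt h2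
    rw [this.deriv]
    ring
  simp only [kernelFactor, e ζ h h0, e (-ζ) h' h0']
  ring

/-- By `polePart_inversion` the substitution exchanges the two products in each summand of the
stable form. -/
theorem StableForm.eventually_flipInvariant {f : ℤ} {a₀ : ℂ} {y : ℂ × ℂ → ℂ} {g n : ℕ}
    (h : StableForm f a₀ y g n) : ∀ᶠ a in 𝓝 a₀, ramParam f a ≠ 0 →
      (ramCurve f a).FlipInvariant (ramParam f a) (regularSet (ramParam f a) a) g n := by
  obtain ⟨J, _, c, m, k, hc, hW⟩ := h
  filter_upwards [hW] with a ha hr u hu S hS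
  have hS' : ∀ i, ramParam f a / S i ∈ regularSet (ramParam f a) a := fun i =>
    inversion_mem_regularSet hr (hS i)
  rw [(ha S hS).1 u hu, (ha (fun i => ramParam f a / S i) hS').1 _
    (inversion_mem_regularSet hr hu), Finset.sum_mul]
  refine Finset.sum_congr rfl fun j _ => ?_
  have hp : ∀ k : Fin n → Bool × ℕ, (∏ i, polePart (ramParam f a) a (k i) (ramParam f a / S i)) *
      ∏ i, -(ramParam f a / S i ^ 2) = ∏ i, polePart (ramParam f a) a (flipIndex (k i)) (S i) := by
    intro k
    rw [← Finset.prod_mul_distrib]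
    refine Finset.prod_congr rfl fun i _ => ?_
    rw [mul_comm, polePart_inversion hr (hS i).1]
  have h1 := hp (k j)
  have h2 := hp fun i => flipIndex (k j i)
  have h3 := polePart_inversion (a := a) hr hu.1 (false, m j)
  have h4 := polePart_inversion (a := a) hr hu.1 (true, m j)
  simp only [flipIndex_flipIndex] at h2
  simp only [flipIndex, Bool.not_false, Bool.not_true] at h3 h4
  rw [← h1, ← h2, ← h3, ← h4]
  ring

/-! ### The induction step -/

theorem RationalCurve.recursionTerm_inversion_left {C : RationalCurve} {r : ℂ} {D : Set ℂ}
    {g n : ℕ} (hr : r ≠ 0) (hD : ∀ z ∈ D, z ≠ 0) (hD' : ∀ z ∈ D, r / z ∈ D)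
    (hst : ∀ g' n', 2 ≤ 2 * g' + n' → 2 * g' + n' < 2 * g + n → C.FlipInvariant r D g' n')
    {u v : ℂ} (hu : u ∈ D) (hv : v ∈ D) {S : Fin n → ℂ} (hS : ∀ i, S i ∈ D) :
    -(r / u ^ 2) * -(r / v ^ 2) * C.recursionTerm g n (r / u) (r / v) S =
      (∏ i, -(r / S i ^ 2)) * C.recursionTerm g n u v fun i => r / S i := by
  rw [← recursionTerm_inversion hr hD hst hu hv fun i => hD' _ (hS i)]
  have e : (fun i => r / (r / S i)) = S := by
    ext i
    have := hD _ (hS i)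
    field_simp
  have e2 : (∏ i, -(r / S i ^ 2)) * ∏ i, -(r / (r / S i) ^ 2) = 1 := by
    rw [← Finset.prod_mul_distrib]
    exact Finset.prod_eq_one fun i _ => inversion_deriv_mul hr (hD _ (hS i))
  rw [e]
  linear_combination -(-(r / u ^ 2) * -(r / v ^ 2) *
    C.recursionTerm g n (r / u) (r / v) S) * e2

/-- Both residues are written in the same variable ζ. The Jacobians at q and s(q) coming from the
kernel factor are absorbed by the recursion term, and the one at z comes from the Cauchy kernel. -/
theorem recursionResidue_inversion {C : RationalCurve} {r a z : ℂ} {χ l : ℂ → ℂ} {g n : ℕ}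
    (hr : r ≠ 0) (h : IsAdapted C a χ l) (h' : IsAdapted C (r / a) (fun ζ => r / χ ζ) l)
    (hl : AnalyticAt ℂ l 0)
    (hst : ∀ g' n', 2 ≤ 2 * g' + n' → 2 * g' + n' < 2 * g + n →
      C.FlipInvariant r (regularSet r a) g' n')
    (hmem : ∀ᶠ ζ in 𝓝[≠] (0 : ℂ), χ ζ ∈ regularSet r a ∧ χ (-ζ) ∈ regularSet r a)
    (hm : ∀ S : Fin n → ℂ, (∀ i, S i ∈ regularSet r a) →
      MeromorphicAt (fun ζ => C.recursionTerm g n (χ ζ) (χ (-ζ)) S) 0)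
    (hz : z ∈ regularSet r a) {S : Fin n → ℂ} (hS : ∀ i, S i ∈ regularSet r a) :
    C.recursionResidue g n z S (r / a) = -(r / z ^ 2) * (∏ i, -(r / S i ^ 2)) *
      C.recursionResidue g n (r / z) (fun i => r / S i) a := by
  have hS' : ∀ i, r / S i ∈ regularSet r a := fun i => inversion_mem_regularSet hr (hS i)
  have hχ := h.analyticAt
  have hχ' := analyticAt_comp_neg_one hχ
  have hd : ∀ᶠ ζ in 𝓝 (0 : ℂ), DifferentiableAt ℂ χ ζ :=
    hχ.eventually_analyticAt.mono fun ζ h => h.differentiableAt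
  have hmer' : MeromorphicAt (fun ζ => C.recursionTerm g n (r / χ ζ) (r / χ (-ζ)) S) 0 := by
    have hm2 : MeromorphicAt (fun ζ => (∏ i, -(r / S i ^ 2)) * ((χ ζ ^ 2 * χ (-ζ) ^ 2 / r ^ 2) *
        C.recursionTerm g n (χ ζ) (χ (-ζ)) fun i => r / S i)) 0 :=
      (MeromorphicAt.const _ 0).mul ((((hχ.pow 2).mul (hχ'.pow 2)).meromorphicAt.div
        (MeromorphicAt.const _ 0)).mul (hm _ hS'))
    refine hm2.congr ?_
    filter_upwards [hmem] with ζ h1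
    have h2 := RationalCurve.recursionTerm_inversion_left hr (fun z hz => hz.1)
      (fun z => inversion_mem_regularSet hr) hst h1.1 h1.2 hS
    have h3 := h1.1.1
    have h4 := h1.2.1
    rw [mul_left_comm, ← h2]
    field_simp
  have hmerG : MeromorphicAt (fun ζ => kernelFactor χ l ζ *
      C.recursionTerm g n (χ ζ) (χ (-ζ)) fun i => r / S i) 0 := by
    refine MeromorphicAt.mul ?_ (hm _ hS')
    unfold kernelFactor
    exact (analyticAt_const.mul (hχ.deriv.mul
      (analyticAt_comp_neg_one hχ.deriv).neg)).meromorphicAt.div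
      ((analyticAt_const.mul (analyticAt_id.pow 2)).mul
        (hl.add (analyticAt_comp_neg_one hl))).meromorphicAt
  have hK : MeromorphicAt (fun ζ => 1 / (r / z - χ (-ζ)) - 1 / (r / z - χ ζ)) 0 :=
    ((MeromorphicAt.const 1 0).div (analyticAt_const.sub hχ').meromorphicAt).sub
      ((MeromorphicAt.const 1 0).div (analyticAt_const.sub hχ).meromorphicAt)
  have hreg : ∀ᶠ ζ in 𝓝 (0 : ℂ), z * χ ζ ≠ r := by
    have hc : ContinuousAt (fun ζ => z * χ ζ) 0 := continuousAt_const.mul hχ.continuousAt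
    refine hc.eventually_ne ?_
    rw [h.map_zero]
    exact hz.2.2
  have hres := residue_const_mul (-(r / z ^ 2) * ∏ i, -(r / S i ^ 2))
    (F := fun ζ => (1 / (r / z - χ (-ζ)) - 1 / (r / z - χ ζ)) *
      (kernelFactor χ l ζ * C.recursionTerm g n (χ ζ) (χ (-ζ)) fun i => r / S i)) (hK.mul hmerG)
  rw [RationalCurve.recursionResidue_eq h' hl hmer',
    RationalCurve.recursionResidue_eq h hl (hm _ hS'), ← hres]
  refine residue_congr ?_
  filter_upwards [hmem, nhdsWithin_le_nhds hd, nhdsWithin_le_nhds (tendsto_neg_zero.eventually hd),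
    nhdsWithin_le_nhds hreg, nhdsWithin_le_nhds (tendsto_neg_zero.eventually hreg)]
    with ζ h1 h2 h2' h3 h4
  have h5 := RationalCurve.recursionTerm_inversion_left hr (fun z hz => hz.1)
      (fun z => inversion_mem_regularSet hr) hst h1.1 h1.2 hS
  rw [kernelFactor_inversion h2 h2' h1.1.1 h1.2.1, cauchy_inversion hz.1 h1.1.1 h1.2.1 h3 h4]
  linear_combination -(r / z ^ 2) * (1 / (r / z - χ (-ζ)) - 1 / (r / z - χ ζ)) *
    kernelFactor χ l ζ * h5

namespace IsCoordinate

variable {f : ℤ} {a₀ : ℂ} {y l : ℂ × ℂ → ℂ}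

theorem _root_.Admissible.finsum_ram {a : ℂ} (h : Admissible f a) (F : ℂ → ℂ) :
    ∑ᶠ b ∈ (ramCurve f a).ram, F b =
      F a + if ramParam f a = 0 then 0 else F (ramParam f a / a) := by
  have ha := h.ne_zero
  rw [ramCurve, h.ram_eq]
  split_ifs with hr
  · have : {t : ℂ | t ≠ 0 ∧ (t = a ∨ t = ramParam f a / a)} = {a} := by
      ext t
      simp only [hr, zero_div, Set.mem_ofPred_eq, Set.mem_singleton_iff]
      constructor
      · rintro ⟨h1, h2 | h2⟩
        · exact h2
        · exact absurd h2 h1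
      · rintro rfl
        exact ⟨ha, Or.inl rfl⟩
    rw [this, finsum_mem_singleton, add_zero]
  · have : {t : ℂ | t ≠ 0 ∧ (t = a ∨ t = ramParam f a / a)} = {a, ramParam f a / a} := by
      ext t
      simp only [Set.mem_ofPred_eq, Set.mem_insert_iff, Set.mem_singleton_iff,
        and_iff_right_iff_imp]
      rintro (rfl | rfl)
      · exact ha
      · exact div_ne_zero hr ha
    rw [this, finsum_mem_pair]
    rw [Ne, eq_div_iff ha]
    exact h.sq_ne_ramParam

/-- The residue at a gives the pole parts at a, and the residue at r/a is its image under the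
involution, by the invariance of the lower correlation functions. -/
theorem stableForm_of_lt (h : IsCoordinate f a₀ y l) {g n : ℕ} (h2 : 2 ≤ 2 * g + n)
    (hst : ∀ g' n', 2 ≤ 2 * g' + n' → 2 * g' + n' < 2 * g + n → StableForm f a₀ y g' n') :
    StableForm f a₀ y g n := by
  have hrT := h.expansion_recursionTerm hst
  obtain ⟨J, _, c, m, k, hc, hW⟩ := exists_residue_kernel_eq h.analyticAt_y h.y_ne_zero
    (h.laurentFamily_kernelFactor.mul_expansion hrT)
  refine ⟨J, inferInstance, c, m, k, hc, ?_⟩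
  have hflip : ∀ᶠ a in 𝓝 a₀, ramParam f a ≠ 0 → ∀ g' n', 2 ≤ 2 * g' + n' →
      2 * g' + n' < 2 * g + n →
      (ramCurve f a).FlipInvariant (ramParam f a) (regularSet (ramParam f a) a) g' n' := by
    -- Only finitely many pairs (g', n') are relevant, so their neighbourhoods can be intersected.
    have : ∀ᶠ a in 𝓝 a₀, ∀ q ∈ Finset.range (2 * g + n) ×ˢ Finset.range (2 * g + n),
        2 ≤ 2 * q.1 + q.2 → 2 * q.1 + q.2 < 2 * g + n → ramParam f a ≠ 0 →
        (ramCurve f a).FlipInvariant (ramParam f a) (regularSet (ramParam f a) a) q.1 q.2 := by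
      rw [Filter.eventually_all_finset]
      intro q _
      by_cases h3 : 2 ≤ 2 * q.1 + q.2 ∧ 2 * q.1 + q.2 < 2 * g + n
      · exact (hst _ _ h3.1 h3.2).eventually_flipInvariant.mono fun a ha _ _ => ha
      · exact Eventually.of_forall fun a h4 h5 => absurd ⟨h4, h5⟩ h3
    filter_upwards [this] with a ha hr g' n' h3 h4
    exact ha (g', n') (Finset.mem_product.2 ⟨Finset.mem_range.2 (by dsimp only; omega),
      Finset.mem_range.2 (by dsimp only; omega)⟩) h3 h4 hr
  filter_upwards [hW, hflip, hrT.meromorphicAt, h.admissible.eventually, h.eventually_isAdapted,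
    h.eventually_isAdapted_inversion, h.analyticAt_l.eventually_fiber, h.eventually_mem_fiber]
    with a aW aflip amer aadm aad aad' al amem S hS
  refine ⟨fun z hz => ?_, (aW S hS).2⟩
  have hfst : ∀ z ∈ regularSet (ramParam f a) a, ∀ S : Fin n → ℂ,
      (∀ i, S i ∈ regularSet (ramParam f a) a) → (ramCurve f a).recursionResidue g n z S a =
        ∑ j, c j a * (polePart (ramParam f a) a (false, m j) z *
          ∏ i, polePart (ramParam f a) a (k j i) (S i)) := by
    intro z hz S hS
    rw [RationalCurve.recursionResidue_eq (C := ramCurve f a) aad.1 al (amer S hS)]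
    exact (aW S hS).1 z hz.2.1
  rw [RationalCurve.corr_eq_finsum _ _ _ h2, aadm.finsum_ram, hfst z hz S hS]
  simp only [mul_add, Finset.sum_add_distrib]
  congr 1
  split_ifs with hr
  · refine (Finset.sum_eq_zero fun j _ => ?_).symm
    simp only [hr, polePart_true_zero]
    ring
  · have hS' : ∀ i, ramParam f a / S i ∈ regularSet (ramParam f a) a := fun i =>
      inversion_mem_regularSet hr (hS i)
    rw [recursionResidue_inversion (C := ramCurve f a) (l := fun ζ => l (a, ζ)) hr aad.1 (aad' hr) al (aflip hr) amem
      amer hz hS, hfst _ (inversion_mem_regularSet hr hz) _ hS', Finset.mul_sum]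
    refine Finset.sum_congr rfl fun j _ => ?_
    have h3 := polePart_inversion (a := a) hr hz.1 (false, m j)
    simp only [flipIndex, Bool.not_false] at h3
    have h4 : (∏ i, -(ramParam f a / S i ^ 2)) *
        ∏ i, polePart (ramParam f a) a (k j i) (ramParam f a / S i) =
        ∏ i, polePart (ramParam f a) a (flipIndex (k j i)) (S i) := by
      rw [← Finset.prod_mul_distrib]
      exact Finset.prod_congr rfl fun i _ => polePart_inversion hr (hS i).1 _
    rw [← h3, ← h4]
    ring

theorem stableForm (h : IsCoordinate f a₀ y l) {g n : ℕ} (h2 : 2 ≤ 2 * g + n) :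
    StableForm f a₀ y g n := by
  induction hN : 2 * g + n using Nat.strong_induction_on generalizing g n with
  | _ N ih =>
    subst hN
    exact h.stableForm_of_lt h2 fun g' n' h3 h4 => ih _ h4 h3 rfl

end IsCoordinate

/-! ### Free energies -/

theorem MeromorphicAt.const_mul {F : ℂ → ℂ} {a : ℂ} (hF : MeromorphicAt F a) (c : ℂ) :
    MeromorphicAt (fun q => c * F q) a :=
  (MeromorphicAt.const c a).mul hF

/-- The right side involves only H', so the additive constant in a primitive is irrelevant. -/
theorem residue_mul_inv_pow_by_parts {χ H : ℂ → ℂ} (hχ : AnalyticAt ℂ χ 0)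
    (hd : deriv χ 0 ≠ 0) (hH : AnalyticAt ℂ H 0) (m : ℕ) :
    residue (fun ζ => H ζ * ((χ ζ - χ 0) ^ (m + 2))⁻¹ * deriv χ ζ) 0 =
      (m + 1 : ℂ)⁻¹ * residue (fun ζ => ((χ ζ - χ 0) ^ (m + 1))⁻¹ * deriv H ζ) 0 := by
  have hm : (m + 1 : ℂ) ≠ 0 := by exact_mod_cast m.succ_ne_zero
  have hτ : AnalyticAt ℂ (fun ζ => χ ζ - χ 0) 0 := hχ.sub analyticAt_const
  have hQ : MeromorphicAt (fun ζ => ((χ ζ - χ 0) ^ (m + 1))⁻¹ * H ζ) 0 :=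
    (hτ.pow _).meromorphicAt.inv.mul hH.meromorphicAt
  have hR : MeromorphicAt (fun ζ => ((χ ζ - χ 0) ^ (m + 1))⁻¹ * deriv H ζ) 0 :=
    (hτ.pow _).meromorphicAt.inv.mul hH.deriv.meromorphicAt
  have hne : ∀ᶠ ζ in 𝓝[≠] (0 : ℂ), χ ζ ≠ χ 0 :=
    (tendsto_punctured_of_deriv_ne_zero hχ hd).eventually self_mem_nhdsWithin
  have h2 := residue_add (hR.const_mul (m + 1 : ℂ)⁻¹) (hQ.deriv.const_mul (-(m + 1 : ℂ)⁻¹))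
  rw [residue_const_mul _ hR, residue_const_mul _ hQ.deriv, residue_deriv hQ, mul_zero,
    add_zero] at h2
  rw [← h2]
  refine residue_congr ?_
  filter_upwards [hne, nhdsWithin_le_nhds hχ.eventually_analyticAt,
    nhdsWithin_le_nhds hH.eventually_analyticAt] with ζ g1 g2 g3
  have hs : χ ζ - χ 0 ≠ 0 := sub_ne_zero.2 g1
  have g4 : HasDerivAt (fun ζ => ((χ ζ - χ 0) ^ (m + 1))⁻¹ * H ζ) _ ζ :=
    (((g2.differentiableAt.hasDerivAt.sub_const (χ 0)).pow (m + 1)).inv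
      (pow_ne_zero _ hs)).mul g3.differentiableAt.hasDerivAt
  rw [g4.deriv]
  simp only [Pi.pow_apply, Pi.inv_apply, Nat.cast_add, Nat.cast_one, Nat.add_sub_cancel]
  field_simp
  ring

theorem eventually_eq_const_of_hasDerivAt_zero {F : ℂ → ℂ} {x : ℂ}
    (h : ∀ᶠ t in 𝓝 x, HasDerivAt F 0 t) : ∀ᶠ t in 𝓝 x, F t = F x := by
  obtain ⟨ε, hε, hb⟩ := Metric.eventually_nhds_iff_ball.1 h
  filter_upwards [Metric.ball_mem_nhds x hε] with t ht
  exact Metric.isOpen_ball.is_const_of_deriv_eq_zero (convex_ball x ε).isPreconnected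
    (fun t ht => (hb t ht).differentiableAt.differentiableWithinAt)
    (fun t ht => (hb t ht).deriv) ht (Metric.mem_ball_self hε)

theorem conifold_logDeriv_inversion (f : ℤ) {r t : ℂ} (hr : r ≠ 0) (h0 : t ≠ 0) (h1 : 1 + t ≠ 0)
    (h2 : r + t ≠ 0) : logDeriv (conifoldCurve f r).X (r / t) * -(r / t ^ 2) =
      -logDeriv (conifoldCurve f r).X t := by
  have e1 : 1 + r / t = (r + t) / t := by field_simp; ring
  have e2 : r + r / t = r * (1 + t) / t := by field_simp; ring
  rw [conifold_logDeriv f h0 h1 h2, conifold_logDeriv f (div_ne_zero hr h0)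
    (by rw [e1]; exact div_ne_zero h2 h0)
    (by rw [e2]; exact div_ne_zero (mul_ne_zero hr h1) h0), e1, e2]
  field_simp
  ring

theorem eventually_mem_regularSet_punctured {r a : ℂ} (ha : a ≠ 0) (h : a * a ≠ r) :
    ∀ᶠ z in 𝓝[≠] a, z ∈ regularSet r a := by
  have hc : ContinuousAt (fun z => z * a) a := by fun_prop
  filter_upwards [self_mem_nhdsWithin, nhdsWithin_le_nhds (isOpen_ne.mem_nhds ha),
    nhdsWithin_le_nhds (hc.eventually_ne h)] with z h1 h2 h3
  exact ⟨h2, h1, h3⟩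

theorem analyticAt_polePart_true {r a : ℂ} (ha : a ≠ 0) (h : a * a ≠ r) (m : ℕ) :
    AnalyticAt ℂ (polePart r a (true, m)) a := by
  have h1 : r / a - a ≠ 0 := by
    rw [sub_ne_zero, Ne, div_eq_iff ha]
    exact fun h' => h h'.symm
  have h2 : AnalyticAt ℂ (fun z : ℂ => r / z - a) a :=
    (analyticAt_const.div analyticAt_id ha).sub analyticAt_const
  have h3 : AnalyticAt ℂ (fun z : ℂ => -(r / z ^ 2)) a :=
    (analyticAt_const.div (analyticAt_id.pow 2) (pow_ne_zero 2 ha)).neg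
  exact h3.mul ((h2.pow (m + 2)).inv (pow_ne_zero _ h1))

/-- `Ψ` is a primitive of `L dX / X` near `b` for a branch `L` of `log t`. -/
structure IsPrimitiveAt (C : RationalCurve) (b : ℂ) (L Ψ : ℂ → ℂ) : Prop where
  hasDerivAt_log : ∀ᶠ t in 𝓝 b, HasDerivAt L t⁻¹ t
  hasDerivAt : ∀ᶠ t in 𝓝 b, HasDerivAt Ψ (L t * logDeriv C.X t) t

theorem IsPrimitiveAt.analyticAt {C : RationalCurve} {b : ℂ} {L Ψ : ℂ → ℂ}
    (h : IsPrimitiveAt C b L Ψ) : AnalyticAt ℂ Ψ b :=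
  Complex.analyticAt_iff_eventually_differentiableAt.2
    (h.hasDerivAt.mono fun _ ht => ht.differentiableAt)

theorem RationalCurve.IsPrimitive.exists_isPrimitiveAt {f : ℤ} {r b : ℂ} {Φ : ℂ → ℂ → ℂ}
    (h : (conifoldCurve f r).IsPrimitive Φ) (hb : b ∈ (conifoldCurve f r).ram) :
    ∃ L, IsPrimitiveAt (conifoldCurve f r) b L (Φ b) := by
  obtain ⟨L, hL, he, hd⟩ := h b hb
  refine ⟨L, ?_, hd⟩
  filter_upwards [hL.eventually_analyticAt, he.eventually_nhds] with t h1 h2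
  have h3 := h1.differentiableAt.hasDerivAt
  have h4 : HasDerivAt (fun t => t) (Complex.exp (L t) * deriv L t) t :=
    h3.cexp.congr_of_eventuallyEq (h2.mono fun u hu => hu.symm)
  have h5 := h4.unique (hasDerivAt_id' t)
  have h6 : Complex.exp (L t) = t := h2.self_of_nhds
  rw [h6] at h5
  rwa [eq_inv_of_mul_eq_one_right h5] at h3

/-- The function -L(r/t) equals log t only up to a constant such as -log r. This is why
`IsPrimitiveAt` asks for L' = 1/t and not for exp L = t. -/
theorem IsPrimitiveAt.inversion {f : ℤ} {r a : ℂ} {L Ψ : ℂ → ℂ} (hr : r ≠ 0) (h0 : a ≠ 0)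
    (h1 : 1 + a ≠ 0) (h2 : r + a ≠ 0) (h : IsPrimitiveAt (conifoldCurve f r) (r / a) L Ψ) :
    IsPrimitiveAt (conifoldCurve f r) a (fun t => -L (r / t)) fun t => Ψ (r / t) := by
  have hσ : Tendsto (fun t => r / t) (𝓝 a) (𝓝 (r / a)) :=
    (continuousAt_const.div continuousAt_id h0 : ContinuousAt (fun t => r / t) a)
  have hd : ∀ t : ℂ, t ≠ 0 → HasDerivAt (fun t => r / t) (-(r / t ^ 2)) t := fun t ht =>
    ((hasDerivAt_const t r).div (hasDerivAt_id' t) ht).congr_deriv (by ring)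
  have hne : ∀ᶠ t in 𝓝 a, t ≠ 0 := isOpen_ne.mem_nhds h0
  constructor
  · filter_upwards [hσ.eventually h.hasDerivAt_log, hne] with t h3 h4
    refine (h3.comp t (hd t h4)).neg.congr_deriv ?_
    field_simp
  · filter_upwards [hσ.eventually h.hasDerivAt, hne,
      (by fun_prop : ContinuousAt (fun b : ℂ => 1 + b) a).eventually_ne h1,
      (by fun_prop : ContinuousAt (fun b : ℂ => r + b) a).eventually_ne h2] with t h3 h4 h5 h6
    refine (h3.comp t (hd t h4)).congr_deriv ?_
    linear_combination L (r / t) * conifold_logDeriv_inversion f hr h4 h5 h6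

theorem StableForm.eventually_corr_eq {f : ℤ} {a₀ : ℂ} {y : ℂ × ℂ → ℂ} {g : ℕ}
    (h : StableForm f a₀ y g 0) (ha₀ : Admissible f a₀) :
    ∃ (J : Type) (_ : Fintype J) (c : J → ℂ → ℂ) (m : J → ℕ), (∀ j, AnalyticAt ℂ (c j) a₀) ∧
      ∀ᶠ a in 𝓝 a₀, (∀ᶠ z in 𝓝[≠] a, (ramCurve f a).corr g 0 z Fin.elim0 =
        ∑ j, c j a * ((z - a) ^ (m j + 2))⁻¹ +
          ∑ j, c j a * polePart (ramParam f a) a (true, m j) z) ∧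
        ∑ j, c j a * sqMoment y a (m j) = 0 := by
  obtain ⟨J, _, c, m, k, hc, hW⟩ := h
  refine ⟨J, inferInstance, c, m, hc, ?_⟩
  filter_upwards [hW, ha₀.eventually] with a ha aadm
  obtain ⟨h1, h2⟩ := ha Fin.elim0 fun i => i.elim0
  constructor
  · filter_upwards [eventually_mem_regularSet_punctured aadm.ne_zero aadm.sq_ne_ramParam] with z hz
    rw [h1 z hz, ← Finset.sum_add_distrib]
    refine Finset.sum_congr rfl fun j _ => ?_
    simp [polePart, mul_add]
  · simpa using h2

namespace IsCoordinate

variable {f : ℤ} {a₀ : ℂ} {y l : ℂ × ℂ → ℂ}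

/-- After integrating by parts, Ψ enters only through its derivative L · 2ζ with L = ζ l + κ. The
κ-part is annihilated by the moment relation of the stable form, and the rest is independent of Ψ
and analytic in a. -/
theorem exists_residue_primitive (h : IsCoordinate f a₀ y l) {g : ℕ} (hg : 1 ≤ g) :
    ∃ E : ℂ → ℂ, AnalyticAt ℂ E a₀ ∧ ∀ᶠ a in 𝓝 a₀,
      MeromorphicAt (fun q => (ramCurve f a).corr g 0 q Fin.elim0) a ∧
      ∀ L Ψ, IsPrimitiveAt (ramCurve f a) a L Ψ →
        residue (fun q => Ψ q * (ramCurve f a).corr g 0 q Fin.elim0) a = E a := by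
  obtain ⟨J, _, c, m, hc, hW⟩ :=
    (h.stableForm (g := g) (n := 0) (by omega)).eventually_corr_eq h.admissible
  have hy := h.analyticAt_y
  refine ⟨fun a => ∑ j, c j a * ((m j + 1 : ℂ)⁻¹ * residue (fun ζ => (ζ ^ (m j + 1))⁻¹ *
    ((y (a, ζ) ^ (m j + 1))⁻¹ * (2 * ζ ^ 2 * l (a, ζ)))) 0), ?_, ?_⟩
  · refine Finset.analyticAt_fun_sum _ fun j _ => (hc j).mul (analyticAt_const.mul ?_)
    exact AnalyticAt.residue_family (m j + 1)
      (fun p => (y p ^ (m j + 1))⁻¹ * (2 * p.2 ^ 2 * l p))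
      (((hy.pow _).inv (pow_ne_zero _ h.y_ne_zero)).mul
        ((analyticAt_const.mul (analyticAt_snd.pow 2)).mul h.analyticAt_l))
  filter_upwards [hW, h.admissible.eventually, h.eventually_isAdapted, hy.eventually_fiber,
    h.analyticAt_l.eventually_fiber, eventually_fiber h.log_eq] with a aW aadm aad ay al alog
  have ha := aadm.ne_zero
  have hpa : ∀ j, AnalyticAt ℂ (polePart (ramParam f a) a (true, m j)) a := fun j =>
    analyticAt_polePart_true ha aadm.sq_ne_ramParam (m j)
  have hsub : AnalyticAt ℂ (fun z : ℂ => z - a) a := analyticAt_id.sub analyticAt_const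
  have hmer : MeromorphicAt (fun q => (ramCurve f a).corr g 0 q Fin.elim0) a := by
    have h1 : MeromorphicAt (fun z => ∑ j, c j a * ((z - a) ^ (m j + 2))⁻¹ +
        ∑ j, c j a * polePart (ramParam f a) a (true, m j) z) a := by
      refine MeromorphicAt.add (MeromorphicAt.fun_sum fun j _ => ?_)
        (MeromorphicAt.fun_sum fun j _ => ?_)
      · exact (MeromorphicAt.const _ _).mul (hsub.pow _).meromorphicAt.inv
      · exact (MeromorphicAt.const _ _).mul (hpa j).meromorphicAt
    exact h1.congr (aW.1.mono fun z hz => hz.symm)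
  refine ⟨hmer, fun L Ψ hΨ => ?_⟩
  have hφ := aad.1.analyticAt
  have hφd := aad.1.deriv_ne_zero
  have hφ0 : coord y a 0 = a := coord_zero a
  have hH : AnalyticAt ℂ (fun ζ => Ψ (coord y a ζ)) 0 :=
    AnalyticAt.comp (g := Ψ) (by rw [hφ0]; exact hΨ.analyticAt) hφ
  have hφt : Tendsto (coord y a) (𝓝 0) (𝓝 a) := by
    simpa [ContinuousAt, hφ0] using hφ.continuousAt
  -- κ is the difference between L and the logarithm normalized to vanish at a.
  obtain ⟨κ, hκ⟩ : ∃ κ, ∀ᶠ ζ in 𝓝 (0 : ℂ), L (coord y a ζ) = ζ * l (a, ζ) + κ := by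
    have hslit : ∀ᶠ t in 𝓝 a, t / a ∈ Complex.slitPlane := by
      refine ContinuousAt.eventually_mem (by fun_prop) (Complex.isOpen_slitPlane.mem_nhds ?_)
      rw [div_self ha]
      simp
    have h1 : ∀ᶠ t in 𝓝 a, HasDerivAt (fun t => L t - Complex.log (t / a)) 0 t := by
      filter_upwards [hΨ.hasDerivAt_log, hslit, isOpen_ne.mem_nhds ha] with t h1 h2 h3
      refine (h1.sub (((hasDerivAt_id' t).div_const a).clog h2)).congr_deriv ?_
      have : t ≠ 0 := h3
      field_simp
      ring
    refine ⟨L a - Complex.log (a / a), ?_⟩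
    filter_upwards [hφt.eventually (eventually_eq_const_of_hasDerivAt_zero h1), alog] with ζ h2 h3
    rw [← h2, h3]
    ring
  have hH' : ∀ᶠ ζ in 𝓝 (0 : ℂ), deriv (fun ζ => Ψ (coord y a ζ)) ζ =
      2 * ζ ^ 2 * l (a, ζ) + κ * (2 * ζ) := by
    filter_upwards [hκ, aad.2, hφt.eventually hΨ.hasDerivAt, hφ.eventually_analyticAt]
      with ζ h1 h2 h3 h4
    have h5 : HasDerivAt (fun ζ => Ψ (coord y a ζ)) _ ζ :=
      h3.comp ζ h4.differentiableAt.hasDerivAt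
    rw [h5.deriv, mul_assoc, ramCurve, h2, h1]
    ring
  have hτ : AnalyticAt ℂ (fun ζ => coord y a ζ - a) 0 := hφ.sub analyticAt_const
  have hparts : ∀ j, residue (fun ζ => Ψ (coord y a ζ) * ((coord y a ζ - a) ^ (m j + 2))⁻¹ *
      deriv (coord y a) ζ) 0 = (m j + 1 : ℂ)⁻¹ * residue (fun ζ => (ζ ^ (m j + 1))⁻¹ *
        ((y (a, ζ) ^ (m j + 1))⁻¹ * (2 * ζ ^ 2 * l (a, ζ)))) 0 + κ * sqMoment y a (m j) := by
    intro j
    have h1 := residue_mul_inv_pow_by_parts hφ hφd hH (m j)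
    have hsq : AnalyticAt ℂ (fun ζ : ℂ => ζ ^ 2) 0 := analyticAt_id.pow 2
    have h2 := residue_mul_inv_pow_by_parts (H := fun ζ => ζ ^ 2) hφ hφd hsq (m j)
    rw [hφ0] at h1 h2
    have hi : MeromorphicAt (fun ζ => ((coord y a ζ - a) ^ (m j + 1))⁻¹) 0 :=
      (hτ.pow _).meromorphicAt.inv
    have g1 : MeromorphicAt (fun ζ => ((coord y a ζ - a) ^ (m j + 1))⁻¹ *
        (2 * ζ ^ 2 * l (a, ζ))) 0 :=
      hi.mul ((analyticAt_const.mul (analyticAt_id.pow 2)).mul al).meromorphicAt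
    have g2 : MeromorphicAt (fun ζ => ((coord y a ζ - a) ^ (m j + 1))⁻¹ *
        deriv (fun ζ : ℂ => ζ ^ 2) ζ) 0 :=
      hi.mul hsq.deriv.meromorphicAt
    have e1 : residue (fun ζ => ((coord y a ζ - a) ^ (m j + 1))⁻¹ *
        deriv (fun ζ => Ψ (coord y a ζ)) ζ) 0 = residue (fun ζ =>
          ((coord y a ζ - a) ^ (m j + 1))⁻¹ * (2 * ζ ^ 2 * l (a, ζ)) +
          κ * (((coord y a ζ - a) ^ (m j + 1))⁻¹ * deriv (fun ζ : ℂ => ζ ^ 2) ζ)) 0 := by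
      refine residue_congr (nhdsWithin_le_nhds ?_)
      filter_upwards [hH'] with ζ hζ
      have : deriv (fun ζ : ℂ => ζ ^ 2) ζ = 2 * ζ := by simp
      rw [hζ, this]
      ring
    have e2 : (fun ζ => ((coord y a ζ - a) ^ (m j + 1))⁻¹ * (2 * ζ ^ 2 * l (a, ζ))) =
        fun ζ => (ζ ^ (m j + 1))⁻¹ * ((y (a, ζ) ^ (m j + 1))⁻¹ * (2 * ζ ^ 2 * l (a, ζ))) := by
      ext ζ
      rw [coord_sub, mul_pow, mul_inv, mul_assoc]
    rw [residue_add g1 (g2.const_mul κ), residue_const_mul κ g2, e2] at e1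
    rw [h1, e1, sqMoment, h2]
    ring
  have hint : residue (fun q => Ψ q * (ramCurve f a).corr g 0 q Fin.elim0) a =
      ∑ j, c j a * residue (fun ζ => Ψ (coord y a ζ) * ((coord y a ζ - a) ^ (m j + 2))⁻¹ *
        deriv (coord y a) ζ) 0 := by
    have hmj : ∀ j, MeromorphicAt (fun ζ => Ψ (coord y a ζ) *
        ((coord y a ζ - a) ^ (m j + 2))⁻¹ * deriv (coord y a) ζ) 0 := fun j =>
      (hH.meromorphicAt.mul (hτ.pow _).meromorphicAt.inv).mul hφ.deriv.meromorphicAt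
    -- The image pole parts are regular at a and contribute no residue.
    have hreg : AnalyticAt ℂ (fun ζ => ∑ j, c j a * (Ψ (coord y a ζ) *
        polePart (ramParam f a) a (true, m j) (coord y a ζ) * deriv (coord y a) ζ)) 0 := by
      refine Finset.analyticAt_fun_sum _ fun j _ => analyticAt_const.mul ((hH.mul ?_).mul hφ.deriv)
      exact AnalyticAt.comp (g := polePart (ramParam f a) a (true, m j))
        (by rw [hφ0]; exact hpa j) hφ
    have hpt := tendsto_punctured_of_deriv_ne_zero hφ hφd
    rw [hφ0] at hpt
    have hmφ : MeromorphicAt (fun ζ => Ψ (coord y a ζ) *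
        (ramCurve f a).corr g 0 (coord y a ζ) Fin.elim0) 0 :=
      hH.meromorphicAt.mul (MeromorphicAt.comp_analyticAt
        (f := fun q => (ramCurve f a).corr g 0 q Fin.elim0) (by rw [hφ0]; exact hmer) hφ)
    have e := residue_comp (F := fun q => Ψ q * (ramCurve f a).corr g 0 q Fin.elim0) hφ hφd hmφ
    rw [hφ0] at e
    have e1 : residue (fun ζ => ∑ j, c j a * (Ψ (coord y a ζ) *
        ((coord y a ζ - a) ^ (m j + 2))⁻¹ * deriv (coord y a) ζ)) 0 =
        ∑ j, c j a * residue (fun ζ => Ψ (coord y a ζ) * ((coord y a ζ - a) ^ (m j + 2))⁻¹ *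
          deriv (coord y a) ζ) 0 := by
      rw [residue_sum _ fun j _ => (hmj j).const_mul (c j a)]
      exact Finset.sum_congr rfl fun j _ => residue_const_mul _ (hmj j)
    have e2 := residue_add (MeromorphicAt.fun_sum fun j (_ : j ∈ Finset.univ) =>
      (hmj j).const_mul (c j a)) hreg.meromorphicAt
    rw [residue_analyticAt hreg, add_zero, e1] at e2
    rw [e, ← e2]
    refine residue_congr ?_
    filter_upwards [hpt.eventually aW.1] with ζ hζ
    rw [hζ, mul_add, add_mul]
    simp only [Finset.mul_sum, Finset.sum_mul]
    congr 1 <;> exact Finset.sum_congr rfl fun j _ => by ring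
  rw [hint]
  simp only [hparts, mul_add, Finset.sum_add_distrib]
  have h0 : ∑ j, c j a * (κ * sqMoment y a (m j)) = 0 := by
    rw [← mul_zero κ, ← aW.2, Finset.mul_sum]
    exact Finset.sum_congr rfl fun j _ => by ring
  rw [h0, add_zero]

end IsCoordinate

theorem Admissible.mem_ram {f : ℤ} {a : ℂ} (h : Admissible f a) : a ∈ (ramCurve f a).ram := by
  rw [ramCurve, h.ram_eq]
  exact ⟨h.ne_zero, Or.inl rfl⟩

theorem Admissible.div_mem_ram {f : ℤ} {a : ℂ} (h : Admissible f a) (hr : ramParam f a ≠ 0) :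
    ramParam f a / a ∈ (ramCurve f a).ram := by
  rw [ramCurve, h.ram_eq]
  exact ⟨div_ne_zero hr h.ne_zero, Or.inr rfl⟩

/-- At r/a, pull back by the involution: W^g_1 is invariant, and the primitive becomes a primitive
at a for another constant in log Y, to which E is insensitive. -/
theorem IsCoordinate.exists_contribution_eq {f : ℤ} {a₀ : ℂ} {y l : ℂ × ℂ → ℂ}
    (h : IsCoordinate f a₀ y l) {g : ℕ} (hg : 1 ≤ g) :
    ∃ E : ℂ → ℂ, AnalyticAt ℂ E a₀ ∧ ∀ᶠ a in 𝓝 a₀, ∀ Φ, (ramCurve f a).IsPrimitive Φ →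
      (ramCurve f a).contribution Φ g a = E a ∧
      (ramParam f a ≠ 0 → (ramCurve f a).contribution Φ g (ramParam f a / a) = E a) := by
  obtain ⟨E, hE, hW⟩ := h.exists_residue_primitive hg
  refine ⟨fun a => (-1) ^ g / (2 - 2 * g) * E a, analyticAt_const.mul hE, ?_⟩
  filter_upwards [hW, h.admissible.eventually,
    (h.stableForm (g := g) (n := 0) (by omega)).eventually_flipInvariant]
    with a ⟨amer, aW⟩ aadm aflip Φ hΦ
  constructor
  · obtain ⟨L, hL⟩ := RationalCurve.IsPrimitive.exists_isPrimitiveAt hΦ aadm.mem_ram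
    rw [RationalCurve.contribution, aW L _ hL]
  · intro hr
    have ha := aadm.ne_zero
    obtain ⟨L, hL⟩ := RationalCurve.IsPrimitive.exists_isPrimitiveAt hΦ (aadm.div_mem_ram hr)
    have hL' := hL.inversion hr ha aadm.one_add_ne_zero aadm.ramParam_add_ne_zero
    have hσd : HasDerivAt (fun t => ramParam f a / t) (-(ramParam f a / a ^ 2)) a :=
      ((hasDerivAt_const a _).div (hasDerivAt_id' a) ha).congr_deriv (by ring)
    have hσ : AnalyticAt ℂ (fun t => ramParam f a / t) a := analyticAt_const.div analyticAt_id ha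
    have key : ∀ᶠ t in 𝓝[≠] a, (ramCurve f a).corr g 0 (ramParam f a / t) Fin.elim0 *
        -(ramParam f a / t ^ 2) = (ramCurve f a).corr g 0 t Fin.elim0 := by
      filter_upwards [eventually_mem_regularSet_punctured ha aadm.sq_ne_ramParam] with t ht
      have h1 := aflip hr t ht Fin.elim0 fun i => i.elim0
      rwa [Fin.prod_univ_zero, mul_one, Subsingleton.elim (fun i : Fin 0 => _) Fin.elim0] at h1
    have hne : ∀ᶠ t in 𝓝[≠] a, t ≠ 0 := nhdsWithin_le_nhds (isOpen_ne.mem_nhds ha)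
    have hmer : MeromorphicAt (fun t => Φ (ramParam f a / a) (ramParam f a / t) *
        (ramCurve f a).corr g 0 (ramParam f a / t) Fin.elim0) a := by
      have h1 : MeromorphicAt (fun t => Φ (ramParam f a / a) (ramParam f a / t) *
          ((-(t ^ 2 / ramParam f a)) * (ramCurve f a).corr g 0 t Fin.elim0)) a :=
        hL'.analyticAt.meromorphicAt.mul
          (((analyticAt_id.pow 2).div analyticAt_const hr).neg.meromorphicAt.mul amer)
      refine h1.congr ?_
      filter_upwards [key, hne] with t h2 h3
      rw [← h2]
      field_simp
    have hres := residue_comp (F := fun q => Φ (ramParam f a / a) q *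
      (ramCurve f a).corr g 0 q Fin.elim0) hσ
      (by rw [hσd.deriv]; exact neg_ne_zero.2 (div_ne_zero hr (pow_ne_zero 2 ha))) hmer
    rw [RationalCurve.contribution, hres, ← aW _ _ hL']
    congr 1
    refine residue_congr ?_
    filter_upwards [key, hne] with t h2 h3
    have h4 : HasDerivAt (fun t => ramParam f a / t) (-(ramParam f a / t ^ 2)) t :=
      ((hasDerivAt_const t _).div (hasDerivAt_id' t) h3).congr_deriv (by ring)
    rw [h4.deriv, ← h2, mul_assoc]

/-! ### The ℂ³ curve as the member r = 0, and the passage between r and a. -/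

theorem c3Curve_eq {f : ℤ} (hf : f ≠ 0) : c3Curve f = conifoldCurve f 0 := by
  unfold c3Curve conifoldCurve
  congr 1
  · ext t
    simp only [zero_add, Set.mem_ofPred_eq]
    tauto
  · ext t
    rcases eq_or_ne t 0 with rfl | ht
    -- At t = 0 the conifold formula divides by zero and gives 0, which matches 0^f only because f ≠
    -- 0.
    · simp [zero_zpow f hf]
    · rw [zpow_add_one₀ ht, zero_add, mul_right_comm, mul_div_cancel_right₀ _ ht]

/-- Take for a any root of the ramification quadratic; the hypotheses on r exclude the degenerate
values of a. -/
theorem exists_admissible {f : ℤ} (hf : f ≠ -1) {r : ℂ} (hr : r ≠ 0) (h1 : r ≠ 1)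
    (h2 : (f + 2 : ℂ) ^ 2 * r ≠ f ^ 2) : ∃ a, Admissible f a ∧ ramParam f a = r := by
  have hf' : (f + 1 : ℂ) ≠ 0 := by
    intro h
    exact hf (by exact_mod_cast eq_neg_of_add_eq_zero_left h)
  obtain ⟨a, ha⟩ := exists_quadratic_eq_zero hf'
    (IsAlgClosed.exists_eq_mul_self (discrim (f + 1 : ℂ) ((f + 2) * r + f) ((f + 1) * r)))
  -- If the denominator vanished, r would drop out of the quadratic, leaving a = 0 or a = -1,
  -- neither of which is a zero of the denominator.
  have hd : (f + 2) * a + (f + 1) ≠ 0 := by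
    intro h
    have h3 : a * ((f + 1) * a + f) = 0 := by linear_combination ha - r * h
    rcases mul_eq_zero.1 h3 with rfl | h4
    · exact hf' (by linear_combination h)
    · have h5 : a = -1 := by linear_combination h - h4
      rw [h5] at h
      have : (-1 : ℂ) = 0 := by linear_combination h
      norm_num at this
  refine ⟨a, ⟨hf', ?_, ?_, hd, ?_⟩, ?_⟩
  · rintro rfl
    exact mul_ne_zero hf' hr (by linear_combination ha)
  · intro h
    have h5 : a = -1 := by linear_combination h
    rw [h5] at ha
    exact h1 (by linear_combination -ha)
  · intro h
    exact h2 (by linear_combination (f + 2) ^ 2 * ha - ((f + 1) * ((f + 2) * a + f) +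
      (f + 2) * (f + 2) * r - f * f) * h)
  · rw [ramParam, div_eq_iff hd]
    linear_combination -ha

theorem admissible_base {f : ℤ} (hf0 : f ≠ 0) (hf1 : f ≠ -1) :
    Admissible f (-f / (f + 1)) := by
  have h0 : (f : ℂ) ≠ 0 := by exact_mod_cast hf0
  have hf' : (f + 1 : ℂ) ≠ 0 := by
    intro h
    exact hf1 (by exact_mod_cast eq_neg_of_add_eq_zero_left h)
  have e1 : 1 + -f / (f + 1) = 1 / (f + 1 : ℂ) := by field_simp; ring
  have e2 : (f + 2) * (-f / (f + 1)) + (f + 1) = 1 / (f + 1 : ℂ) := by field_simp; ring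
  have e3 : (f + 2) * (-f / (f + 1)) + f = -f / (f + 1 : ℂ) := by field_simp; ring
  have h3 := one_div_ne_zero hf'
  have h4 := div_ne_zero (neg_ne_zero.2 h0) hf'
  exact ⟨hf', h4, by rwa [e1], by rwa [e2], by rwa [e3]⟩

theorem ramParam_base {f : ℤ} (hf1 : f ≠ -1) : ramParam f (-f / (f + 1)) = 0 := by
  have hf' : (f + 1 : ℂ) ≠ 0 := by
    intro h
    exact hf1 (by exact_mod_cast eq_neg_of_add_eq_zero_left h)
  rw [ramParam, mul_div_cancel₀ _ hf']
  simp

/-- The derivative at the base point is nonzero, so `ramParam` is a local homeomorphism there, and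
statements near r = 0 can be checked near a₀. -/
theorem map_ramParam_base {f : ℤ} (hf0 : f ≠ 0) (hf1 : f ≠ -1) :
    map (ramParam f) (𝓝 (-f / (f + 1))) = 𝓝 0 := by
  have h := admissible_base hf0 hf1
  have hd := h.den_ne_zero
  have hf' := h.framing
  have h1 := h.analyticAt_ramParam.hasStrictDerivAt
  rw [← ramParam_base hf1]
  refine h1.map_nhds_eq ?_
  have hder : HasDerivAt (ramParam f) _ (-f / (f + 1)) :=
    ((hasDerivAt_id' _).mul (((hasDerivAt_id' _).const_mul (f + 1 : ℂ)).add_const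
      (f : ℂ))).neg.div (((hasDerivAt_id' _).const_mul (f + 2 : ℂ)).add_const (f + 1 : ℂ)) hd
  rw [hder.deriv]
  have e : (f + 1 : ℂ) * (-f / (f + 1)) + f = 0 := by field_simp; ring
  have e2 := mul_ne_zero (mul_ne_zero h.ne_zero hf') hd
  refine div_ne_zero (fun h5 => e2 ?_) (pow_ne_zero 2 hd)
  simp only [Pi.neg_apply, Pi.mul_apply, e] at h5
  linear_combination -h5

theorem Admissible.disc_ramParam {f : ℤ} {a : ℂ} (h : Admissible f a) :
    (f + 2 : ℂ) ^ 2 * ramParam f a ≠ f ^ 2 := by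
  have h1 := h.den_ne_zero
  have e : f ^ 2 - (f + 2) ^ 2 * ramParam f a =
      (f + 1) * ((f + 2) * a + f) ^ 2 / ((f + 2) * a + (f + 1)) := by
    unfold ramParam
    generalize hd : (f + 2) * a + (f + 1) = d at *
    field_simp
    rw [← hd]
    ring
  intro h2
  rw [h2, sub_self] at e
  exact div_ne_zero (mul_ne_zero h.framing (pow_ne_zero 2 h.disc_ne_zero)) h1 e.symm

theorem lemma3 (f : ℤ) (hf0 : f ≠ 0) (hf1 : f ≠ -1) (g : ℕ) (hg : 2 ≤ g)
    (Φ₃ : ℂ → ℂ → ℂ) (hΦ₃ : (c3Curve f).IsPrimitive Φ₃)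
    (Φ : ℂ → ℂ → ℂ → ℂ)
    (hΦ : ∀ r : ℂ, r ≠ 0 → r ≠ 1 → (f + 2 : ℂ) ^ 2 * r ≠ f ^ 2 →
      (conifoldCurve f r).IsPrimitive (Φ r)) :
    Tendsto (fun r => (conifoldCurve f r).freeEnergy (Φ r) g) (𝓝[≠] 0)
        (𝓝 (2 * (c3Curve f).freeEnergy Φ₃ g)) ∧
      ∀ r : ℂ, r ≠ 0 → r ≠ 1 → (f + 2 : ℂ) ^ 2 * r ≠ f ^ 2 →
        ∃ a₀ a₁ : ℂ, a₀ ≠ a₁ ∧ (conifoldCurve f r).ram = {a₀, a₁} ∧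
          r / a₀ = a₁ ∧ r / a₁ = a₀ ∧
          (conifoldCurve f r).contribution (Φ r) g a₀ =
            (conifoldCurve f r).contribution (Φ r) g a₁ ∧
          (conifoldCurve f r).freeEnergy (Φ r) g =
            2 * (conifoldCurve f r).contribution (Φ r) g a₀ := by
  constructor
  · have h := admissible_base hf0 hf1
    obtain ⟨y, l, hyl⟩ := h.exists_isCoordinate
    obtain ⟨E, hE, hev⟩ := hyl.exists_contribution_eq (g := g) (by omega)
    have hlim : (c3Curve f).freeEnergy Φ₃ g = E (-f / (f + 1)) := by
      have hc : c3Curve f = ramCurve f (-f / (f + 1)) := by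
        rw [c3Curve_eq hf0, ramCurve, ramParam_base hf1]
      rw [hc] at hΦ₃ ⊢
      rw [RationalCurve.freeEnergy, h.finsum_ram, if_pos (ramParam_base hf1), add_zero,
        (hev.self_of_nhds _ hΦ₃).1]
    have hfree : ∀ᶠ a in 𝓝 (-f / (f + 1) : ℂ), ramParam f a ≠ 0 →
        (conifoldCurve f (ramParam f a)).freeEnergy (Φ (ramParam f a)) g = 2 * E a := by
      filter_upwards [hev, h.eventually] with a ha aadm hr
      obtain ⟨e1, e2⟩ := ha _ (hΦ _ hr aadm.ramParam_ne_one aadm.disc_ramParam)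
      refine (aadm.finsum_ram fun b =>
        (ramCurve f a).contribution (Φ (ramParam f a)) g b).trans ?_
      rw [if_neg hr, e1, e2 hr, two_mul]
    rw [hlim]
    intro V hV
    have hcont : Tendsto (fun a => 2 * E a) (𝓝 (-f / (f + 1) : ℂ)) (𝓝 (2 * E (-f / (f + 1)))) :=
      continuousAt_const.mul hE.continuousAt
    -- The neighbourhood of r = 0 is the image of one of a₀, on which the free energy is 2E(a) away
    -- from r = 0.
    have hr : ∀ᶠ r in 𝓝 (0 : ℂ), r ≠ 0 → (conifoldCurve f r).freeEnergy (Φ r) g ∈ V := by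
      rw [← map_ramParam_base hf0 hf1, eventually_map]
      filter_upwards [hfree, hcont hV] with a h1 h2 h3
      rw [h1 h3]
      exact h2
    exact eventually_nhdsWithin_iff.2 hr
  · intro r hr h1 h2
    obtain ⟨a, h, rfl⟩ := exists_admissible hf1 hr h1 h2
    obtain ⟨y, l, hyl⟩ := h.exists_isCoordinate
    obtain ⟨E, hE, hev⟩ := hyl.exists_contribution_eq (g := g) (by omega)
    obtain ⟨e1, e2⟩ := hev.self_of_nhds _ (hΦ _ hr h1 h2)
    have ha := h.ne_zero
    have e3 := e2 hr
    have hne : a ≠ ramParam f a / a := by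
      rw [Ne, eq_div_iff ha]
      exact h.sq_ne_ramParam
    have hfree := h.finsum_ram fun b => (ramCurve f a).contribution (Φ (ramParam f a)) g b
    rw [if_neg hr] at hfree
    refine ⟨a, ramParam f a / a, hne, ?_, rfl, ?_, e1.trans e3.symm, ?_⟩
    · rw [h.ram_eq]
      ext t
      simp only [Set.mem_ofPred_eq, Set.mem_insert_iff, Set.mem_singleton_iff,
        and_iff_right_iff_imp]
      rintro (rfl | rfl)
      · exact ha
      · exact div_ne_zero hr ha
    · field_simp
    · exact hfree.trans (by rw [e3, two_mul]; exact congrArg₂ _ rfl e1.symm)
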